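/- Let $\mathbb T=\mathbb R/2\pi\mathbb Z$ with the metric $|e^{ix}-e^{iy}|$, and put $\|f\|_{\rm Lip}=\sup_{x\ne y}|f(x)-f(y)|/|e^{ix}-e^{iy}|$. Let $m\ge 1$, let $V\in\mathcal C^{m,1}(\mathbb T)$ be real-valued (that is, $V\in\mathcal C^m(\mathbb T)$ and $\|V^{(m)}\|_{\rm Lip}<\infty$), and let $\beta>0$. For a probability measure $\mu$ on $\mathbb T$ let $$F(\mu)=\beta\iint\log\Big|\sin\frac{x-y}2\Big|^{-1}\mu(dx)\mu(dy)+\mathcal K(\mu\,|\,\mu_0)\in[0,+\infty],\qquad \mu_0(dx)=e^{-V(x)}\frac{dx}{2\pi},$$ where $\mathcal K(\mu|\mu_0)=\int\log\frac{d\mu}{d\mu_0}\,d\mu+\mu_0(\mathbb T)-1$ is the relative entropy ($+\infty$ if $\mu\not\ll\mu_0$ or $\log\frac{d\mu}{d\mu_0}\notin L^1(\mu)$); it is the usual one when $V$ is normalised so that $\mu_0(\mathbb T)=1$, and the constant $\mu_0(\mathbb T)-1$ has no effect on minimizers. Then $F$ has a minimizer among all probability measures on $\mathbb T$ that is of the form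 $\rho(x)\,dx$ with a positive continuous density $\rho$. For every such minimizer $\mu=\rho\,dx$, let $$\mathsf H=\Big\{\psi\in L^2(\mathbb T):\ \psi'\in L^2(\mathbb T),\ \int\psi\,d\mu=0\Big\},\qquad \langle\phi,\psi\rangle=\int\phi'\psi'\,d\mu$$ (real-valued functions, distributional derivatives), and consider the expressions $$A\phi=-\phi''-(\log\rho)'\phi',\qquad L\phi=-\phi''-2\pi\beta\,H(\rho\phi')-(\log\rho)'\phi',$$ where $H\psi(x)=-\mathrm{p.v.}\int_{\mathbb T}\frac{\psi(t)}{\tan((x-t)/2)}\frac{dt}{2\pi}$. They induce operators $\mathscr A$ and $\mathscr L$ on $\mathsf H$, elements of $\mathsf H$ being regarded as functions modulo constants: for $u,f\in\mathsf H$, $\mathscr Lu=f$ means that $u\in\mathcal C^2(\mathbb T)$ and $Lu=f+c$ almost everywhere for some constant $c$ (necessarily $c=\int Lu\,d\mu$), and similarly for $\mathscr A$. Then $\mathsf H$ is a Hilbert space, and there are functions $\phi_j:\mathbb T\to\mathbb R$ ($j\ge1$) and real numbers $0<\varkappa_1\le\varkappa_2\le\cdots$ such that: (a) $\mathscr L\phi_j=\varkappa_j\phi_j$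 for every $j\ge1$. (b) $(\phi_j)_{j\ge1}$ is an orthonormal basis of $\mathsf H$. (c) There is $\alpha>0$ with $\varkappa_j\sim\alpha j^2$ as $j\to\infty$. It is the Weyl constant of the Sturm–Liouville operator: $\mathscr A$ has an orthonormal eigenbasis of $\mathsf H$ with eigenvalues $0<\lambda_1\le\lambda_2\le\cdots$, and $\lambda_j\sim\alpha j^2$ with the same $\alpha$. (d) The operator $\mathscr L$ has an inverse $\mathscr L^{-1}:\mathsf H\to\mathsf H$, that is, a bounded operator such that $\mathscr Lu=f$ if and only if $u=\mathscr L^{-1}f$, for all $u,f\in\mathsf H$. It is trace class, and for every $\psi\in\mathsf H$ $$\langle\psi,\mathscr L^{-1}\psi\rangle=\sum_{j\ge1}\frac1{\varkappa_j}|\langle\psi,\phi_j\rangle|^2 .$$ (e) $\phi_j\in\mathcal C^m(\mathbb T)$ for every $j$, and there are constants $C_0,\dots,C_m$ such that $\|\phi_j^{(k)}\|_{\rm Lip}\le C_k\,\varkappa_j^{(k+1)/2}$ for all $k\in\{0,\dots,m\}$ and all $j\ge1$. -/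

import Mathlib

open MeasureTheory Filter Topology Asymptotics
open scoped ENNReal ContDiff

noncomputable section

namespace CircleGas

instance twoPiPos : Fact ((0 : ℝ) < 2 * Real.pi) := ⟨Real.two_pi_pos⟩

/-- The torus `ℝ / 2πℤ`; its `volume` is the Lebesgue measure `dx`, of total mass `2π`. -/
abbrev Torus : Type := AddCircle (2 * Real.pi)

/-- The metric `|e^{ix} - e^{iy}|` on the torus. -/
def chord (x y : Torus) : ℝ :=
  ‖((AddCircle.toCircle x : Circle) : ℂ) - ((AddCircle.toCircle y : Circle) : ℂ)‖

/-- The derivative of a function on the torus. -/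
def tderiv (f : Torus → ℝ) (x : Torus) : ℝ := deriv (fun t : ℝ => f (x + (t : Torus))) 0

/-- `f` is of class `C^n` on the torus (`n` is a natural number, or `⊤` for smooth functions). -/
def TContDiff (n : ℕ∞) (f : Torus → ℝ) : Prop := ContDiff ℝ n (fun t : ℝ => f (t : Torus))

/-- `‖f‖_Lip ≤ K`, for the metric `|e^{ix} - e^{iy}|`. -/
def LipBound (f : Torus → ℝ) (K : ℝ) : Prop := ∀ x y : Torus, |f x - f y| ≤ K * chord x y

/-- The class `C^{m,1}` of the torus. -/
def IsCmLip (m : ℕ) (f : Torus → ℝ) : Prop :=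
  TContDiff m f ∧ ∃ K : ℝ, LipBound (tderiv^[m] f) K

/-! ### Energy, relative entropy, equilibrium density -/

/-- The reference measure `e^{-V(x)} dx / (2π)`. -/
def refMeasure (V : Torus → ℝ) : Measure Torus :=
  volume.withDensity (fun x => ENNReal.ofReal (Real.exp (-V x) / (2 * Real.pi)))

/-- The kernel `log |sin ((x - y) / 2)|⁻¹`, where `|sin ((x - y) / 2)| = |e^{ix} - e^{iy}| / 2`;
it is `+∞` on the diagonal. -/
def logKernel (x y : Torus) : ℝ≥0∞ :=
  open Classical in if x = y then ⊤ else ENNReal.ofReal (-Real.log (chord x y / 2))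

/-- The logarithmic energy, in `[0, +∞]`. -/
def logEnergy (ν : Measure Torus) : ℝ≥0∞ := ∫⁻ x, ∫⁻ y, logKernel x y ∂ν ∂ν

/-- The functional `β E(ν) + K(ν | e^{-V} dx / 2π)`. For a reference measure of mass one,
`klDiv` is the usual relative entropy `∫ log (dν / dμ₀) dν`; for another mass the two differ by the
constant `μ₀(𝕋) - 1`, so that the minimizers are the same. -/
def freeEnergy (β : ℝ) (V : Torus → ℝ) (ν : Measure Torus) : ℝ≥0∞ :=
  ENNReal.ofReal β * logEnergy ν + InformationTheory.klDiv ν (refMeasure V)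

/-- A positive continuous probability density on the torus, with respect to `dx`. -/
structure Density where
  toFun : Torus → ℝ
  continuous_toFun : Continuous toFun
  pos : ∀ x, 0 < toFun x
  integral_eq_one : ∫ x, toFun x = 1

/-- The probability measure `ρ(x) dx`. -/
def Density.measure (ρ : Density) : Measure Torus :=
  volume.withDensity (fun x => ENNReal.ofReal (ρ.toFun x))

/-- `ρ` is the density of an equilibrium measure: `ρ(x) dx` minimizes the free energy among all
probability measures on the torus. -/
def IsEquilibriumDensity (β : ℝ) (V : Torus → ℝ) (ρ : Density) : Prop :=
  ∀ ν : Measure Torus, IsProbabilityMeasure ν → freeEnergy β V ρ.measure ≤ freeEnergy β V ν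

/-! ### The Hilbert space -/

/-- Real-valued `L²(𝕋)`. -/
abbrev L2T : Type := Lp ℝ 2 (volume : Measure Torus)

/-- `g` is the distributional derivative of `f`. -/
def IsWeakDeriv (f g : L2T) : Prop :=
  ∀ η : Torus → ℝ, TContDiff ⊤ η → ∫ x, f x * tderiv η x = -∫ x, g x * η x

theorem TContDiff.continuous {n : ℕ∞} {f : Torus → ℝ} (h : TContDiff n f) : Continuous f := by
  have h1 : Continuous (fun t : ℝ => f (t : Torus)) := ContDiff.continuous h
  exact (QuotientAddGroup.isQuotientMap_mk _).continuous_iff.2 h1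

theorem tderiv_coe (f : Torus → ℝ) (s : ℝ) :
    tderiv f (s : Torus) = deriv (fun t : ℝ => f (t : Torus)) s := by
  have := deriv_comp_const_add (f := fun t : ℝ => f (t : Torus)) s 0
  simpa [tderiv] using this

theorem TContDiff.continuous_tderiv {f : Torus → ℝ} (h : TContDiff ⊤ f) :
    Continuous (tderiv f) := by
  have h1 : Continuous (deriv (fun t : ℝ => f (t : Torus))) :=
    ContDiff.continuous_deriv (n := ((⊤ : ℕ∞) : WithTop ℕ∞)) h (by exact_mod_cast le_top)
  refine (QuotientAddGroup.isQuotientMap_mk _).continuous_iff.2 ?_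
  have h2 : tderiv f ∘ (fun t : ℝ => (t : Torus)) = deriv (fun t : ℝ => f (t : Torus)) := by
    funext s; exact tderiv_coe f s
  exact h2.symm ▸ h1

theorem integrable_mul_continuous (f : L2T) {g : Torus → ℝ} (hg : Continuous g) :
    Integrable (fun x => f x * g x) := by
  have hf : Integrable (fun x => f x) :=
    memLp_one_iff_integrable.1 ((Lp.memLp f).mono_exponent (by norm_num))
  obtain ⟨C, hC⟩ := isCompact_univ.exists_bound_of_continuousOn (f := g) hg.continuousOn
  exact hf.mul_bdd (c := C) hg.aestronglyMeasurable
    (Filter.Eventually.of_forall fun x => hC x trivial)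

theorem integrable_mul_mul (f g : L2T) (ρ : Density) :
    Integrable (fun x => f x * g x * ρ.toFun x) := by
  have hfg : Integrable (fun x => f x * g x) := (Lp.memLp f).integrable_mul (Lp.memLp g)
  obtain ⟨C, hC⟩ := isCompact_univ.exists_bound_of_continuousOn (f := ρ.toFun)
    ρ.continuous_toFun.continuousOn
  exact hfg.mul_bdd (c := C) ρ.continuous_toFun.aestronglyMeasurable
    (Filter.Eventually.of_forall fun x => hC x trivial)

/-- The functions `ψ ∈ L²(𝕋)` with distributional derivative `ψ' ∈ L²(𝕋)` and `∫ ψ ρ dx = 0`,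
each recorded as the pair `(ψ, ψ')`. -/
def sobolevPairs (ρ : Density) : Submodule ℝ (L2T × L2T) where
  carrier := {p | IsWeakDeriv p.1 p.2 ∧ ∫ x, p.1 x * ρ.toFun x = 0}
  zero_mem' := by
    have h0 := Lp.coeFn_zero ℝ 2 (volume : Measure Torus)
    have key : ∀ g : Torus → ℝ, ∫ x, (0 : L2T) x * g x = 0 := fun g => by
      refine integral_eq_zero_of_ae ?_
      filter_upwards [h0] with x hx
      rw [hx]; simp
    refine ⟨fun η _ => ?_, key _⟩
    rw [Prod.fst_zero, Prod.snd_zero, key, key, neg_zero]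
  add_mem' := by
    intro p q hp hq
    have key : ∀ (f g : L2T) {h : Torus → ℝ}, Continuous h →
        ∫ x, (f + g : L2T) x * h x = (∫ x, f x * h x) + ∫ x, g x * h x := by
      intro f g h hh
      rw [← integral_add (integrable_mul_continuous f hh) (integrable_mul_continuous g hh)]
      refine integral_congr_ae ?_
      filter_upwards [Lp.coeFn_add f g] with x hx
      rw [hx, Pi.add_apply, add_mul]
    refine ⟨fun η hη => ?_, ?_⟩
    · rw [Prod.fst_add, Prod.snd_add, key _ _ hη.continuous_tderiv, key _ _ hη.continuous,
        hp.1 η hη, hq.1 η hη]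
      ring
    · change ∫ x, (p.1 + q.1 : L2T) x * ρ.toFun x = 0
      rw [key _ _ ρ.continuous_toFun, hp.2, hq.2, add_zero]
  smul_mem' := by
    intro c p hp
    have key : ∀ (f : L2T) (h : Torus → ℝ),
        ∫ x, (c • f : L2T) x * h x = c * ∫ x, f x * h x := by
      intro f h
      rw [← integral_const_mul]
      refine integral_congr_ae ?_
      filter_upwards [Lp.coeFn_smul c f] with x hx
      rw [hx, Pi.smul_apply, smul_eq_mul, mul_assoc]
    refine ⟨fun η hη => ?_, ?_⟩
    · rw [Prod.smul_fst, Prod.smul_snd, key, key, hp.1 η hη]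
      ring
    · change ∫ x, (c • p.1 : L2T) x * ρ.toFun x = 0
      rw [key, hp.2, mul_zero]

/-- The space of the `ψ ∈ L²(𝕋)` with `ψ' ∈ L²(𝕋)` and `∫ ψ ρ dx = 0`. It is a type of its own, and
not a subspace of `L²(𝕋) × L²(𝕋)`, because it carries another inner product. -/
def EnergySpace (ρ : Density) : Type := sobolevPairs ρ

instance (ρ : Density) : AddCommGroup (EnergySpace ρ) := inferInstanceAs (AddCommGroup (sobolevPairs ρ))

instance (ρ : Density) : Module ℝ (EnergySpace ρ) := inferInstanceAs (Module ℝ (sobolevPairs ρ))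

/-- The element of `L²(𝕋)` underlying an element of the space. -/
def EnergySpace.val {ρ : Density} (u : EnergySpace ρ) : L2T := Prod.fst (Subtype.val u)

/-- The distributional derivative of an element of the space. -/
def EnergySpace.wderiv {ρ : Density} (u : EnergySpace ρ) : L2T := Prod.snd (Subtype.val u)

theorem EnergySpace.wderiv_add {ρ : Density} (u w : EnergySpace ρ) :
    (u + w).wderiv = u.wderiv + w.wderiv := rfl

theorem EnergySpace.wderiv_smul {ρ : Density} (c : ℝ) (u : EnergySpace ρ) :
    (c • u).wderiv = c • u.wderiv := rfl

theorem EnergySpace.isWeakDeriv {ρ : Density} (u : EnergySpace ρ) : IsWeakDeriv u.val u.wderiv :=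
  (Subtype.property u).1

theorem EnergySpace.integral_mul_eq_zero {ρ : Density} (u : EnergySpace ρ) :
    ∫ x, u.val x * ρ.toFun x = 0 := (Subtype.property u).2

/-- A complex trigonometric monomial has smooth real and imaginary parts. -/
theorem tContDiff_fourier (L : ℂ →L[ℝ] ℝ) (n : ℤ) :
    TContDiff ⊤ (fun x : Torus => L (fourier n x)) ∧
      ∀ x : Torus, tderiv (fun x : Torus => L (fourier n x)) x
        = L (Complex.I * n * fourier n x) := by
  have hpi : (Real.pi : ℂ) ≠ 0 := by exact_mod_cast Real.pi_ne_zero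
  constructor
  · have : (fun t : ℝ => L (fourier n (t : Torus))) =
        fun t : ℝ => L (Complex.exp (Complex.I * n * t)) := by
      funext t
      rw [fourier_coe_apply]
      congr 2
      push_cast
      field_simp
    change ContDiff ℝ _ (fun t : ℝ => L (fourier n (t : Torus)))
    rw [this]
    exact L.contDiff.comp ((contDiff_const.mul Complex.ofRealCLM.contDiff).cexp)
  · intro x
    induction x using QuotientAddGroup.induction_on with
    | H s =>
      rw [tderiv_coe]
      have h1 := hasDerivAt_fourier (T := 2 * Real.pi) n s
      have h2 := (L.hasFDerivAt.comp_hasDerivAt s h1).deriv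
      refine Eq.trans h2 ?_
      congr 2
      push_cast
      field_simp

theorem ae_const_of_weakDeriv_zero {f : L2T} (h : IsWeakDeriv f 0) :
    ∃ c : ℝ, ∀ᵐ x, f x = c := by
  have hz : ∀ η : Torus → ℝ, TContDiff ⊤ η → ∫ x, f x * tderiv η x = 0 := by
    intro η hη
    rw [h η hη, neg_eq_zero]
    refine integral_eq_zero_of_ae ?_
    filter_upwards [Lp.coeFn_zero ℝ 2 (volume : Measure Torus)] with x hx
    rw [hx]; simp
  have hint : Integrable (fun x => f x) :=
    memLp_one_iff_integrable.1 ((Lp.memLp f).mono_exponent (by norm_num))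
  have hfC : MemLp (fun x => ((f x : ℝ) : ℂ)) 2 (volume : Measure Torus) :=
    (Lp.memLp f).ofReal
  have hF : MemLp (fun x => ((f x : ℝ) : ℂ)) 2 (AddCircle.haarAddCircle : Measure Torus) :=
    memLp_haarAddCircle_iff.2 hfC
  -- the nonzero Fourier coefficients vanish
  have hint0 : ∀ n : ℤ, Integrable (fun x : Torus => ((f x : ℝ) : ℂ) * fourier n x) := by
    intro n
    exact hint.ofReal.mul_bdd (c := 1) (map_continuous (fourier n)).aestronglyMeasurable
      (Filter.Eventually.of_forall fun x => by
        rw [fourier_apply]; exact (Circle.norm_coe _).le)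
  have hcoef : ∀ n : ℤ, n ≠ 0 → ∫ x : Torus, ((f x : ℝ) : ℂ) * fourier n x = 0 := by
    intro n hn
    have hL : ∀ L : ℂ →L[ℝ] ℝ,
        L (Complex.I * n * ∫ x : Torus, ((f x : ℝ) : ℂ) * fourier n x) = 0 := by
      intro L
      rw [← integral_const_mul, ← L.integral_comp_comm ((hint0 n).const_mul _),
        ← hz _ (tContDiff_fourier L n).1]
      refine integral_congr_ae (Filter.Eventually.of_forall fun x => ?_)
      simp only
      rw [(tContDiff_fourier L n).2 x, ← smul_eq_mul (f x), ← L.map_smul, Complex.real_smul]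
      congr 1
      ring
    have hzero : Complex.I * n * ∫ x : Torus, ((f x : ℝ) : ℂ) * fourier n x = 0 :=
      Complex.ext (hL Complex.reCLM) (hL Complex.imCLM)
    have hne : Complex.I * (n : ℂ) ≠ 0 := mul_ne_zero Complex.I_ne_zero (by exact_mod_cast hn)
    exact (mul_eq_zero.1 hzero).resolve_left hne
  set F : Lp ℂ 2 (AddCircle.haarAddCircle : Measure Torus) := hF.toLp _ with hFdef
  have hFc : ∀ n : ℤ, n ≠ 0 → fourierBasis.repr F n = 0 := by
    intro n hn
    rw [fourierBasis_repr, fourierCoeff_congr_ae hF.coeFn_toLp, fourierCoeff,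
      AddCircle.integral_haarAddCircle]
    have := hcoef (-n) (neg_ne_zero.2 hn)
    simp only [smul_eq_mul]
    simp_rw [mul_comm (fourier (-n) _)]
    rw [this, smul_zero]
  have hsum : F = fourierBasis.repr F 0 • fourierLp 2 0 := by
    have h1 := (fourierBasis (T := 2 * Real.pi)).hasSum_repr F
    have h2 := hasSum_single (f := fun i : ℤ => 
        (fourierBasis (T := 2 * Real.pi)).repr F i • (fourierBasis (T := 2 * Real.pi)) i) 0
      (fun n hn => by simp only [hFc n hn, zero_smul])
    have h3 := h1.unique h2
    rwa [coe_fourierBasis] at h3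
  refine ⟨(fourierBasis.repr F 0).re, ?_⟩
  have hac : (volume : Measure Torus) ≪ AddCircle.haarAddCircle := by
    rw [AddCircle.volume_eq_smul_haarAddCircle]
    exact Measure.smul_absolutelyContinuous
  have hae : ∀ᵐ x ∂(AddCircle.haarAddCircle : Measure Torus),
      ((f x : ℝ) : ℂ) = fourierBasis.repr F 0 := by
    have e1 := hF.coeFn_toLp
    have e2 := Lp.coeFn_smul (fourierBasis.repr F 0)
      (fourierLp (T := 2 * Real.pi) 2 0)
    have e3 := coeFn_fourierLp (T := 2 * Real.pi) 2 0
    rw [← hsum] at e2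
    filter_upwards [e1, e2, e3] with x h1 h2 h3
    rw [← h1]
    rw [← hFdef, h2, Pi.smul_apply, h3]
    simp
  filter_upwards [hac.ae_le hae] with x hx
  rw [← hx, Complex.ofReal_re]

/-- The inner product `⟨φ, ψ⟩ = ∫ φ' ψ' ρ dx`. -/
abbrev hCore (ρ : Density) : InnerProductSpace.Core ℝ (EnergySpace ρ) where
  inner u w := ∫ x, u.wderiv x * w.wderiv x * ρ.toFun x
  conj_inner_symm u w := by
    simp only [conj_trivial]
    congr 1; funext x; ring
  re_inner_nonneg u := by
    simp only [RCLike.re_to_real]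
    exact integral_nonneg fun x => mul_nonneg (mul_self_nonneg _) (ρ.pos x).le
  add_left u w z := by
    rw [← integral_add (integrable_mul_mul _ _ ρ) (integrable_mul_mul _ _ ρ)]
    refine integral_congr_ae ?_
    rw [EnergySpace.wderiv_add]
    filter_upwards [Lp.coeFn_add u.wderiv w.wderiv] with x hx
    rw [hx, Pi.add_apply]; ring
  smul_left u w c := by
    simp only [conj_trivial]
    rw [← integral_const_mul]
    refine integral_congr_ae ?_
    rw [EnergySpace.wderiv_smul]
    filter_upwards [Lp.coeFn_smul c u.wderiv] with x hx
    rw [hx, Pi.smul_apply, smul_eq_mul]; ring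
  definite u hu := by
    have h1 : (fun x => u.wderiv x * u.wderiv x * ρ.toFun x) =ᵐ[volume] 0 :=
      (integral_eq_zero_iff_of_nonneg
        (fun x => mul_nonneg (mul_self_nonneg _) (ρ.pos x).le) (integrable_mul_mul _ _ ρ)).1 hu
    have h2 : u.wderiv = 0 := by
      refine Lp.ext ?_
      filter_upwards [h1, Lp.coeFn_zero ℝ 2 (volume : Measure Torus)] with x hx h0
      rw [h0]
      simpa [(ρ.pos x).ne'] using hx
    obtain ⟨c, hc⟩ := ae_const_of_weakDeriv_zero (h2 ▸ u.isWeakDeriv)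
    have h3 : c = 0 := by
      have h4 := u.integral_mul_eq_zero
      have h5 : ∫ x, u.val x * ρ.toFun x = ∫ x, c * ρ.toFun x :=
        integral_congr_ae (by filter_upwards [hc] with x hx; rw [hx])
      rw [h5, integral_const_mul, ρ.integral_eq_one, mul_one] at h4
      exact h4
    have h6 : u.val = 0 := by
      refine Lp.ext ?_
      filter_upwards [hc, Lp.coeFn_zero ℝ 2 (volume : Measure Torus)] with x hx h0
      rw [h0, hx, h3]; rfl
    exact Subtype.ext (Prod.ext h6 h2)

instance (ρ : Density) : NormedAddCommGroup (EnergySpace ρ) := (hCore ρ).toNormedAddCommGroup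

instance (ρ : Density) : InnerProductSpace ℝ (EnergySpace ρ) :=
  InnerProductSpace.ofCore (hCore ρ).toCore

/-! ### The operators -/

/-- The Hilbert transform `- p.v. ∫ ψ(t) / tan ((x - t) / 2) dt / (2π)`, the principal value being
the limit as `ε → 0` of the integral over `|e^{ix} - e^{it}| > ε`. The integral is written in
the variable `s = x - t`, with `s ∈ (-π, π)`. -/
def hilbertTransform (ψ : Torus → ℝ) (x : Torus) : ℝ :=
  -limUnder (𝓝[>] (0 : ℝ)) (fun ε : ℝ =>
    (∫ s in {s : ℝ | s ∈ Set.Ioo (-Real.pi) Real.pi ∧ ε < chord (s : Torus) 0},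
      ψ (x - (s : Torus)) / Real.tan (s / 2)) / (2 * Real.pi))

/-- The Sturm–Liouville expression `-φ'' - (log ρ)' φ'`. -/
def sturmLiouvilleExpr (ρ : Density) (φ : Torus → ℝ) (x : Torus) : ℝ :=
  -(tderiv (tderiv φ) x + tderiv (fun y => Real.log (ρ.toFun y)) x * tderiv φ x)

/-- The expression `-(φ'' + 2πβ H(ρ φ') + (log ρ)' φ')`. -/
def opExpr (β : ℝ) (ρ : Density) (φ : Torus → ℝ) (x : Torus) : ℝ :=
  -(tderiv (tderiv φ) x
      + 2 * Real.pi * β * hilbertTransform (fun y => ρ.toFun y * tderiv φ y) x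
      + tderiv (fun y => Real.log (ρ.toFun y)) x * tderiv φ x)

/-- The graph of the operator that an expression `T` induces on the Hilbert space: `u` is of class
`C²` and `T u = f` up to an additive constant. The constant is `∫ T u ρ dx`: an element of the
space has mean zero, and its inner products only see its derivative. -/
def InducedGraph {ρ : Density} (T : (Torus → ℝ) → Torus → ℝ) (u f : EnergySpace ρ) : Prop :=
  ∃ v : Torus → ℝ, TContDiff 2 v ∧ (∀ᵐ x, u.val x = v x) ∧ ∃ c : ℝ, ∀ᵐ x, T v x = f.val x + c

/-- `b` is an orthonormal eigenbasis of the operator induced by `T`, for the nondecreasing sequence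
`κ` of positive eigenvalues. -/
structure IsEigenbasis {ρ : Density} (T : (Torus → ℝ) → Torus → ℝ)
    (b : HilbertBasis ℕ ℝ (EnergySpace ρ)) (κ : ℕ → ℝ) : Prop where
  pos : ∀ j, 0 < κ j
  mono : Monotone κ
  eigen : ∀ j, InducedGraph T (b j) (κ j • b j)

/-- Trace class operators of a Hilbert space: the sums `∑ ⟨x_n, ·⟩ y_n` with
`∑ ‖x_n‖ ‖y_n‖ < ∞`. -/
def IsTraceClass {E : Type*} [NormedAddCommGroup E] [InnerProductSpace ℝ E] (G : E →L[ℝ] E) :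
    Prop :=
  ∃ x y : ℕ → E, Summable (fun n => ‖x n‖ * ‖y n‖) ∧
    ∀ v, HasSum (fun n => inner ℝ (x n) v • y n) (G v)

end CircleGas

end

open CircleGas

/-! Equilibrium. The logarithmic kernel acts on Fourier coefficients by the positive multiplier
`khat`, so the energy is a positive quadratic form on differences of probability measures
(`two_mul_mutualEnergy_le`). If log ρ = c - V - 2βU, where U is the potential of ρ, expanding the
free energy around ρ dx gives F(ν) ≥ F(ρ dx) + K(ν | ρ dx) (`EulerLagrange.freeEnergy_le`). Hence ρ
dx is a minimizer, and any other equilibrium density is equal to ρ, so it solves the same equation.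
To solve the equation, one finds for each s ≥ 0 a solution of f = s exp(-V - 2βU_f) by strong
monotonicity, and then chooses s by the intermediate value theorem so that f has mass one
(`exists_eulerLagrange`). Since U' = πHρ, differentiation gives ρ' = -ρV' - 2πβ ρHρ; as H preserves
Sobolev regularity, ρ inherits the class C^m from V.

Inverse. In terms of the flux g = ρu', Lu = -g'/ρ - 2πβ Hg. Put a = -g'/√ρ. Multiplying Lu = f +
const by √ρ and projecting off √ρ, which removes the constant, turns the problem into (1 + P)a = √ρ
f, with P = `perturb`. The crux is that H d/dx = -|d/dx|, so that ⟨Pa, b⟩ = 2πβ ∑ |n| g_a(n) g_b(n)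
(`hasSum_inner_perturb`): P is symmetric and nonnegative, and 1 + P ≥ 1 is invertible. Moreover a ↦
u is the adjoint of the compact embedding E : u ↦ √ρ u of the energy space into L². Therefore L⁻¹ =
E*(1 + P)⁻¹E, which is `green`, is compact, self-adjoint and positive, and an eigenbasis follows
from the spectral theorem. The Sturm–Liouville operator is the case β = 0, where P = 0.

Asymptotics. The map u ↦ h = √ρ u' is an isometry onto a hyperplane of L². One has a = -h' + O(‖h‖)
and Pa = O(‖h‖), so both operators are -d²/dx² acting on h, up to terms of lower order. A min-max
comparison with the trigonometric polynomials of degree M, a space of dimension 2M + 1, gives √ϰ_j =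
j/2 + O(1). The Weyl constant is thus 1/4 for both operators, and L⁻¹ is trace class.

Regularity. The eigenvalue equation expresses (ρφ')' through ρφ', φ and ρ. With w = √ϰ, up to a
constant, as the price of one derivative, ‖φ‖ = O(1/w) in L² and ‖φ'‖ = O(1); induction bounds all
the derivatives in L², and the Sobolev embedding converts these bounds into uniform ones without
loss, because ‖φ‖ is already one power of w better than the bound sought. -/

noncomputable section

namespace CircleGas

/-! ### The real trigonometric system `cos nx + sin nx` -/

/-- The function `cos nx + sin nx`, for `n ∈ ℤ`. -/
def cas (n : ℤ) : C(Torus, ℝ) where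
  toFun x := (fourier n x).re + (fourier n x).im
  continuous_toFun := by
    have := map_continuous (fourier (T := 2 * Real.pi) n)
    exact (Complex.continuous_re.comp this).add (Complex.continuous_im.comp this)

theorem cas_apply (n : ℤ) (x : Torus) : cas n x = (fourier n x).re + (fourier n x).im := rfl

theorem fourier_coe_eq (n : ℤ) (t : ℝ) :
    fourier n (t : Torus) = Complex.exp ((n * t : ℝ) * Complex.I) := by
  have hpi : (Real.pi : ℂ) ≠ 0 := by exact_mod_cast Real.pi_ne_zero
  rw [fourier_coe_apply]
  congr 1
  push_cast
  field_simp

theorem fourier_re_coe (n : ℤ) (t : ℝ) : (fourier n (t : Torus)).re = Real.cos (n * t) := by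
  rw [fourier_coe_eq, Complex.exp_ofReal_mul_I_re]

theorem fourier_im_coe (n : ℤ) (t : ℝ) : (fourier n (t : Torus)).im = Real.sin (n * t) := by
  rw [fourier_coe_eq, Complex.exp_ofReal_mul_I_im]

theorem cas_coe (n : ℤ) (t : ℝ) : cas n (t : Torus) = Real.cos (n * t) + Real.sin (n * t) := by
  rw [cas_apply, fourier_re_coe, fourier_im_coe]

theorem cas_neg_coe (n : ℤ) (t : ℝ) :
    cas (-n) (t : Torus) = Real.cos (n * t) - Real.sin (n * t) := by
  rw [cas_coe]; push_cast
  rw [neg_mul, Real.cos_neg, Real.sin_neg]; ring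

theorem cas_zero (x : Torus) : cas 0 x = 1 := by
  rw [cas_apply, fourier_zero]; simp

theorem abs_cas_le (n : ℤ) (x : Torus) : |cas n x| ≤ 2 := by
  induction x using QuotientAddGroup.induction_on with
  | H t =>
    rw [cas_coe]
    have h1 := Real.abs_cos_le_one (n * t)
    have h2 := Real.abs_sin_le_one (n * t)
    exact (abs_add_le _ _).trans (by linarith)

theorem tContDiff_cas (n : ℤ) : TContDiff ⊤ (cas n) := by
  have : (fun t : ℝ => cas n (t : Torus)) = fun t : ℝ => Real.cos (n * t) + Real.sin (n * t) :=
    funext (cas_coe n)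
  unfold TContDiff
  rw [this]
  exact ((Real.contDiff_cos.comp (contDiff_const.mul contDiff_id)).add
    (Real.contDiff_sin.comp (contDiff_const.mul contDiff_id)))

/-- This is why cosine and sine are merged into one real system indexed by ℤ: differentiation is a
multiplier composed with the reflection n ↦ -n, and so are the Hilbert transform and the
antiderivative. -/
theorem hasDerivAt_cas (n : ℤ) (t : ℝ) :
    HasDerivAt (fun t : ℝ => cas n (t : Torus)) (n * cas (-n) (t : Torus)) t := by
  have : (fun t : ℝ => cas n (t : Torus)) = fun t : ℝ => Real.cos (n * t) + Real.sin (n * t) :=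
    funext (cas_coe n)
  rw [this, cas_neg_coe]
  have h1 : HasDerivAt (fun t : ℝ => (n : ℝ) * t) n t := by
    simpa using (hasDerivAt_id t).const_mul (n : ℝ)
  exact (h1.cos.add h1.sin).congr_deriv (by ring)

theorem tderiv_cas (n : ℤ) (x : Torus) : tderiv (cas n) x = n * cas (-n) x := by
  induction x using QuotientAddGroup.induction_on with
  | H t => exact (tderiv_coe _ t).trans (hasDerivAt_cas n t).deriv

theorem integrable_continuous {E : Type*} [NormedAddCommGroup E] {f : Torus → E}
    (hf : Continuous f) : Integrable f :=
  hf.integrable_of_hasCompactSupport (HasCompactSupport.of_compactSpace f)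

theorem integral_fourier (k : ℤ) :
    ∫ x : Torus, (fourier k x : ℂ) = if k = 0 then (2 * Real.pi : ℂ) else 0 := by
  have h := fourierCoeff_fourier (T := 2 * Real.pi) k
  have h0 := congrFun h 0
  rw [fourierCoeff, AddCircle.integral_haarAddCircle] at h0
  simp only [neg_zero, fourier_zero, one_smul] at h0
  have hpi : (2 * Real.pi : ℝ) ≠ 0 := Real.two_pi_pos.ne'
  rw [inv_smul_eq_iff₀ hpi] at h0
  rw [h0]
  by_cases hk : k = 0
  · subst hk; simp
  · simp [hk, Ne.symm hk]

theorem integral_cas_mul_cas (n m : ℤ) :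
    ∫ x : Torus, cas n x * cas m x = if n = m then 2 * Real.pi else 0 := by
  have h1 : ∀ x : Torus, cas n x * cas m x = (fourier (n - m) x).re + (fourier (n + m) x).im := by
    intro x
    induction x using QuotientAddGroup.induction_on with
    | H t =>
      rw [cas_coe, cas_coe, fourier_re_coe, fourier_im_coe]
      push_cast
      rw [sub_mul, add_mul (n : ℝ) (m : ℝ) t, Real.cos_sub, Real.sin_add]; ring
  have hc : ∀ k : ℤ, Integrable (fun x : Torus => (fourier k x : ℂ)) := fun k =>
    integrable_continuous (map_continuous (fourier (T := 2 * Real.pi) k))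
  have hre : ∀ k : ℤ, ∫ x : Torus, (fourier k x : ℂ).re = (∫ x : Torus, (fourier k x : ℂ)).re :=
    fun k => Complex.reCLM.integral_comp_comm (hc k)
  have him : ∀ k : ℤ, ∫ x : Torus, (fourier k x : ℂ).im = (∫ x : Torus, (fourier k x : ℂ)).im :=
    fun k => Complex.imCLM.integral_comp_comm (hc k)
  simp_rw [h1]
  refine (integral_add (hc (n - m)).re (hc (n + m)).im).trans ?_
  refine (congrArg₂ (· + ·) (hre (n - m)) (him (n + m))).trans ?_
  rw [integral_fourier, integral_fourier]
  by_cases h : n = m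
  · subst h
    by_cases h' : n + n = 0 <;> simp [h']
  · have : n - m ≠ 0 := sub_ne_zero.2 h
    by_cases h' : n + m = 0 <;> simp [h, h', this]

/-! ### `L²` -/

/-- The class in `L²` of a continuous function. -/
abbrev toL2 : C(Torus, ℝ) →L[ℝ] L2T := ContinuousMap.toLp 2 volume ℝ

theorem coeFn_toL2 (f : C(Torus, ℝ)) : ⇑(toL2 f) =ᵐ[volume] f :=
  ContinuousMap.coeFn_toLp (𝕜 := ℝ) volume f

theorem l2_inner (f g : L2T) : inner ℝ f g = ∫ x, f x * g x := by
  rw [L2.inner_def]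
  congr 1; funext x
  simp [mul_comm]

theorem l2_norm_sq (f : L2T) : ‖f‖ ^ 2 = ∫ x, f x * f x := by
  rw [← l2_inner, real_inner_self_eq_norm_sq]

theorem integrable_l2 (f : L2T) : Integrable (fun x => f x) :=
  memLp_one_iff_integrable.1 ((Lp.memLp f).mono_exponent (by norm_num))

theorem l2_ext_continuous {f g : L2T} {F : Torus → ℝ} (hf : f =ᵐ[volume] F)
    (hg : g =ᵐ[volume] F) : f = g := Lp.ext (hf.trans hg.symm)

theorem inner_toL2 (f : L2T) (g : C(Torus, ℝ)) : inner ℝ f (toL2 g) = ∫ x, f x * g x := by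
  rw [l2_inner]
  refine integral_congr_ae ?_
  filter_upwards [coeFn_toL2 g] with x hx
  rw [hx]

/-- The integrals against `cas n` and `cas (-n)` are the sum and the difference of the real and
imaginary parts of a complex Fourier coefficient, so completeness carries over from the
exponentials. -/
theorem eq_zero_of_integral_cas {f : L2T} (h : ∀ n, ∫ x, f x * cas n x = 0) : f = 0 := by
  have hint := integrable_l2 f
  have hfC : MemLp (fun x => ((f x : ℝ) : ℂ)) 2 (volume : Measure Torus) := (Lp.memLp f).ofReal
  have hF : MemLp (fun x => ((f x : ℝ) : ℂ)) 2 (AddCircle.haarAddCircle : Measure Torus) :=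
    memLp_haarAddCircle_iff.2 hfC
  have hint0 : ∀ n : ℤ, Integrable (fun x : Torus => ((f x : ℝ) : ℂ) * fourier n x) := by
    intro n
    exact hint.ofReal.mul_bdd (c := 1) (map_continuous (fourier n)).aestronglyMeasurable
      (Filter.Eventually.of_forall fun x => by
        rw [fourier_apply]; exact (Circle.norm_coe _).le)
  have hcas : ∀ n (x : Torus), cas (-n) x = (fourier n x).re - (fourier n x).im := by
    intro n x
    rw [cas_apply, fourier_neg]; simp [sub_eq_add_neg]
  have hcoef : ∀ n : ℤ, ∫ x : Torus, ((f x : ℝ) : ℂ) * fourier n x = 0 := by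
    intro n
    have e1 : (∫ x : Torus, ((f x : ℝ) : ℂ) * fourier n x).re = ∫ x, f x * (fourier n x).re := by
      refine (Complex.reCLM.integral_comp_comm (hint0 n)).symm.trans ?_
      congr 1; funext x; simp
    have e2 : (∫ x : Torus, ((f x : ℝ) : ℂ) * fourier n x).im = ∫ x, f x * (fourier n x).im := by
      refine (Complex.imCLM.integral_comp_comm (hint0 n)).symm.trans ?_
      congr 1; funext x; simp
    have i1 : Integrable (fun x => f x * (fourier n x).re) := by
      simpa using (hint0 n).re
    have i2 : Integrable (fun x => f x * (fourier n x).im) := by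
      simpa using (hint0 n).im
    have h1 := h n
    have h2 := h (-n)
    simp_rw [cas_apply, mul_add] at h1
    simp_rw [hcas, mul_sub] at h2
    rw [integral_add i1 i2] at h1
    rw [integral_sub i1 i2] at h2
    refine Complex.ext ?_ ?_
    · rw [e1, Complex.zero_re]; linarith
    · rw [e2, Complex.zero_im]; linarith
  set F : Lp ℂ 2 (AddCircle.haarAddCircle : Measure Torus) := hF.toLp _ with hFdef
  have hF0 : F = 0 := by
    have h1 := (fourierBasis (T := 2 * Real.pi)).hasSum_repr F
    have h2 : ∀ n, fourierBasis.repr F n = 0 := by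
      intro n
      rw [fourierBasis_repr, fourierCoeff_congr_ae hF.coeFn_toLp, fourierCoeff,
        AddCircle.integral_haarAddCircle]
      have := hcoef (-n)
      simp only [smul_eq_mul]
      simp_rw [mul_comm (fourier (-n) _)]
      rw [this, smul_zero]
    simp only [h2, zero_smul] at h1
    exact h1.unique hasSum_zero
  have hac : (volume : Measure Torus) ≪ AddCircle.haarAddCircle := by
    rw [AddCircle.volume_eq_smul_haarAddCircle]
    exact Measure.smul_absolutelyContinuous
  refine Lp.ext ?_
  have e1 := hF.coeFn_toLp
  rw [← hFdef, hF0] at e1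
  filter_upwards [hac.ae_le e1, hac.ae_le (Lp.coeFn_zero ℂ 2 (AddCircle.haarAddCircle : Measure Torus)),
    Lp.coeFn_zero ℝ 2 (volume : Measure Torus)] with x h1 h2 h3
  rw [h2] at h1
  rw [h3]
  simpa using h1.symm

/-- The normalising constant of the system. -/
def casNorm : ℝ := (Real.sqrt (2 * Real.pi))⁻¹

theorem casNorm_pos : 0 < casNorm := inv_pos.2 (Real.sqrt_pos.2 Real.two_pi_pos)

theorem casNorm_sq : casNorm * casNorm * (2 * Real.pi) = 1 := by
  unfold casNorm
  rw [← mul_inv, Real.mul_self_sqrt Real.two_pi_pos.le]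
  exact inv_mul_cancel₀ Real.two_pi_pos.ne'

theorem orthonormal_cas : Orthonormal ℝ (fun n : ℤ => toL2 (casNorm • cas n)) := by
  rw [orthonormal_iff_ite]
  intro n m
  rw [inner_toL2]
  have : ∫ x, (toL2 (casNorm • cas n)) x * (casNorm • cas m) x
      = ∫ x, casNorm * casNorm * (cas n x * cas m x) := by
    refine integral_congr_ae ?_
    filter_upwards [coeFn_toL2 (casNorm • cas n)] with x hx
    rw [hx]
    simp only [ContinuousMap.coe_smul, Pi.smul_apply, smul_eq_mul]; ring
  rw [this, integral_const_mul, integral_cas_mul_cas]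
  split_ifs
  · exact casNorm_sq
  · simp

/-- The trigonometric Hilbert basis of `L²(𝕋)`. -/
def casBasis : HilbertBasis ℤ ℝ L2T :=
  HilbertBasis.mkOfOrthogonalEqBot orthonormal_cas (by
    rw [Submodule.eq_bot_iff]
    intro f hf
    refine eq_zero_of_integral_cas fun n => ?_
    have h1 : inner ℝ (toL2 (casNorm • cas n)) f = 0 :=
      (Submodule.mem_orthogonal _ _).1 hf _ (Submodule.subset_span ⟨n, rfl⟩)
    rw [real_inner_comm, inner_toL2] at h1
    have h2 : ∫ x, f x * (casNorm • cas n) x = casNorm * ∫ x, f x * cas n x := by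
      rw [← integral_const_mul]
      congr 1; funext x
      simp only [ContinuousMap.coe_smul, Pi.smul_apply, smul_eq_mul]; ring
    rw [h2] at h1
    exact (mul_eq_zero.1 h1).resolve_left casNorm_pos.ne')

theorem casBasis_apply (n : ℤ) : casBasis n = toL2 (casNorm • cas n) := by
  unfold casBasis
  rw [HilbertBasis.coe_mkOfOrthogonalEqBot]

/-- The coefficients of a function in the trigonometric system. -/
def casCoeff (f : Torus → ℝ) (n : ℤ) : ℝ := casNorm * ∫ x, f x * cas n x

theorem casCoeff_congr {f g : Torus → ℝ} (h : f =ᵐ[volume] g) (n : ℤ) :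
    casCoeff f n = casCoeff g n := by
  unfold casCoeff
  congr 1
  refine integral_congr_ae ?_
  filter_upwards [h] with x hx
  rw [hx]

theorem inner_casBasis (f : L2T) (n : ℤ) : inner ℝ (casBasis n) f = casCoeff f n := by
  rw [casBasis_apply, real_inner_comm, inner_toL2, casCoeff, ← integral_const_mul]
  congr 1; funext x
  simp only [ContinuousMap.coe_smul, Pi.smul_apply, smul_eq_mul]; ring

theorem casBasis_repr (f : L2T) (n : ℤ) : casBasis.repr f n = casCoeff f n := by
  rw [HilbertBasis.repr_apply_apply, inner_casBasis]

theorem casCoeff_ext {f g : L2T} (h : ∀ n, casCoeff f n = casCoeff g n) : f = g := by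
  refine casBasis.repr.injective (lp.ext (funext fun n => ?_))
  rw [casBasis_repr, casBasis_repr, h]

theorem casCoeff_add (f g : L2T) (n : ℤ) :
    casCoeff (f + g : L2T) n = casCoeff f n + casCoeff g n := by
  simp only [← inner_casBasis, inner_add_right]

theorem casCoeff_sub (f g : L2T) (n : ℤ) :
    casCoeff (f - g : L2T) n = casCoeff f n - casCoeff g n := by
  simp only [← inner_casBasis, inner_sub_right]

theorem casCoeff_smul (c : ℝ) (f : L2T) (n : ℤ) :
    casCoeff (c • f : L2T) n = c * casCoeff f n := by
  simp only [← inner_casBasis, inner_smul_right]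

theorem casCoeff_casBasis (m n : ℤ) :
    casCoeff (casBasis m) n = if n = m then 1 else 0 := by
  rw [← inner_casBasis, orthonormal_iff_ite.1 casBasis.orthonormal]

theorem hasSum_casCoeff_mul (f g : L2T) :
    HasSum (fun n => casCoeff f n * casCoeff g n) (inner ℝ f g) := by
  have := casBasis.hasSum_inner_mul_inner f g
  simp only [inner_casBasis, real_inner_comm (casBasis _) f] at this
  exact this

theorem hasSum_casCoeff_sq (f : L2T) : HasSum (fun n => casCoeff f n ^ 2) (‖f‖ ^ 2) := by
  have := hasSum_casCoeff_mul f f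
  rw [real_inner_self_eq_norm_sq] at this
  simpa only [sq] using this

theorem exists_l2_of_summable {a : ℤ → ℝ} (ha : Summable fun n => a n ^ 2) :
    ∃ f : L2T, ∀ n, casCoeff f n = a n := by
  have hm : Memℓp a 2 := by
    refine memℓp_gen ?_
    simpa using ha
  refine ⟨casBasis.repr.symm ⟨a, hm⟩, fun n => ?_⟩
  rw [← casBasis_repr, LinearIsometryEquiv.apply_symm_apply]

/-! ### Multipliers -/

theorem summable_mul_casCoeff_sq (σ : Equiv.Perm ℤ) {m : ℤ → ℝ} {C : ℝ} (h : ∀ n, |m n| ≤ C)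
    (f : L2T) : Summable fun n => (m n * casCoeff f (σ n)) ^ 2 := by
  have h1 : Summable fun n => C ^ 2 * casCoeff f (σ n) ^ 2 :=
    ((σ.summable_iff (f := fun n => casCoeff f n ^ 2)).2 (hasSum_casCoeff_sq f).summable).mul_left _
  refine h1.of_nonneg_of_le (fun n => sq_nonneg _) fun n => ?_
  rw [mul_pow]
  exact mul_le_mul_of_nonneg_right (sq_le_sq' (abs_le.1 (h n)).1 (abs_le.1 (h n)).2) (sq_nonneg _)

/-- The operator with coefficients `a_n ↦ m_n a_{σ(n)}`. -/
def mulOp (σ : Equiv.Perm ℤ) (m : ℤ → ℝ) (C : ℝ) (h : ∀ n, |m n| ≤ C) : L2T →L[ℝ] L2T :=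
  LinearMap.mkContinuous
    { toFun := fun f => (exists_l2_of_summable (summable_mul_casCoeff_sq σ h f)).choose
      map_add' := fun f g => casCoeff_ext fun n => by
        rw [casCoeff_add, (exists_l2_of_summable (summable_mul_casCoeff_sq σ h _)).choose_spec,
          (exists_l2_of_summable (summable_mul_casCoeff_sq σ h _)).choose_spec,
          (exists_l2_of_summable (summable_mul_casCoeff_sq σ h _)).choose_spec, casCoeff_add]
        ring
      map_smul' := fun c f => casCoeff_ext fun n => by
        rw [RingHom.id_apply, casCoeff_smul,
          (exists_l2_of_summable (summable_mul_casCoeff_sq σ h _)).choose_spec,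
          (exists_l2_of_summable (summable_mul_casCoeff_sq σ h _)).choose_spec, casCoeff_smul]
        ring } C fun f => by
    have hC : 0 ≤ C := (abs_nonneg _).trans (h 0)
    refine abs_le_of_sq_le_sq' ?_ (by positivity) |>.2
    rw [mul_pow]
    have h1 := (σ.hasSum_iff (f := fun n => casCoeff f n ^ 2)).2 (hasSum_casCoeff_sq f)
    refine hasSum_le (fun n => ?_) (hasSum_casCoeff_sq _) (h1.mul_left (C ^ 2))
    simp only [LinearMap.coe_mk, AddHom.coe_mk, Function.comp_apply]
    rw [(exists_l2_of_summable (summable_mul_casCoeff_sq σ h f)).choose_spec, mul_pow]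
    exact mul_le_mul_of_nonneg_right (sq_le_sq' (abs_le.1 (h n)).1 (abs_le.1 (h n)).2)
      (sq_nonneg _)

theorem casCoeff_mulOp (σ : Equiv.Perm ℤ) (m : ℤ → ℝ) (C : ℝ) (h : ∀ n, |m n| ≤ C) (f : L2T)
    (n : ℤ) : casCoeff (mulOp σ m C h f) n = m n * casCoeff f (σ n) :=
  (exists_l2_of_summable (summable_mul_casCoeff_sq σ h f)).choose_spec n

theorem norm_mulOp_le (σ : Equiv.Perm ℤ) (m : ℤ → ℝ) (C : ℝ) (h : ∀ n, |m n| ≤ C) (f : L2T) :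
    ‖mulOp σ m C h f‖ ≤ C * ‖f‖ :=
  (mulOp σ m C h).le_of_opNorm_le
    (LinearMap.mkContinuous_norm_le _ ((abs_nonneg _).trans (h 0)) _) f

theorem abs_sign_le (n : ℤ) : |(-(n.sign : ℝ))| ≤ 1 := by
  rcases Int.sign_trichotomy n with h | h | h <;> simp [h]

/-- The Hilbert transform on `L²`. -/
def hilb : L2T →L[ℝ] L2T := mulOp (Equiv.neg ℤ) (fun n => -(n.sign : ℝ)) 1 abs_sign_le

theorem casCoeff_hilb (f : L2T) (n : ℤ) :
    casCoeff (hilb f) n = -(n.sign : ℝ) * casCoeff f (-n) := casCoeff_mulOp _ _ _ _ _ _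

theorem norm_hilb_le (f : L2T) : ‖hilb f‖ ≤ ‖f‖ := by
  have := norm_mulOp_le (Equiv.neg ℤ) (fun n => -(n.sign : ℝ)) 1 abs_sign_le f
  rwa [one_mul] at this

theorem abs_inv_int_le (n : ℤ) : |((n : ℝ)⁻¹)| ≤ 1 := by
  rw [abs_inv]
  by_cases h : n = 0
  · simp [h]
  · refine inv_le_one_of_one_le₀ ?_
    exact_mod_cast Int.one_le_abs h

/-- The antiderivative of mean zero. -/
def antideriv : L2T →L[ℝ] L2T := mulOp (Equiv.neg ℤ) (fun n => (n : ℝ)⁻¹) 1 abs_inv_int_le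

theorem casCoeff_antideriv (f : L2T) (n : ℤ) :
    casCoeff (antideriv f) n = (n : ℝ)⁻¹ * casCoeff f (-n) := casCoeff_mulOp _ _ _ _ _ _

/-! ### Multiplication by a continuous function -/

theorem memLp_continuous_mul (a : C(Torus, ℝ)) (f : L2T) : MemLp (fun x => a x * f x) 2 volume :=
  (Lp.memLp f).of_le_mul (c := ‖a‖)
    (a.continuous.aestronglyMeasurable.mul (Lp.memLp f).1)
    (Eventually.of_forall fun x => by
      rw [norm_mul]; exact mul_le_mul_of_nonneg_right (a.norm_coe_le_norm x) (norm_nonneg _))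

/-- Multiplication by a continuous function. -/
def mulC (a : C(Torus, ℝ)) : L2T →L[ℝ] L2T :=
  LinearMap.mkContinuous
    { toFun := fun f => (memLp_continuous_mul a f).toLp _
      map_add' := fun f g => by
        refine Lp.ext ?_
        filter_upwards [(memLp_continuous_mul a (f + g)).coeFn_toLp, (memLp_continuous_mul a f).coeFn_toLp, (memLp_continuous_mul a g).coeFn_toLp,
          Lp.coeFn_add f g, Lp.coeFn_add ((memLp_continuous_mul a f).toLp _) ((memLp_continuous_mul a g).toLp _)] with x h1 h2 h3 h4 h5
        rw [h1, h5, Pi.add_apply, h2, h3, h4, Pi.add_apply, mul_add]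
      map_smul' := fun c f => by
        refine Lp.ext ?_
        filter_upwards [(memLp_continuous_mul a (c • f)).coeFn_toLp, (memLp_continuous_mul a f).coeFn_toLp,
          Lp.coeFn_smul c f, Lp.coeFn_smul c ((memLp_continuous_mul a f).toLp _)] with x h1 h2 h4 h5
        rw [h1, RingHom.id_apply, h5, Pi.smul_apply, h2, h4, Pi.smul_apply, smul_eq_mul,
          smul_eq_mul]
        ring } ‖a‖ fun f => by
    refine Lp.norm_le_mul_norm_of_ae_le_mul ?_
    filter_upwards [(memLp_continuous_mul a f).coeFn_toLp] with x hx
    simp only [LinearMap.coe_mk, AddHom.coe_mk]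
    rw [hx, norm_mul]
    exact mul_le_mul_of_nonneg_right (a.norm_coe_le_norm x) (norm_nonneg _)

theorem coeFn_mulC (a : C(Torus, ℝ)) (f : L2T) : mulC a f =ᵐ[volume] fun x => a x * f x :=
  (memLp_continuous_mul a f).coeFn_toLp

theorem norm_mulC_le (a : C(Torus, ℝ)) (f : L2T) : ‖mulC a f‖ ≤ ‖a‖ * ‖f‖ :=
  (mulC a).le_of_opNorm_le (LinearMap.mkContinuous_norm_le _ (norm_nonneg _) _) f

theorem mulC_mul (a b : C(Torus, ℝ)) (f : L2T) : mulC (a * b) f = mulC a (mulC b f) := by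
  refine Lp.ext ?_
  filter_upwards [coeFn_mulC (a * b) f, coeFn_mulC a (mulC b f), coeFn_mulC b f] with x h1 h2 h3
  rw [h1, h2, h3, ContinuousMap.mul_apply, mul_assoc]

theorem mulC_one (f : L2T) : mulC 1 f = f := by
  refine Lp.ext ?_
  filter_upwards [coeFn_mulC 1 f] with x h1
  rw [h1, ContinuousMap.one_apply, one_mul]

theorem mulC_toL2 (a b : C(Torus, ℝ)) : mulC a (toL2 b) = toL2 (a * b) := by
  refine Lp.ext ?_
  filter_upwards [coeFn_mulC a (toL2 b), coeFn_toL2 b, coeFn_toL2 (a * b)] with x h1 h2 h3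
  rw [h1, h2, h3, ContinuousMap.mul_apply]

theorem inner_mulC_left (a : C(Torus, ℝ)) (f g : L2T) :
    inner ℝ (mulC a f) g = inner ℝ f (mulC a g) := by
  rw [l2_inner, l2_inner]
  refine integral_congr_ae ?_
  filter_upwards [coeFn_mulC a f, coeFn_mulC a g] with x h1 h2
  rw [h1, h2]; ring

theorem toL2_injective : Function.Injective toL2 :=
  ContinuousMap.toLp_injective (p := 2) (E := ℝ) (𝕜 := ℝ) (μ := (volume : Measure Torus))

/-! ### Derivatives on the torus -/

/-- `F` is continuously differentiable on the torus, with derivative `G`. -/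
def HasTDeriv (F G : C(Torus, ℝ)) : Prop :=
  ∀ t : ℝ, HasDerivAt (fun s : ℝ => F (s : Torus)) (G (t : Torus)) t

theorem HasTDeriv.tderiv_eq {F G : C(Torus, ℝ)} (h : HasTDeriv F G) : tderiv F = G := by
  funext x
  induction x using QuotientAddGroup.induction_on with
  | H t => exact (tderiv_coe _ t).trans (h t).deriv

theorem HasTDeriv.add {F G F' G' : C(Torus, ℝ)} (h : HasTDeriv F F') (h' : HasTDeriv G G') :
    HasTDeriv (F + G) (F' + G') := fun t => (h t).add (h' t)

theorem HasTDeriv.mul {F G F' G' : C(Torus, ℝ)} (h : HasTDeriv F F') (h' : HasTDeriv G G') :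
    HasTDeriv (F * G) (F' * G + F * G') := fun t => (h t).mul (h' t)

theorem hasTDeriv_const (c : ℝ) : HasTDeriv (ContinuousMap.const Torus c) 0 :=
  fun t => hasDerivAt_const t c

theorem hasTDeriv_cas (n : ℤ) : HasTDeriv (cas n) ((n : ℝ) • cas (-n)) := fun t =>
  hasDerivAt_cas n t

theorem TContDiff.of_le {m n : ℕ∞} {F : Torus → ℝ} (h : TContDiff n F) (hmn : m ≤ n) :
    TContDiff m F := ContDiff.of_le h (by exact_mod_cast hmn)

theorem tContDiff_zero {F : Torus → ℝ} : TContDiff 0 F ↔ Continuous F := by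
  refine ⟨fun h => h.continuous, fun h => ?_⟩
  unfold TContDiff
  exact contDiff_zero.2 (h.comp (AddCircle.continuous_mk' _))

theorem TContDiff.hasTDeriv {F : C(Torus, ℝ)} (h : TContDiff 1 F) :
    ∃ G : C(Torus, ℝ), HasTDeriv F G := by
  have h1 : Continuous (deriv (fun t : ℝ => F (t : Torus))) :=
    ContDiff.continuous_deriv (n := ((1 : ℕ∞) : WithTop ℕ∞)) h (by norm_num)
  have h2 : tderiv F ∘ (fun t : ℝ => (t : Torus)) = deriv (fun t : ℝ => F (t : Torus)) := by
    funext s; exact tderiv_coe F s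
  refine ⟨⟨tderiv F, (QuotientAddGroup.isQuotientMap_mk _).continuous_iff.2 (h2.symm ▸ h1)⟩,
    fun t => ?_⟩
  have h3 : Differentiable ℝ (fun t : ℝ => F (t : Torus)) :=
    ContDiff.differentiable (n := ((1 : ℕ∞) : WithTop ℕ∞)) h (by norm_num)
  have := (h3 t).hasDerivAt
  rwa [← tderiv_coe] at this

theorem HasTDeriv.tContDiff_succ {F G : C(Torus, ℝ)} (h : HasTDeriv F G) {k : ℕ} :
    TContDiff ((k + 1 : ℕ) : ℕ∞) F ↔ TContDiff (k : ℕ∞) G := by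
  unfold TContDiff
  have e : deriv (fun t : ℝ => F (t : Torus)) = fun t : ℝ => G (t : Torus) :=
    funext fun t => (h t).deriv
  have e2 : (((k + 1 : ℕ) : ℕ∞) : WithTop ℕ∞) = ((k : ℕ∞) : WithTop ℕ∞) + 1 := by
    push_cast
    try rfl
  rw [e2, contDiff_succ_iff_deriv, e]
  refine ⟨fun h => h.2.2, fun h' => ⟨fun t => (h t).differentiableAt, by simp, h'⟩⟩

theorem HasTDeriv.integral_eq_zero {F G : C(Torus, ℝ)} (h : HasTDeriv F G) :
    ∫ x, G x = 0 := by
  rw [← AddCircle.intervalIntegral_preimage (2 * Real.pi) 0,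
    intervalIntegral.integral_eq_sub_of_hasDerivAt (fun t _ => h t)
      ((G.continuous.comp (AddCircle.continuous_mk' _)).intervalIntegrable _ _)]
  have : ((0 + 2 * Real.pi : ℝ) : Torus) = ((0 : ℝ) : Torus) := by
    rw [zero_add]; exact (AddCircle.coe_period _).trans (AddCircle.coe_zero _).symm
  rw [this, sub_self]

theorem HasTDeriv.casCoeff_eq {F G : C(Torus, ℝ)} (h : HasTDeriv F G) (n : ℤ) :
    casCoeff G n = -n * casCoeff F (-n) := by
  have h1 := (h.mul (hasTDeriv_cas n)).integral_eq_zero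
  have h2 : ∫ x, (G * cas n + F * ((n : ℝ) • cas (-n))) x
      = (∫ x, G x * cas n x) + n * ∫ x, F x * cas (-n) x := by
    rw [← integral_const_mul, ← integral_add]
    · congr 1; funext x
      simp
    · exact integrable_continuous (by fun_prop)
    · exact integrable_continuous (by fun_prop)
  unfold casCoeff
  rw [h2] at h1
  linear_combination casNorm * h1

/-! ### Distributional derivatives -/

/-- One direction tests against `cas n`; the other is Parseval's identity against η and η'. Calculus
with weak derivatives thereby becomes algebra on coefficients. -/
theorem isWeakDeriv_iff {f g : L2T} :
    IsWeakDeriv f g ↔ ∀ n, casCoeff g n = -n * casCoeff f (-n) := by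
  constructor
  · intro h n
    have h1 := h (cas n) (tContDiff_cas n)
    simp_rw [tderiv_cas] at h1
    have h2 : ∫ x, f x * (n * cas (-n) x) = n * ∫ x, f x * cas (-n) x := by
      rw [← integral_const_mul]
      congr 1; funext x; ring
    unfold casCoeff
    rw [h2] at h1
    linear_combination casNorm * h1
  · intro h η hη
    obtain ⟨η', hη'⟩ := TContDiff.hasTDeriv (F := ⟨η, hη.continuous⟩) (hη.of_le le_top)
    have e1 : tderiv η = η' := hη'.tderiv_eq
    rw [e1]
    have h1 := hasSum_casCoeff_mul f (toL2 η')
    have h2 := hasSum_casCoeff_mul g (toL2 ⟨η, hη.continuous⟩)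
    rw [inner_toL2] at h1 h2
    simp only [casCoeff_congr (coeFn_toL2 _)] at h1 h2
    have h3 := ((Equiv.neg ℤ).hasSum_iff).2 h2
    refine h1.unique ?_
    refine h3.neg.congr_fun fun n => ?_
    rw [Function.comp_apply, Equiv.neg_apply, h, hη'.casCoeff_eq, neg_neg]
    push_cast; ring

theorem HasTDeriv.isWeakDeriv {F G : C(Torus, ℝ)} (h : HasTDeriv F G) :
    IsWeakDeriv (toL2 F) (toL2 G) :=
  isWeakDeriv_iff.2 fun n => by
    rw [casCoeff_congr (coeFn_toL2 _), casCoeff_congr (coeFn_toL2 _), h.casCoeff_eq]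

theorem IsWeakDeriv.unique {f g g' : L2T} (h : IsWeakDeriv f g) (h' : IsWeakDeriv f g') :
    g = g' := casCoeff_ext fun n => by rw [isWeakDeriv_iff.1 h, isWeakDeriv_iff.1 h']

theorem IsWeakDeriv.add {f g f' g' : L2T} (h : IsWeakDeriv f f') (h' : IsWeakDeriv g g') :
    IsWeakDeriv (f + g) (f' + g') := isWeakDeriv_iff.2 fun n => by
  rw [casCoeff_add, casCoeff_add, isWeakDeriv_iff.1 h, isWeakDeriv_iff.1 h']; ring

theorem IsWeakDeriv.sub {f g f' g' : L2T} (h : IsWeakDeriv f f') (h' : IsWeakDeriv g g') :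
    IsWeakDeriv (f - g) (f' - g') := isWeakDeriv_iff.2 fun n => by
  rw [casCoeff_sub, casCoeff_sub, isWeakDeriv_iff.1 h, isWeakDeriv_iff.1 h']; ring

theorem IsWeakDeriv.smul {f f' : L2T} (c : ℝ) (h : IsWeakDeriv f f') :
    IsWeakDeriv (c • f) (c • f') := isWeakDeriv_iff.2 fun n => by
  rw [casCoeff_smul, casCoeff_smul, isWeakDeriv_iff.1 h]; ring

theorem IsWeakDeriv.hilb {f f' : L2T} (h : IsWeakDeriv f f') :
    IsWeakDeriv (hilb f) (hilb f') := isWeakDeriv_iff.2 fun n => by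
  rw [casCoeff_hilb, casCoeff_hilb, isWeakDeriv_iff.1 h, neg_neg, Int.sign_neg]
  push_cast; ring

theorem IsWeakDeriv.inner_eq {f g f' g' : L2T} (h : IsWeakDeriv f f') (h' : IsWeakDeriv g g') :
    inner ℝ f' g = -inner ℝ f g' := by
  have h1 := hasSum_casCoeff_mul f' g
  have h3 := ((Equiv.neg ℤ).hasSum_iff).2 (hasSum_casCoeff_mul f g')
  refine h1.unique ?_
  refine h3.neg.congr_fun fun n => ?_
  rw [Function.comp_apply, Equiv.neg_apply, isWeakDeriv_iff.1 h, isWeakDeriv_iff.1 h', neg_neg]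
  push_cast; ring

theorem IsWeakDeriv.casCoeff_zero {f f' : L2T} (h : IsWeakDeriv f f') : casCoeff f' 0 = 0 := by
  rw [isWeakDeriv_iff.1 h]; simp

theorem isWeakDeriv_antideriv {g : L2T} (h : casCoeff g 0 = 0) : IsWeakDeriv (antideriv g) g :=
  isWeakDeriv_iff.2 fun n => by
    rw [casCoeff_antideriv, neg_neg]
    by_cases hn : n = 0
    · subst hn; simp [h]
    · have : (n : ℝ) ≠ 0 := by exact_mod_cast hn
      push_cast; field_simp

/-- Integration by parts of f against the C¹ function aη; a multiplier that is only C¹ is not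
allowed as a test function, but `IsWeakDeriv.inner_eq` pairs any two weakly differentiable
functions. -/
theorem IsWeakDeriv.mulC {a a' : C(Torus, ℝ)} (ha : HasTDeriv a a') {f f' : L2T}
    (h : IsWeakDeriv f f') : IsWeakDeriv (mulC a f) (mulC a' f + mulC a f') := by
  intro η hη
  obtain ⟨η', hη'⟩ := TContDiff.hasTDeriv (F := ⟨η, hη.continuous⟩) (hη.of_le le_top)
  have e1 : tderiv η = η' := hη'.tderiv_eq
  set e : C(Torus, ℝ) := ⟨η, hη.continuous⟩
  have key := h.inner_eq (ha.mul hη').isWeakDeriv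
  have e2 : ∫ x, CircleGas.mulC a f x * tderiv η x = inner ℝ (CircleGas.mulC a f) (toL2 η') := by
    rw [inner_toL2, e1]
  have e3 : ∫ x, (CircleGas.mulC a' f + CircleGas.mulC a f' : L2T) x * η x
      = inner ℝ (CircleGas.mulC a' f + CircleGas.mulC a f') (toL2 e) := (inner_toL2 _ e).symm
  rw [e2, e3, inner_add_left, inner_mulC_left, inner_mulC_left, inner_mulC_left, mulC_toL2,
    mulC_toL2, mulC_toL2]
  rw [map_add, inner_add_right] at key
  linarith

theorem isWeakDeriv_const (c : ℝ) : IsWeakDeriv (toL2 (ContinuousMap.const Torus c)) 0 := by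
  have := (hasTDeriv_const c).isWeakDeriv
  rwa [map_zero] at this

/-- A square integrable function whose distributional derivative is square integrable is
continuous. -/
theorem IsWeakDeriv.exists_continuous :
    ∃ C : ℝ, 0 < C ∧ ∀ {f g : L2T}, IsWeakDeriv f g →
      ∃ F : C(Torus, ℝ), f = toL2 F ∧ ‖F‖ ≤ C * (‖f‖ + ‖g‖) := by
  have hs : Summable fun n : ℤ => ((n : ℝ)⁻¹) ^ 2 := by
    have := (Real.summable_one_div_int_pow (p := 2)).2 (by norm_num)
    simpa using this
  set S := ∑' n : ℤ, ((n : ℝ)⁻¹) ^ 2 with hS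
  have hS0 : 0 ≤ S := tsum_nonneg fun n => sq_nonneg _
  refine ⟨2 * casNorm * (1 + Real.sqrt S), by have := casNorm_pos; positivity, ?_⟩
  intro f g h
  have hcn : ∀ n : ℤ, ‖casNorm • cas n‖ ≤ 2 * casNorm := by
    intro n
    rw [norm_smul, Real.norm_of_nonneg casNorm_pos.le, mul_comm]
    refine mul_le_mul_of_nonneg_right ?_ casNorm_pos.le
    exact (ContinuousMap.norm_le _ (by norm_num)).2 fun x => abs_cas_le n x
  have hneg : HasSum (fun n => casCoeff g (-n) ^ 2) (‖g‖ ^ 2) :=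
    ((Equiv.neg ℤ).hasSum_iff (f := fun n => casCoeff g n ^ 2)).2 (hasSum_casCoeff_sq g)
  -- Off n = 0 the coefficient of f is that of its derivative divided by n, and Cauchy–Schwarz with
  -- ∑ 1/n² makes the series absolutely convergent. At n = 0 the convention 0⁻¹ = 0 removes the
  -- second term, and ‖f‖ takes its place.
  have hbound : ∀ n : ℤ, |casCoeff f n| ≤
      (if n = 0 then ‖f‖ else 0) + |(n : ℝ)⁻¹| * |casCoeff g (-n)| := by
    intro n
    by_cases hn : n = 0
    · subst hn
      have h1 : casCoeff f 0 ^ 2 ≤ ‖f‖ ^ 2 :=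
        le_hasSum (hasSum_casCoeff_sq f) 0 fun _ _ => sq_nonneg _
      have := abs_le_of_sq_le_sq h1 (norm_nonneg _)
      simpa using this
    · have hn' : (n : ℝ) ≠ 0 := by exact_mod_cast hn
      rw [if_neg hn, zero_add, isWeakDeriv_iff.1 h, neg_neg, ← abs_mul]
      push_cast
      rw [neg_neg, inv_mul_cancel_left₀ hn']
  have hCS : Summable fun n : ℤ => |(n : ℝ)⁻¹| * |casCoeff g (-n)| :=
    Summable.of_nonneg_of_le (fun n => by positivity) (fun n => by
      have := two_mul_le_add_sq |(n : ℝ)⁻¹| |casCoeff g (-n)|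
      rw [sq_abs, sq_abs] at this
      have h2 := mul_nonneg (abs_nonneg (n : ℝ)⁻¹) (abs_nonneg (casCoeff g (-n)))
      linarith) (hs.add hneg.summable)
  have hCS' : ∑' n : ℤ, |(n : ℝ)⁻¹| * |casCoeff g (-n)| ≤ Real.sqrt S * ‖g‖ := by
    refine Real.tsum_le_of_sum_le (fun n => by positivity) fun s => ?_
    refine (Real.sum_mul_le_sqrt_mul_sqrt s _ _).trans ?_
    simp only [sq_abs]
    refine mul_le_mul (Real.sqrt_le_sqrt (hs.sum_le_tsum _ fun _ _ => sq_nonneg _)) ?_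
      (Real.sqrt_nonneg _) (Real.sqrt_nonneg _)
    rw [Real.sqrt_le_left (norm_nonneg _)]
    exact sum_le_hasSum _ (fun _ _ => sq_nonneg _) hneg
  have h0 : HasSum (fun n : ℤ => if n = 0 then ‖f‖ else 0) ‖f‖ := hasSum_ite_eq 0 _
  have hmaj : HasSum (fun n : ℤ => 2 * casNorm * ((if n = 0 then ‖f‖ else 0)
      + |(n : ℝ)⁻¹| * |casCoeff g (-n)|)) (2 * casNorm * (‖f‖ + ∑' n : ℤ, |(n : ℝ)⁻¹| * |casCoeff g (-n)|)) :=
    (h0.add hCS.hasSum).mul_left _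
  have hterm : ∀ n : ℤ, ‖casCoeff f n • (casNorm • cas n)‖ ≤ 2 * casNorm *
      ((if n = 0 then ‖f‖ else 0) + |(n : ℝ)⁻¹| * |casCoeff g (-n)|) := by
    intro n
    rw [norm_smul, Real.norm_eq_abs, mul_comm]
    exact mul_le_mul (hcn n) (hbound n) (abs_nonneg _) (by have := casNorm_pos; positivity)
  have hsum : Summable fun n : ℤ => casCoeff f n • (casNorm • cas n) :=
    Summable.of_norm_bounded hmaj.summable hterm
  refine ⟨∑' n : ℤ, casCoeff f n • (casNorm • cas n), ?_, ?_⟩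
  · have h1 := (hsum.hasSum).mapL toL2
    have h2 := casBasis.hasSum_repr f
    refine h2.unique ?_
    convert h1 using 2 with n
    rw [casBasis_repr, casBasis_apply, map_smul toL2 (casCoeff f n)]
  · refine (tsum_of_norm_bounded hmaj hterm).trans ?_
    rw [mul_assoc (2 * casNorm)]
    refine mul_le_mul_of_nonneg_left ?_ (by have := casNorm_pos; positivity)
    nlinarith [norm_nonneg f, norm_nonneg g, Real.sqrt_nonneg S,
      mul_nonneg (Real.sqrt_nonneg S) (norm_nonneg f)]

/-- A weak derivative has mean zero, so the primitive of G is periodic; it differs from F by a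
function with zero weak derivative, which is constant. -/
theorem IsWeakDeriv.hasTDeriv {F G : C(Torus, ℝ)} (h : IsWeakDeriv (toL2 F) (toL2 G)) :
    HasTDeriv F G := by
  have hG : ∫ x, G x = 0 := by
    have := h.casCoeff_zero
    rw [casCoeff_congr (coeFn_toL2 _), casCoeff] at this
    have h2 := (mul_eq_zero.1 this).resolve_left casNorm_pos.ne'
    simpa [cas_zero] using h2
  have hGc : Continuous fun t : ℝ => G (t : Torus) := G.continuous.comp (AddCircle.continuous_mk' _)
  set Φ : ℝ → ℝ := fun t => ∫ s in (0 : ℝ)..t, G (s : Torus) with hΦ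
  have hd : ∀ t : ℝ, HasDerivAt Φ (G (t : Torus)) t := fun t =>
    intervalIntegral.integral_hasDerivAt_right (hGc.intervalIntegrable _ _)
      hGc.aestronglyMeasurable.stronglyMeasurableAtFilter hGc.continuousAt
  have hper : Function.Periodic Φ (2 * Real.pi) := by
    intro t
    have h1 : Φ (t + 2 * Real.pi) - Φ t = ∫ s in t..(t + 2 * Real.pi), G (s : Torus) :=
      intervalIntegral.integral_interval_sub_left (hGc.intervalIntegrable _ _)
        (hGc.intervalIntegrable _ _)
    rw [AddCircle.intervalIntegral_preimage (2 * Real.pi) t (fun x : Torus => G x), hG] at h1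
    linarith
  have hcont : Continuous (hper.lift : Torus → ℝ) :=
    (QuotientAddGroup.isQuotientMap_mk _).continuous_iff.2
      (continuous_iff_continuousAt.2 fun t : ℝ => (hd t).continuousAt)
  set P : C(Torus, ℝ) := ⟨hper.lift, hcont⟩
  have hP : HasTDeriv P G := hd
  have h0 : IsWeakDeriv (toL2 (F - P)) 0 := by
    have := h.sub hP.isWeakDeriv
    rwa [← map_sub, sub_self] at this
  obtain ⟨c, hc⟩ := ae_const_of_weakDeriv_zero h0
  have h1 : (F - P : C(Torus, ℝ)) = ContinuousMap.const Torus c := by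
    refine toL2_injective (Lp.ext ?_)
    filter_upwards [hc, coeFn_toL2 (ContinuousMap.const Torus c)] with x h1 h2
    rw [h1, h2]; rfl
  have h2 : F = P + ContinuousMap.const Torus c := by rw [← h1]; abel
  have h3 := hP.add (hasTDeriv_const c)
  rw [h2]
  simpa using h3

/-! ### The principal value integral -/

theorem chord_coe_zero (s : ℝ) : chord (s : Torus) 0 = |2 * Real.sin (s / 2)| := by
  have hpi : (2 * Real.pi : ℝ) ≠ 0 := Real.two_pi_pos.ne'
  unfold chord
  rw [AddCircle.toCircle_zero, AddCircle.toCircle_apply_mk, Circle.coe_exp, Circle.coe_one,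
    div_self hpi, one_mul, mul_comm, Complex.norm_exp_I_mul_ofReal_sub_one, Real.norm_eq_abs]

theorem chord_coe_zero_le (s : ℝ) : chord (s : Torus) 0 ≤ |s| := by
  rw [chord_coe_zero, abs_mul, abs_two]
  have h := Real.abs_sin_le_abs (x := s / 2)
  rw [abs_div, abs_two] at h
  linarith

theorem abs_le_abs_tan {x : ℝ} (h : |x| < Real.pi / 2) : |x| ≤ |Real.tan x| := by
  rcases le_total 0 x with h0 | h0
  · rw [abs_of_nonneg h0] at h ⊢
    exact (Real.le_tan h0 h).trans (le_abs_self _)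
  · rw [abs_of_nonpos h0] at h ⊢
    have := Real.le_tan (neg_nonneg.2 h0) h
    rw [Real.tan_neg] at this
    exact this.trans (neg_le_abs _)

theorem tan_half_ne_zero {s : ℝ} (hs : s ∈ Set.Ioo (-Real.pi) Real.pi) (h0 : s ≠ 0) :
    Real.tan (s / 2) ≠ 0 := by
  have h1 : |s / 2| < Real.pi / 2 := by
    rw [abs_div, abs_two]
    have := abs_lt.2 hs
    linarith
  have h2 := abs_le_abs_tan h1
  intro h
  rw [h, abs_zero] at h2
  have : s / 2 = 0 := abs_eq_zero.1 (le_antisymm h2 (abs_nonneg _))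
  exact h0 (by linarith)

theorem abs_div_tan_le {s y C : ℝ} (hC : 0 ≤ C) (hs : s ∈ Set.Ioo (-Real.pi) Real.pi)
    (hy : |y| ≤ C * |s|) : |y / Real.tan (s / 2)| ≤ 2 * C := by
  -- At the singularity tan 0 = 0, and division by zero returns 0.
  by_cases h0 : s = 0
  · subst h0; simpa using hC
  have h1 : |s / 2| < Real.pi / 2 := by
    rw [abs_div, abs_two]
    have := abs_lt.2 hs
    linarith
  have h2 := abs_le_abs_tan h1
  rw [abs_div, abs_two] at h2
  have h3 : 0 < |Real.tan (s / 2)| := abs_pos.2 (tan_half_ne_zero hs h0)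
  rw [abs_div, div_le_iff₀ h3]
  nlinarith

/-- The identity sin(A + h) cos h = sin(A - h) cos h + (cos(A - h) + cos(A + h)) sin h, at A = (n +
1/2)s and h = s/2. It telescopes the conjugate Dirichlet kernel. -/
theorem sin_mul_div_tan (n : ℕ) {s : ℝ} (hs : s ∈ Set.Ioo (-Real.pi) Real.pi) (h0 : s ≠ 0) :
    Real.sin ((n + 1 : ℕ) * s) / Real.tan (s / 2)
      = Real.sin (n * s) / Real.tan (s / 2) + (Real.cos (n * s) + Real.cos ((n + 1 : ℕ) * s)) := by
  have h1 := tan_half_ne_zero hs h0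
  rw [div_eq_iff h1, add_mul, div_mul_cancel₀ _ h1]
  have hc : Real.cos (s / 2) ≠ 0 := by
    intro h
    rw [Real.tan_eq_sin_div_cos, h, div_zero] at h1
    exact h1 rfl
  have e1 : ((n + 1 : ℕ) : ℝ) * s = (n * s + s / 2) + s / 2 := by push_cast; ring
  have key : ∀ A h : ℝ, Real.sin (A + h) * Real.cos h = Real.sin (A - h) * Real.cos h
      + (Real.cos (A - h) + Real.cos (A + h)) * Real.sin h := by
    intro A h
    rw [Real.sin_add, Real.sin_sub, Real.cos_add, Real.cos_sub]; ring
  have h2 := key (n * s + s / 2) (s / 2)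
  rw [add_sub_cancel_right, ← e1] at h2
  rw [Real.tan_eq_sin_div_cos]
  rw [← mul_div_assoc, ← sub_eq_iff_eq_add', eq_div_iff hc, sub_mul, h2]
  ring

theorem integral_cos_nat_mul (n : ℕ) :
    ∫ s in Set.Ioo (-Real.pi) Real.pi, Real.cos (n * s) = if n = 0 then 2 * Real.pi else 0 := by
  rw [← integral_Ioc_eq_integral_Ioo, ← intervalIntegral.integral_of_le (by linarith [Real.pi_pos])]
  split_ifs with h
  · subst h; simp; ring
  · have hn : (n : ℝ) ≠ 0 := by exact_mod_cast h
    rw [intervalIntegral.integral_comp_mul_left (fun x => Real.cos x) hn, integral_cos]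
    simp

/-- In the recursion only cos(0·s) has a nonzero integral: the passage from 0 to 1 contributes 2π,
and the later ones contribute nothing. -/
theorem integral_sin_mul_div_tan_nat (n : ℕ) :
    IntegrableOn (fun s => Real.sin (n * s) / Real.tan (s / 2)) (Set.Ioo (-Real.pi) Real.pi) ∧
    ∫ s in Set.Ioo (-Real.pi) Real.pi, Real.sin (n * s) / Real.tan (s / 2)
      = if n = 0 then 0 else 2 * Real.pi := by
  have hcos : ∀ n : ℕ, IntegrableOn (fun s : ℝ => Real.cos (n * s))
      (Set.Ioo (-Real.pi) Real.pi) := fun n =>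
    (Continuous.integrableOn_Icc (by fun_prop)).mono_set Set.Ioo_subset_Icc_self
  induction n with
  | zero => simp
  | succ n ih =>
    have h0 : ∀ᵐ s : ℝ ∂(volume.restrict (Set.Ioo (-Real.pi) Real.pi)), s ≠ 0 :=
      ae_restrict_of_ae (by
        rw [ae_iff]; simp)
    have hae : (fun s => Real.sin ((n + 1 : ℕ) * s) / Real.tan (s / 2)) =ᵐ[volume.restrict
        (Set.Ioo (-Real.pi) Real.pi)] fun s => Real.sin (n * s) / Real.tan (s / 2) +
          (Real.cos (n * s) + Real.cos ((n + 1 : ℕ) * s)) := by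
      filter_upwards [h0, ae_restrict_mem measurableSet_Ioo] with s hs hs'
      exact sin_mul_div_tan n hs' hs
    have hcc : IntegrableOn (fun s : ℝ => Real.cos (n * s) + Real.cos ((n + 1 : ℕ) * s))
      (Set.Ioo (-Real.pi) Real.pi) := (hcos n).add (hcos (n + 1))
    refine ⟨(ih.1.add hcc).congr hae.symm, ?_⟩
    rw [integral_congr_ae hae, integral_add ih.1 hcc,
      integral_add (hcos n) (hcos (n + 1)), ih.2, integral_cos_nat_mul, integral_cos_nat_mul]
    by_cases hn : n = 0 <;> simp [hn]

theorem integral_sin_mul_div_tan (n : ℤ) :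
    IntegrableOn (fun s => Real.sin (n * s) / Real.tan (s / 2)) (Set.Ioo (-Real.pi) Real.pi) ∧
    ∫ s in Set.Ioo (-Real.pi) Real.pi, Real.sin (n * s) / Real.tan (s / 2)
      = 2 * Real.pi * n.sign := by
  obtain ⟨k, rfl | rfl⟩ := n.eq_nat_or_neg
  · have h := integral_sin_mul_div_tan_nat k
    refine ⟨by exact_mod_cast h.1, ?_⟩
    push_cast
    rw [h.2]
    by_cases hk : k = 0
    · simp [hk]
    · have : ((k : ℤ).sign) = 1 := Int.sign_eq_one_of_pos (by omega)
      simp [hk, this]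
  · have h := integral_sin_mul_div_tan_nat k
    have e : (fun s => Real.sin (((-(k : ℤ) : ℤ) : ℝ) * s) / Real.tan (s / 2))
        = fun s => -(Real.sin (k * s) / Real.tan (s / 2)) := by
      funext s
      push_cast
      rw [neg_mul, Real.sin_neg, neg_div]
    rw [e]
    refine ⟨h.1.neg, ?_⟩
    rw [integral_neg, h.2]
    by_cases hk : k = 0
    · simp [hk]
    · have : ((k : ℤ).sign) = 1 := Int.sign_eq_one_of_pos (by omega)
      rw [Int.sign_neg, this]
      simp [hk]

theorem setIntegral_odd {S : Set ℝ} (hS : MeasurableSet S) (hneg : ∀ s, -s ∈ S ↔ s ∈ S) {f : ℝ → ℝ}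
    (hf : ∀ s, f (-s) = -f s) : ∫ s in S, f s = 0 := by
  have h1 : ∫ s in S, f s = ∫ s, S.indicator f s := (integral_indicator hS).symm
  have h2 : ∫ s, S.indicator f (-s) = ∫ s, S.indicator f s := integral_neg_eq_self _ _
  have h3 : ∀ s, S.indicator f (-s) = -S.indicator f s := by
    intro s
    by_cases hs : s ∈ S
    · rw [Set.indicator_of_mem hs, Set.indicator_of_mem ((hneg s).2 hs), hf]
    · rw [Set.indicator_of_notMem hs, Set.indicator_of_notMem (fun h => hs ((hneg s).1 h)), neg_zero]
  simp_rw [h3] at h2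
  rw [integral_neg] at h2
  linarith

theorem HasTDeriv.abs_sub_le {F G : C(Torus, ℝ)} (h : HasTDeriv F G) (x : Torus) (s : ℝ) :
    |F (x - (s : Torus)) - F x| ≤ ‖G‖ * |s| := by
  induction x using QuotientAddGroup.induction_on with
  | H t =>
    have h1 := Convex.norm_image_sub_le_of_norm_hasDerivWithin_le (s := Set.univ)
      (f := fun s : ℝ => F (s : Torus)) (f' := fun s : ℝ => G (s : Torus)) (C := ‖G‖)
      (fun t _ => (h t).hasDerivWithinAt) (fun t _ => G.norm_coe_le_norm _) convex_univ
      (Set.mem_univ t) (Set.mem_univ (t - s))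
    simpa using h1

theorem measurable_tan : Measurable Real.tan := by
  have : Real.tan = fun x => Real.sin x / Real.cos x := funext Real.tan_eq_sin_div_cos
  rw [this]
  exact Real.measurable_sin.div Real.measurable_cos

theorem measurable_coe_torus : Measurable (fun s : ℝ => (s : Torus)) :=
  (AddCircle.continuous_mk' _).measurable

/-- The truncated domain is symmetric and the cotangent is odd, so subtracting F(x) does not change
the truncated integrals. The integrand is then bounded by 2‖G‖, and dominated convergence applies.
-/
theorem hilbertTransform_eq {F G : C(Torus, ℝ)} (h : HasTDeriv F G) (x : Torus) :
    hilbertTransform F x = -((∫ s in Set.Ioo (-Real.pi) Real.pi,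
      (F (x - (s : Torus)) - F x) / Real.tan (s / 2)) / (2 * Real.pi)) := by
  unfold hilbertTransform
  congr 1
  refine Tendsto.limUnder_eq ?_
  refine Tendsto.div_const ?_ _
  set D : ℝ → ℝ := fun s => (F (x - (s : Torus)) - F x) / Real.tan (s / 2) with hD
  have hDm : Measurable D := by
    refine Measurable.div ?_ (measurable_tan.comp (measurable_id.div_const 2))
    exact (F.continuous.measurable.comp (measurable_const.sub measurable_coe_torus)).sub_const _
  have hDb : ∀ s ∈ Set.Ioo (-Real.pi) Real.pi, |D s| ≤ 2 * ‖G‖ := fun s hs =>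
    abs_div_tan_le (norm_nonneg _) hs (h.abs_sub_le x s)
  have hchm : Measurable fun s : ℝ => chord (s : Torus) 0 := by
    simp_rw [chord_coe_zero]
    exact (by fun_prop : Continuous fun s : ℝ => |2 * Real.sin (s / 2)|).measurable
  set S : ℝ → Set ℝ := fun ε => {s : ℝ | s ∈ Set.Ioo (-Real.pi) Real.pi ∧ ε < chord (s : Torus) 0}
    with hS
  have hSm : ∀ ε, MeasurableSet (S ε) := fun ε =>
    measurableSet_Ioo.inter (measurableSet_lt measurable_const hchm)
  have hSneg : ∀ ε s, -s ∈ S ε ↔ s ∈ S ε := by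
    intro ε s
    simp only [hS, Set.mem_ofPred_eq, Set.mem_Ioo, chord_coe_zero]
    rw [neg_div, Real.sin_neg, mul_neg, abs_neg]
    constructor <;> rintro ⟨⟨h1, h2⟩, h3⟩ <;> exact ⟨⟨by linarith, by linarith⟩, h3⟩
  have hDi : IntegrableOn D (Set.Ioo (-Real.pi) Real.pi) := by
    refine Integrable.of_bound (C := 2 * ‖G‖) hDm.aestronglyMeasurable ?_
    filter_upwards [ae_restrict_mem measurableSet_Ioo] with s hs
    exact hDb s hs
  have hSsub : ∀ ε, S ε ⊆ Set.Ioo (-Real.pi) Real.pi := fun ε s hs => hs.1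
  have hcot : ∀ ε > 0, IntegrableOn (fun s => F x / Real.tan (s / 2)) (S ε) := by
    intro ε hε
    have : IsFiniteMeasure (volume.restrict (S ε)) := by
      refine ⟨?_⟩
      rw [Measure.restrict_apply_univ]
      exact (measure_mono (hSsub ε)).trans_lt (by simp)
    refine Integrable.of_bound (C := 2 * (|F x| / ε))
      (measurable_const.div (measurable_tan.comp (measurable_id.div_const 2))).aestronglyMeasurable ?_
    filter_upwards [ae_restrict_mem (hSm ε)] with s hs
    refine abs_div_tan_le (by positivity) hs.1 ?_
    have : ε ≤ |s| := hs.2.le.trans (chord_coe_zero_le s)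
    rw [div_mul_eq_mul_div, le_div_iff₀ hε]
    exact mul_le_mul_of_nonneg_left this (abs_nonneg _)
  have heq : ∀ ε > 0, ∫ s in S ε, F (x - (s : Torus)) / Real.tan (s / 2)
      = ∫ s, (S ε).indicator D s := by
    intro ε hε
    rw [integral_indicator (hSm ε)]
    have h1 : ∀ s : ℝ, F (x - (s : Torus)) / Real.tan (s / 2) = D s + F x / Real.tan (s / 2) := by
      intro s; simp only [hD]; ring
    simp_rw [h1]
    rw [integral_add (hDi.mono_set (hSsub ε)) (hcot ε hε),
      setIntegral_odd (f := fun s => F x / Real.tan (s / 2)) (hSm ε) (hSneg ε)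
        (fun s => by rw [neg_div, Real.tan_neg, div_neg]), add_zero]
  have hlim : Tendsto (fun ε => ∫ s, (S ε).indicator D s) (𝓝[>] (0 : ℝ))
      (𝓝 (∫ s, (Set.Ioo (-Real.pi) Real.pi).indicator D s)) := by
    refine tendsto_integral_filter_of_dominated_convergence
      ((Set.Ioo (-Real.pi) Real.pi).indicator fun _ => 2 * ‖G‖) ?_ ?_ ?_ ?_
    · exact Eventually.of_forall fun ε => (hDm.indicator (hSm ε)).aestronglyMeasurable
    · refine Eventually.of_forall fun ε => Eventually.of_forall fun s => ?_
      by_cases hs : s ∈ S ε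
      · rw [Set.indicator_of_mem hs, Set.indicator_of_mem (hSsub ε hs)]
        exact hDb s (hSsub ε hs)
      · rw [Set.indicator_of_notMem hs, norm_zero]
        exact Set.indicator_nonneg (fun _ _ => by positivity) _
    · rw [integrable_indicator_iff measurableSet_Ioo]
      exact integrableOn_const (by simp)
    · refine Eventually.of_forall fun s => ?_
      by_cases hs : s ∈ Set.Ioo (-Real.pi) Real.pi
      · by_cases h0 : s = 0
        · have hz : D s = 0 := by simp [hD, h0]
          have : ∀ T : Set ℝ, T.indicator D s = 0 := fun T => by
            by_cases hT : s ∈ T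
            · rw [Set.indicator_of_mem hT, hz]
            · rw [Set.indicator_of_notMem hT]
          simp_rw [this]
          exact tendsto_const_nhds
        · have hpos : 0 < chord (s : Torus) 0 := by
            rw [chord_coe_zero]
            refine abs_pos.2 (mul_ne_zero two_ne_zero fun h => tan_half_ne_zero hs h0 ?_)
            rw [Real.tan_eq_sin_div_cos, h, zero_div]
          refine tendsto_const_nhds.congr' ?_
          filter_upwards [nhdsWithin_le_nhds (Iio_mem_nhds hpos)] with ε hε
          rw [Set.indicator_of_mem hs, Set.indicator_of_mem (show s ∈ S ε from ⟨hs, hε⟩)]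
      · have : ∀ ε, (S ε).indicator D s = 0 := fun ε =>
          Set.indicator_of_notMem (fun h => hs (hSsub ε h)) _
        simp_rw [this, Set.indicator_of_notMem hs]
        exact tendsto_const_nhds
  rw [integral_indicator measurableSet_Ioo] at hlim
  refine hlim.congr' ?_
  filter_upwards [self_mem_nhdsWithin] with ε hε
  exact (heq ε hε).symm

theorem cas_add_coe (n : ℤ) (x : Torus) (s : ℝ) :
    cas n (x + (s : Torus)) = Real.cos (n * s) * cas n x + Real.sin (n * s) * cas (-n) x := by
  induction x using QuotientAddGroup.induction_on with
  | H t =>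
    have h1 := cas_coe n (t + s)
    have h2 := cas_coe n t
    have h3 := cas_neg_coe n t
    refine h1.trans ?_
    refine Eq.trans ?_ (congrArg₂ (fun u v => Real.cos (n * s) * u + Real.sin (n * s) * v)
      h2.symm h3.symm)
    rw [mul_add, Real.cos_add, Real.sin_add]
    ring

/-- Comparison of coefficients. By Fubini and translation, integrating F(x - s) against `cas n`
leaves cos(ns)A + sin(ns)B; divided by the tangent, the cosine part is odd in s and the sine part
integrates to 2π sign(n)B. -/
theorem hilbertTransform_ae_eq {F G : C(Torus, ℝ)} (h : HasTDeriv F G) :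
    ∀ᵐ x, hilb (toL2 F) x = hilbertTransform F x := by
  set I : Set ℝ := Set.Ioo (-Real.pi) Real.pi with hI
  set D : Torus → ℝ → ℝ := fun x s => (F (x - (s : Torus)) - F x) / Real.tan (s / 2) with hD
  have hDb : ∀ x, ∀ s ∈ I, |D x s| ≤ 2 * ‖G‖ := fun x s hs =>
    abs_div_tan_le (norm_nonneg _) hs (h.abs_sub_le x s)
  have hDm : Measurable (fun p : Torus × ℝ => D p.1 p.2) := by
    refine Measurable.div ?_ (measurable_tan.comp (measurable_snd.div_const 2))
    refine (F.continuous.measurable.comp (measurable_fst.sub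
      (measurable_coe_torus.comp measurable_snd))).sub (F.continuous.measurable.comp measurable_fst)
  have : IsFiniteMeasure (volume.restrict I) := ⟨by simp [hI]⟩
  have hcont : Continuous fun x => ∫ s in I, D x s := by
    refine continuous_of_dominated (bound := fun _ => 2 * ‖G‖) ?_ ?_ (integrable_const _) ?_
    · exact fun x => (hDm.comp measurable_prodMk_left).aestronglyMeasurable
    · intro x
      filter_upwards [ae_restrict_mem measurableSet_Ioo] with s hs
      exact hDb x s hs
    · exact Eventually.of_forall fun s =>
        ((F.continuous.comp (continuous_id.sub continuous_const)).sub F.continuous).div_const _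
  set h0 : C(Torus, ℝ) := ⟨fun x => -((∫ s in I, D x s) / (2 * Real.pi)),
    (hcont.div_const _).neg⟩ with hh0
  have hfun : ∀ x, hilbertTransform F x = h0 x := fun x => hilbertTransform_eq h x
  suffices hs : hilb (toL2 F) = toL2 h0 by
    rw [hs]
    filter_upwards [coeFn_toL2 h0] with x hx
    rw [hx, hfun]
  refine casCoeff_ext fun n => ?_
  rw [casCoeff_hilb, casCoeff_congr (coeFn_toL2 _), casCoeff_congr (coeFn_toL2 _)]
  have hint : Integrable (Function.uncurry fun (x : Torus) (s : ℝ) => D x s * cas n x)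
      (volume.prod (volume.restrict I)) := by
    refine Integrable.of_bound (C := 2 * ‖G‖ * 2)
      (hDm.mul ((cas n).continuous.measurable.comp measurable_fst)).aestronglyMeasurable ?_
    have : ∀ᵐ p : Torus × ℝ ∂(volume.prod (volume.restrict I)), p.2 ∈ I :=
      Measure.quasiMeasurePreserving_snd.ae (ae_restrict_mem measurableSet_Ioo)
    filter_upwards [this] with p hp
    simp only [Function.uncurry, norm_mul]
    exact mul_le_mul (hDb p.1 p.2 hp) (abs_cas_le n p.1) (norm_nonneg _) (by positivity)
  set A := ∫ x, F x * cas n x with hA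
  set B := ∫ x, F x * cas (-n) x with hB
  have hinner : ∀ s : ℝ, ∫ x, D x s * cas n x
      = ((Real.cos (n * s) - 1) * A) / Real.tan (s / 2)
        + B * (Real.sin (n * s) / Real.tan (s / 2)) := by
    intro s
    have i1 : ∀ k : ℤ, Integrable fun x : Torus => F x * cas k x := fun k =>
      integrable_continuous (by fun_prop)
    have e1 : ∫ x, F (x - (s : Torus)) * cas n x = Real.cos (n * s) * A + Real.sin (n * s) * B := by
      rw [← integral_add_right_eq_self (μ := (volume : Measure Torus)) _ (s : Torus)]
      rw [hA, hB, ← integral_const_mul, ← integral_const_mul,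
        ← integral_add ((i1 n).const_mul _) ((i1 (-n)).const_mul _)]
      congr 1; funext x
      rw [add_sub_cancel_right, cas_add_coe]; ring
    have e2 : ∫ x, D x s * cas n x
        = ((∫ x, F (x - (s : Torus)) * cas n x) - A) / Real.tan (s / 2) := by
      rw [hA, ← integral_sub (integrable_continuous (by fun_prop)) (i1 n), ← integral_div]
      congr 1; funext x
      simp only [hD]; ring
    rw [e2, e1]; ring
  have hswap := integral_integral_swap hint
  have hJ := integral_sin_mul_div_tan n
  have hint2 : IntegrableOn (fun s => ((Real.cos (n * s) - 1) * A) / Real.tan (s / 2)) I := by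
    have h1 := hint.integral_prod_right
    simp only [Function.uncurry] at h1
    simp_rw [hinner] at h1
    have h2 := h1.sub (hJ.1.const_mul B)
    refine h2.congr (Eventually.of_forall fun s => ?_)
    simp
  have hodd : ∫ s in I, ((Real.cos (n * s) - 1) * A) / Real.tan (s / 2) = 0 := by
    refine setIntegral_odd measurableSet_Ioo ?_ ?_
    · intro s
      simp only [Set.mem_Ioo]
      constructor <;> rintro ⟨h1, h2⟩ <;> exact ⟨by linarith, by linarith⟩
    · intro s
      rw [neg_div, Real.tan_neg, div_neg, mul_neg, Real.cos_neg]
  simp_rw [hinner] at hswap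
  rw [integral_add hint2 (hJ.1.const_mul B), hodd, zero_add, integral_const_mul, hJ.2] at hswap
  have hfin : ∫ x, h0 x * cas n x = -(B * (2 * Real.pi * n.sign)) / (2 * Real.pi) := by
    rw [← hswap, neg_div, ← integral_div, ← integral_neg]
    congr 1; funext x
    rw [integral_mul_const]
    simp only [hh0, ContinuousMap.coe_mk]
    ring
  have hpi := Real.two_pi_pos.ne'
  unfold casCoeff
  rw [hfin]
  change -(n.sign : ℝ) * (casNorm * B) = _
  field_simp

/-! ### The logarithmic kernel -/

/-- The kernel `log |sin (s / 2)|⁻¹`. -/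
def logK (s : Torus) : ℝ := -Real.log (chord s 0 / 2)

/-- The regularised kernel `log 2 - log |1 - r e^{is}|`. -/
def logKr (r : ℝ) (s : Torus) : ℝ := Real.log 2 - Real.log ‖1 - (r : ℂ) * fourier 1 s‖

theorem norm_fourier_apply (n : ℤ) (s : Torus) : ‖(fourier n s : ℂ)‖ = 1 := by
  rw [fourier_apply]; exact Circle.norm_coe _

theorem chord_zero_eq (s : Torus) : chord s 0 = ‖1 - fourier 1 s‖ := by
  unfold chord
  rw [AddCircle.toCircle_zero, Circle.coe_one, ← fourier_one, norm_sub_rev]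

theorem chord_eq_sub (x y : Torus) : chord x y = chord (x - y) 0 := by
  have e : AddCircle.toCircle (x - y) = AddCircle.toCircle x * (AddCircle.toCircle y)⁻¹ := by
    rw [sub_eq_add_neg, AddCircle.toCircle_add, AddCircle.toCircle_neg]
  unfold chord
  rw [AddCircle.toCircle_zero, Circle.coe_one, e, Circle.coe_mul]
  have h : ((AddCircle.toCircle x : Circle) : ℂ) - (AddCircle.toCircle y : Circle)
      = (((AddCircle.toCircle x : Circle) : ℂ) * ((AddCircle.toCircle y)⁻¹ : Circle) - 1)
        * (AddCircle.toCircle y : Circle) := by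
    rw [sub_mul, mul_assoc, ← Circle.coe_mul, inv_mul_cancel, Circle.coe_one, mul_one, one_mul]
  rw [h, norm_mul, Circle.norm_coe, mul_one]

theorem chord_zero_pos {s : Torus} (h : s ≠ 0) : 0 < chord s 0 := by
  unfold chord
  refine norm_pos_iff.2 (sub_ne_zero.2 fun h' => h ?_)
  exact AddCircle.injective_toCircle Real.two_pi_pos.ne' (Subtype.ext h')

theorem continuous_chord_zero : Continuous fun s : Torus => chord s 0 := by
  simp_rw [chord_zero_eq]
  exact (continuous_const.sub (map_continuous (fourier (T := 2 * Real.pi) 1))).norm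

theorem chord_zero_le (s : Torus) : chord s 0 ≤ 2 := by
  rw [chord_zero_eq]
  refine (norm_sub_le _ _).trans ?_
  rw [norm_fourier_apply, norm_one]; norm_num

theorem chord_nonneg (x y : Torus) : 0 ≤ chord x y := norm_nonneg _

theorem logK_nonneg (s : Torus) : 0 ≤ logK s := by
  unfold logK
  have := Real.log_nonpos (div_nonneg (chord_nonneg s 0) zero_le_two)
    (by linarith [chord_zero_le s])
  linarith

theorem measurable_logK : Measurable logK :=
  (Real.measurable_log.comp (continuous_chord_zero.measurable.div_const 2)).neg

theorem logK_eq {s : Torus} (h : s ≠ 0) : logK s = Real.log 2 - Real.log (chord s 0) := by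
  unfold logK
  rw [Real.log_div (chord_zero_pos h).ne' two_ne_zero]; ring

theorem one_sub_le_norm {r : ℝ} (h0 : 0 ≤ r) (s : Torus) :
    1 - r ≤ ‖1 - (r : ℂ) * fourier 1 s‖ := by
  have h1 := norm_sub_norm_le (1 : ℂ) ((r : ℂ) * fourier 1 s)
  rwa [norm_mul, norm_fourier_apply, norm_one, mul_one, Complex.norm_real,
    Real.norm_of_nonneg h0] at h1

theorem norm_le_two {r : ℝ} (h0 : 0 ≤ r) (h1 : r ≤ 1) (s : Torus) :
    ‖1 - (r : ℂ) * fourier 1 s‖ ≤ 2 := by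
  refine (norm_sub_le _ _).trans ?_
  rw [norm_mul, norm_fourier_apply, norm_one, mul_one, Complex.norm_real, Real.norm_of_nonneg h0]
  linarith

/-- With z = e^{is}, |1 - z| ≤ |1 - rz| + (1 - r) and 1 - r ≤ |1 - rz|. This dominates the
regularised kernels by `logK` + log 2, uniformly in r. -/
theorem chord_le_two_mul_norm {r : ℝ} (h0 : 0 ≤ r) (h1 : r ≤ 1) (s : Torus) :
    chord s 0 ≤ 2 * ‖1 - (r : ℂ) * fourier 1 s‖ := by
  have h2 := one_sub_le_norm h0 s
  have h3 : (1 : ℂ) - fourier 1 s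
      = (1 - (r : ℂ) * fourier 1 s) - ((1 - r : ℝ) : ℂ) * fourier 1 s := by push_cast; ring
  rw [chord_zero_eq, h3]
  refine (norm_sub_le _ _).trans ?_
  rw [norm_mul, norm_fourier_apply, mul_one, Complex.norm_real,
    Real.norm_of_nonneg (by linarith : 0 ≤ 1 - r)]
  linarith

theorem continuous_logKr {r : ℝ} (h0 : 0 ≤ r) (h1 : r < 1) : Continuous (logKr r) := by
  refine continuous_const.sub (Continuous.log ?_ fun s => ?_)
  · exact (continuous_const.sub
      (continuous_const.mul (map_continuous (fourier (T := 2 * Real.pi) 1)))).norm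
  · have := one_sub_le_norm h0 s
    linarith

theorem logKr_nonneg {r : ℝ} (h0 : 0 ≤ r) (h1 : r < 1) (s : Torus) : 0 ≤ logKr r s := by
  have h2 := one_sub_le_norm h0 s
  have := Real.log_le_log (by linarith) (norm_le_two h0 h1.le s)
  unfold logKr
  linarith

theorem logKr_le {r : ℝ} (h0 : 0 ≤ r) (h1 : r < 1) {s : Torus} (hs : s ≠ 0) :
    logKr r s ≤ logK s + Real.log 2 := by
  have h2 := one_sub_le_norm h0 s
  have h3 := Real.log_le_log (chord_zero_pos hs) (chord_le_two_mul_norm h0 h1.le s)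
  rw [Real.log_mul two_ne_zero (by linarith)] at h3
  rw [logK_eq hs]
  unfold logKr
  linarith

/-- A sequence of radii tending to `1`. -/
def radius (k : ℕ) : ℝ := 1 - 1 / ((k : ℝ) + 1)

theorem radius_nonneg (k : ℕ) : 0 ≤ radius k := by
  unfold radius
  have : 1 / ((k : ℝ) + 1) ≤ 1 := by
    rw [div_le_one (by positivity)]
    linarith [(Nat.cast_nonneg k : (0 : ℝ) ≤ k)]
  linarith

theorem radius_lt_one (k : ℕ) : radius k < 1 := by
  unfold radius
  have : 0 < 1 / ((k : ℝ) + 1) := by positivity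
  linarith

theorem tendsto_radius : Tendsto radius atTop (𝓝 1) := by
  have := (tendsto_one_div_add_atTop_nhds_zero_nat (𝕜 := ℝ)).const_sub 1
  rw [sub_zero] at this
  exact this

theorem tendsto_norm_radius (s : Torus) :
    Tendsto (fun k => ‖1 - (radius k : ℂ) * fourier 1 s‖) atTop (𝓝 (chord s 0)) := by
  rw [chord_zero_eq]
  have h1 : Tendsto (fun k => (radius k : ℂ)) atTop (𝓝 ((1 : ℝ) : ℂ)) :=
    (Complex.continuous_ofReal.tendsto 1).comp tendsto_radius
  have h2 := ((h1.mul_const (fourier 1 s)).const_sub 1).norm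
  simpa using h2

theorem tendsto_logKr {s : Torus} (hs : s ≠ 0) :
    Tendsto (fun k => logKr (radius k) s) atTop (𝓝 (logK s)) := by
  rw [logK_eq hs]
  exact ((tendsto_norm_radius s).log (chord_zero_pos hs).ne').const_sub _

/-- The real part of the Taylor series of -log(1 - re^{is}). The term n = 0 vanishes, division by
zero giving 0; hence log 2 stands apart. -/
theorem hasSum_logKr {r : ℝ} (h0 : 0 ≤ r) (h1 : r < 1) (s : Torus) :
    HasSum (fun n : ℕ => r ^ n / n * (fourier (n : ℤ) s : ℂ).re) (logKr r s - Real.log 2) := by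
  have hz : ‖(r : ℂ) * fourier 1 s‖ < 1 := by
    rwa [norm_mul, norm_fourier_apply, mul_one, Complex.norm_real, Real.norm_of_nonneg h0]
  have h2 := Complex.hasSum_re (Complex.hasSum_taylorSeries_neg_log hz)
  have e : (-Complex.log (1 - (r : ℂ) * fourier 1 s)).re = logKr r s - Real.log 2 := by
    rw [Complex.neg_re, Complex.log_re]
    unfold logKr; ring
  rw [e] at h2
  refine h2.congr_fun fun n => ?_
  have e2 : ((r : ℂ) * fourier 1 s) ^ n / n = ((r ^ n / n : ℝ) : ℂ) * fourier (n : ℤ) s := by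
    have : (fourier 1 s : ℂ) ^ n = fourier (n : ℤ) s := by
      rw [fourier_apply, fourier_apply, one_zsmul, natCast_zsmul, AddCircle.toCircle_nsmul,
        Circle.coe_pow]
    rw [mul_pow, this]; push_cast; ring
  rw [e2, Complex.re_ofReal_mul]

theorem fourier_re_eq (n : ℤ) (s : Torus) : (fourier n s : ℂ).re = (cas n s + cas (-n) s) / 2 := by
  rw [cas_apply, cas_apply, fourier_neg, Complex.conj_re, Complex.conj_im]; ring

/-- The multiplier of the convolution with the logarithmic kernel. -/
def khat (n : ℤ) : ℝ := if n = 0 then 2 * Real.pi * Real.log 2 else Real.pi / |(n : ℝ)|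

theorem khat_nonneg (n : ℤ) : 0 ≤ khat n := by
  unfold khat
  have := Real.log_nonneg (one_le_two : (1 : ℝ) ≤ 2)
  have := Real.pi_pos
  split_ifs <;> positivity

theorem khat_neg (n : ℤ) : khat (-n) = khat n := by
  unfold khat
  simp

theorem integral_fourier_re_mul_cas (j : ℕ) (n : ℤ) :
    ∫ s : Torus, (fourier (j : ℤ) s : ℂ).re * cas n s
      = Real.pi * ((if (j : ℤ) = n then 1 else 0) + if -(j : ℤ) = n then 1 else 0) := by
  have h : ∀ s : Torus, (fourier (j : ℤ) s : ℂ).re * cas n s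
      = (1 / 2) * (cas j s * cas n s) + (1 / 2) * (cas (-j) s * cas n s) := by
    intro s; rw [fourier_re_eq]; ring
  simp_rw [h]
  rw [integral_add (integrable_continuous (by fun_prop)) (integrable_continuous (by fun_prop)),
    integral_const_mul, integral_const_mul, integral_cas_mul_cas, integral_cas_mul_cas]
  split_ifs <;> ring

theorem summable_pow {r : ℝ} (h0 : 0 ≤ r) (h1 : r < 1) : Summable fun n : ℕ => r ^ n :=
  summable_geometric_of_lt_one h0 h1

theorem abs_pow_div_le {r : ℝ} (h0 : 0 ≤ r) (n : ℕ) : |r ^ n / n| ≤ r ^ n := by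
  rw [abs_of_nonneg (by positivity)]
  rcases Nat.eq_zero_or_pos n with rfl | hn
  · simp
  · exact div_le_self (by positivity) (by exact_mod_cast hn)

theorem integral_logKr_mul_cas {r : ℝ} (h0 : 0 ≤ r) (h1 : r < 1) (n : ℤ) :
    ∫ s, logKr r s * cas n s = r ^ n.natAbs * khat n := by
  have hF : ∀ j : ℕ, Integrable fun s : Torus =>
      r ^ j / j * (fourier (j : ℤ) s : ℂ).re * cas n s := fun j => by
    simp_rw [fourier_re_eq]
    exact integrable_continuous (by fun_prop)
  have hb : ∀ (j : ℕ) (s : Torus), ‖r ^ j / j * (fourier (j : ℤ) s : ℂ).re * cas n s‖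
      ≤ r ^ j * 2 := by
    intro j s
    rw [norm_mul, norm_mul]
    refine mul_le_mul ?_ (abs_cas_le n s) (norm_nonneg _) (by positivity)
    refine (mul_le_mul (abs_pow_div_le h0 j) ((Complex.abs_re_le_norm _).trans
      (norm_fourier_apply _ _).le) (abs_nonneg _) (by positivity)).trans (by simp)
  have hsum : Summable fun j : ℕ => ∫ s : Torus, ‖r ^ j / j * (fourier (j : ℤ) s : ℂ).re * cas n s‖ := by
    refine Summable.of_nonneg_of_le (fun j => integral_nonneg fun s => norm_nonneg _) (fun j => ?_)
      ((summable_pow h0 h1).mul_right (2 * (2 * Real.pi)))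
    have h2 : ∫ s : Torus, ‖r ^ j / j * (fourier (j : ℤ) s : ℂ).re * cas n s‖
        ≤ ∫ s : Torus, r ^ j * 2 :=
      integral_mono (hF j).norm (integrable_const _) (hb j)
    refine h2.trans (le_of_eq ?_)
    rw [integral_const, smul_eq_mul, Measure.real, AddCircle.measure_univ,
      ENNReal.toReal_ofReal Real.two_pi_pos.le]; ring
  have h3 := hasSum_integral_of_summable_integral_norm hF hsum
  have h4 : ∀ s, ∑' j : ℕ, r ^ j / j * (fourier (j : ℤ) s : ℂ).re * cas n s
      = logKr r s * cas n s - Real.log 2 * cas n s := by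
    intro s
    rw [((hasSum_logKr h0 h1 s).mul_right (cas n s)).tsum_eq]; ring
  simp_rw [h4] at h3
  have hlog : ∫ s, Real.log 2 * cas n s = if n = 0 then 2 * Real.pi * Real.log 2 else 0 := by
    have := integral_cas_mul_cas 0 n
    simp_rw [cas_zero, one_mul] at this
    rw [integral_const_mul, this]
    by_cases hn : n = 0
    · simp [hn]; ring
    · simp [hn, Ne.symm hn]
  have hi1 : Integrable fun s => logKr r s * cas n s :=
    integrable_continuous ((continuous_logKr h0 h1).mul (cas n).continuous)
  rw [integral_sub hi1 (integrable_continuous (by fun_prop)), hlog] at h3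
  have h5 : ∀ j : ℕ, ∫ s : Torus, r ^ j / j * (fourier (j : ℤ) s : ℂ).re * cas n s
      = r ^ j / j * (Real.pi * ((if (j : ℤ) = n then 1 else 0) + if -(j : ℤ) = n then 1 else 0)) := by
    intro j
    rw [← integral_fourier_re_mul_cas, ← integral_const_mul]
    congr 1; funext s; ring
  simp_rw [h5] at h3
  have h6 := hasSum_single (f := fun j : ℕ => r ^ j / j *
    (Real.pi * ((if (j : ℤ) = n then 1 else 0) + if -(j : ℤ) = n then 1 else 0))) n.natAbs
    (fun j hj => by
      have e1 : ¬ (j : ℤ) = n := by omega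
      have e2 : ¬ -(j : ℤ) = n := by omega
      simp [e1, e2])
  have h7 := h3.unique h6
  rw [sub_eq_iff_eq_add] at h7
  rw [h7]
  unfold khat
  by_cases hn : n = 0
  · simp [hn]
  · have hab : ((n.natAbs : ℕ) : ℝ) = |(n : ℝ)| := by
      rw [Nat.cast_natAbs]; push_cast; rfl
    have : ((if (n.natAbs : ℤ) = n then (1 : ℝ) else 0) + if -(n.natAbs : ℤ) = n then 1 else 0) = 1 := by
      rcases lt_or_gt_of_ne hn with h | h
      · rw [if_neg (by omega), if_pos (by omega)]; simp
      · rw [if_pos (by omega), if_neg (by omega)]; simp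
    rw [this, hab]
    simp only [hn, if_false]
    ring

theorem ae_ne_zero : ∀ᵐ s : Torus, s ≠ 0 := by
  have : (volume : Measure Torus) {0} = 0 := by
    have := AddCircle.volume_closedBall (T := 2 * Real.pi) (x := 0) 0
    simpa using this
  rw [ae_iff]
  simpa using this

theorem summable_khat_sq : Summable fun n => khat n ^ 2 := by
  have hs : Summable fun n : ℤ => Real.pi ^ 2 * (1 / (n : ℝ) ^ 2) :=
    ((Real.summable_one_div_int_pow (p := 2)).2 (by norm_num)).mul_left _
  refine (hs.add (summable_of_ne_finset_zero (s := {0})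
    (f := fun n : ℤ => if n = 0 then khat 0 ^ 2 else 0) fun n hn => ?_)).of_nonneg_of_le
    (fun n => sq_nonneg _) fun n => ?_
  · simp at hn; simp [hn]
  · by_cases hn : n = 0
    · subst hn; simp
    · simp only [khat, hn, if_false, div_pow, sq_abs]
      rw [add_zero, mul_one_div]

/-- Fatou's lemma as r → 1: by Parseval, the L² norms of the regularised kernels are bounded by the
square summable sequence `khat`. -/
theorem memLp_logK : MemLp logK 2 (volume : Measure Torus) := by
  refine (memLp_two_iff_integrable_sq measurable_logK.aestronglyMeasurable).2 ?_
  refine ⟨(measurable_logK.pow_const 2).aestronglyMeasurable, ?_⟩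
  rw [hasFiniteIntegral_iff_ofReal (Eventually.of_forall fun s => sq_nonneg _)]
  have h1 : ∫⁻ s, ENNReal.ofReal (logK s ^ 2)
      ≤ liminf (fun k => ∫⁻ s, ENNReal.ofReal (logKr (radius k) s ^ 2)) atTop := by
    refine le_trans (lintegral_mono_ae ?_) (lintegral_liminf_le fun k =>
      ENNReal.measurable_ofReal.comp
        ((continuous_logKr (radius_nonneg k) (radius_lt_one k)).measurable.pow_const 2))
    filter_upwards [ae_ne_zero] with s hs
    exact (((ENNReal.continuous_ofReal.tendsto _).comp ((tendsto_logKr hs).pow 2)).liminf_eq).ge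
  have h2 : ∀ k, ∫⁻ s, ENNReal.ofReal (logKr (radius k) s ^ 2)
      ≤ ENNReal.ofReal (casNorm ^ 2 * ∑' n, khat n ^ 2) := by
    intro k
    have hc := continuous_logKr (radius_nonneg k) (radius_lt_one k)
    have hi : Integrable fun s => logKr (radius k) s ^ 2 := integrable_continuous (hc.pow 2)
    rw [← ofReal_integral_eq_lintegral_ofReal hi
      (Eventually.of_forall fun s => sq_nonneg _)]
    refine ENNReal.ofReal_le_ofReal ?_
    have e1 : ∫ s, logKr (radius k) s ^ 2 = ‖toL2 ⟨logKr (radius k), hc⟩‖ ^ 2 := by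
      rw [l2_norm_sq]
      refine integral_congr_ae ?_
      filter_upwards [coeFn_toL2 ⟨logKr (radius k), hc⟩] with s hs
      rw [hs, sq]; rfl
    rw [e1]
    refine hasSum_le (fun n => ?_) (hasSum_casCoeff_sq _) (summable_khat_sq.hasSum.mul_left _)
    rw [casCoeff_congr (coeFn_toL2 _)]
    change casCoeff (logKr (radius k)) n ^ 2 ≤ _
    unfold casCoeff
    rw [integral_logKr_mul_cas (radius_nonneg k) (radius_lt_one k), mul_pow, mul_pow]
    refine mul_le_mul_of_nonneg_left ?_ (sq_nonneg _)
    refine mul_le_of_le_one_left (sq_nonneg _) ?_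
    exact pow_le_one₀ (pow_nonneg (radius_nonneg k) _)
      (pow_le_one₀ (radius_nonneg k) (radius_lt_one k).le)
  exact (h1.trans (liminf_le_of_frequently_le' (Frequently.of_forall h2))).trans_lt
    ENNReal.ofReal_lt_top

theorem integrable_logK : Integrable logK :=
  memLp_one_iff_integrable.1 (memLp_logK.mono_exponent (by norm_num))

theorem integral_logK_mul_cas (n : ℤ) : ∫ s, logK s * cas n s = khat n := by
  have h1 : Tendsto (fun k => ∫ s, logKr (radius k) s * cas n s) atTop
      (𝓝 (∫ s, logK s * cas n s)) := by
    refine tendsto_integral_of_dominated_convergence (fun s => (logK s + Real.log 2) * 2) ?_ ?_ ?_ ?_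
    · exact fun k => ((continuous_logKr (radius_nonneg k) (radius_lt_one k)).mul
        (cas n).continuous).aestronglyMeasurable
    · exact (integrable_logK.add (integrable_const _)).mul_const 2
    · intro k
      filter_upwards [ae_ne_zero] with s hs
      rw [norm_mul]
      have h2 := logKr_le (radius_nonneg k) (radius_lt_one k) hs
      have h3 := logKr_nonneg (radius_nonneg k) (radius_lt_one k) s
      rw [Real.norm_of_nonneg h3]
      exact mul_le_mul h2 (abs_cas_le n s) (norm_nonneg _) (h3.trans h2)
    · filter_upwards [ae_ne_zero] with s hs
      exact (tendsto_logKr hs).mul_const _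
  have h2 : Tendsto (fun k => radius k ^ n.natAbs * khat n) atTop (𝓝 (1 ^ n.natAbs * khat n)) :=
    (tendsto_radius.pow _).mul_const _
  rw [one_pow, one_mul] at h2
  refine tendsto_nhds_unique h1 (h2.congr fun k => ?_)
  rw [integral_logKr_mul_cas (radius_nonneg k) (radius_lt_one k)]

theorem cas_sub (n : ℤ) (x s : Torus) :
    cas n (x - s) = (cas n s + cas (-n) s) / 2 * cas n x - (cas n s - cas (-n) s) / 2 * cas (-n) x := by
  induction s using QuotientAddGroup.induction_on with
  | H t =>
    have h1 := cas_add_coe n x (-t)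
    have h2 := cas_coe n t
    have h3 := cas_neg_coe n t
    have e : x + ((-t : ℝ) : Torus) = x - (t : Torus) := by
      rw [sub_eq_add_neg]; rfl
    rw [e, mul_neg, Real.cos_neg, Real.sin_neg] at h1
    have h4 : Real.cos (n * t) = (cas n (t : Torus) + cas (-n) (t : Torus)) / 2 := by
      rw [h2, h3]; ring
    have h5 : Real.sin (n * t) = (cas n (t : Torus) - cas (-n) (t : Torus)) / 2 := by
      rw [h2, h3]; ring
    rw [h4, h5] at h1
    refine h1.trans ?_
    ring

theorem measurePreserving_sub_left (x : Torus) :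
    MeasurePreserving (fun y : Torus => x - y) volume volume :=
  Measure.measurePreserving_sub_left volume x

theorem memLp_logK_sub (x : Torus) : MemLp (fun y => logK (x - y)) 2 (volume : Measure Torus) :=
  memLp_logK.comp_measurePreserving (measurePreserving_sub_left x)

theorem casCoeff_logK_sub (x : Torus) (n : ℤ) :
    casCoeff (fun y => logK (x - y)) n = casNorm * (khat n * cas n x) := by
  unfold casCoeff
  congr 1
  have hm := integral_sub_left_eq_self (fun y => logK y * cas n (x - y)) (volume : Measure Torus) x
  simp only [sub_sub_cancel] at hm
  rw [hm]
  have hi : ∀ k, Integrable fun s => logK s * cas k s := fun k =>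
    integrable_logK.mul_bdd (c := 2) (cas k).continuous.aestronglyMeasurable
      (Eventually.of_forall (abs_cas_le k))
  have h : ∀ s, logK s * cas n (x - s)
      = ((cas n x - cas (-n) x) / 2) * (logK s * cas n s)
        + ((cas n x + cas (-n) x) / 2) * (logK s * cas (-n) s) := by
    intro s; rw [cas_sub]; ring
  simp_rw [h]
  rw [integral_add ((hi n).const_mul _) ((hi (-n)).const_mul _), integral_const_mul,
    integral_const_mul, integral_logK_mul_cas, integral_logK_mul_cas, khat_neg]
  ring

/-- The logarithmic potential. -/
def pot (f : Torus → ℝ) (x : Torus) : ℝ := ∫ y, logK (x - y) * f y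

theorem abs_khat_le (n : ℤ) : |khat n| ≤ 2 * Real.pi := by
  have hpi := Real.pi_pos
  rw [abs_of_nonneg (khat_nonneg n)]
  unfold khat
  split_ifs with h
  · have := Real.log_two_lt_d9
    nlinarith
  · have : (1 : ℝ) ≤ |(n : ℝ)| := by exact_mod_cast Int.one_le_abs h
    rw [div_le_iff₀ (by linarith)]
    nlinarith

/-- The logarithmic potential as an operator on `L²`. -/
def potOp : L2T →L[ℝ] L2T := mulOp (Equiv.refl ℤ) khat (2 * Real.pi) abs_khat_le

theorem casCoeff_potOp (f : L2T) (n : ℤ) : casCoeff (potOp f) n = khat n * casCoeff f n :=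
  casCoeff_mulOp _ _ _ _ _ _

/-- The multiplier n · π/|n| is π sign(n). This is what links the logarithmic interaction with the
Hilbert transform. -/
theorem isWeakDeriv_potOp (f : L2T) : IsWeakDeriv (potOp f) (Real.pi • hilb f) :=
  isWeakDeriv_iff.2 fun n => by
    rw [casCoeff_smul, casCoeff_hilb, casCoeff_potOp, khat_neg]
    by_cases hn : n = 0
    · simp [hn]
    · have h : (n : ℝ) / |(n : ℝ)| = (n.sign : ℝ) := by
        rcases lt_or_gt_of_ne hn with h | h
        · have h' : (n : ℝ) < 0 := by exact_mod_cast h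
          rw [abs_of_neg h', Int.sign_eq_neg_one_of_neg h, div_neg, div_self h'.ne]; simp
        · have h' : (0 : ℝ) < n := by exact_mod_cast h
          rw [abs_of_pos h', Int.sign_eq_one_of_pos h, div_self h'.ne']; simp
      rw [← h]
      simp only [khat, hn, if_false]
      ring

theorem pot_congr {f g : Torus → ℝ} (h : f =ᵐ[volume] g) : pot f = pot g := by
  funext x
  refine integral_congr_ae ?_
  filter_upwards [h] with y hy
  rw [hy]

/-- The Fourier series of the potential converges absolutely, its coefficients being products of two
square summable sequences; Parseval's identity against the translate of `logK` identifies its value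
at every point. -/
theorem exists_pot_eq (f : L2T) : ∃ U : C(Torus, ℝ), potOp f = toL2 U ∧ ∀ x, pot f x = U x := by
  have hterm : ∀ n : ℤ, ‖casCoeff (potOp f) n • (casNorm • cas n)‖
      ≤ casNorm * 2 * (khat n ^ 2 + casCoeff f n ^ 2) := by
    intro n
    rw [norm_smul, norm_smul, casCoeff_potOp, Real.norm_of_nonneg casNorm_pos.le]
    have h1 : ‖cas n‖ ≤ 2 := (ContinuousMap.norm_le _ (by norm_num)).2 fun x => abs_cas_le n x
    have h2 : ‖khat n * casCoeff f n‖ ≤ khat n ^ 2 + casCoeff f n ^ 2 := by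
      rw [Real.norm_eq_abs, abs_le]
      constructor <;> nlinarith [sq_nonneg (khat n + casCoeff f n), sq_nonneg (khat n - casCoeff f n)]
    calc _ ≤ (khat n ^ 2 + casCoeff f n ^ 2) * (casNorm * 2) :=
          mul_le_mul h2 (mul_le_mul_of_nonneg_left h1 casNorm_pos.le)
            (mul_nonneg casNorm_pos.le (norm_nonneg _)) (by positivity)
      _ = _ := by ring
  have hsum : Summable fun n : ℤ => casCoeff (potOp f) n • (casNorm • cas n) :=
    Summable.of_norm_bounded ((summable_khat_sq.add (hasSum_casCoeff_sq f).summable).mul_left _) hterm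
  refine ⟨∑' n : ℤ, casCoeff (potOp f) n • (casNorm • cas n), ?_, fun x => ?_⟩
  · have h1 := (hsum.hasSum).mapL toL2
    have h2 := casBasis.hasSum_repr (potOp f)
    refine h2.unique (h1.congr_fun fun n => ?_)
    rw [casBasis_repr, casBasis_apply, map_smul toL2 (casCoeff (potOp f) n)]
  · have h1 := (hsum.hasSum).mapL (ContinuousMap.evalCLM ℝ x)
    have h2 := hasSum_casCoeff_mul ((memLp_logK_sub x).toLp _) f
    have h3 : inner ℝ ((memLp_logK_sub x).toLp _) f = pot f x := by
      rw [l2_inner]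
      refine integral_congr_ae ?_
      filter_upwards [(memLp_logK_sub x).coeFn_toLp] with y hy
      rw [hy]
    rw [h3] at h2
    refine h2.unique (h1.congr_fun fun n => ?_)
    rw [casCoeff_congr (memLp_logK_sub x).coeFn_toLp, casCoeff_logK_sub]
    simp only [casCoeff_potOp, ContinuousMap.evalCLM_apply, ContinuousMap.smul_apply, smul_eq_mul]
    ring

/-! ### Positivity of the logarithmic energy -/

/-- Convergence holds also on the diagonal, where both sides become infinite. This gives
measurability of the kernel and allows Fatou's lemma for measures that may charge the diagonal. -/
theorem tendsto_ofReal_logKr (x y : Torus) :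
    Tendsto (fun k => ENNReal.ofReal (logKr (radius k) (x - y))) atTop (𝓝 (logKernel x y)) := by
  unfold logKernel
  by_cases h : x = y
  · subst h
    rw [if_pos rfl, sub_self]
    refine ENNReal.tendsto_ofReal_atTop.comp ?_
    have h1 : Tendsto (fun k => ‖1 - (radius k : ℂ) * fourier 1 (0 : Torus)‖) atTop (𝓝[>] 0) := by
      refine tendsto_nhdsWithin_iff.2 ⟨?_, Eventually.of_forall fun k => ?_⟩
      · have := tendsto_norm_radius 0
        rwa [show chord 0 0 = 0 by unfold chord; simp] at this
      · have h1 := one_sub_le_norm (radius_nonneg k) 0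
        have h2 := radius_lt_one k
        exact lt_of_lt_of_le (by linarith) h1
    have h2 := tendsto_neg_atBot_atTop.comp (Real.tendsto_log_nhdsGT_zero.comp h1)
    exact tendsto_atTop_add_const_left _ (Real.log 2) h2
  · rw [if_neg h, chord_eq_sub]
    exact (ENNReal.continuous_ofReal.tendsto _).comp (tendsto_logKr (sub_ne_zero.2 h))

theorem logKernel_of_ne {x y : Torus} (h : x ≠ y) :
    logKernel x y = ENNReal.ofReal (logK (x - y)) := by
  unfold logKernel logK
  rw [if_neg h, chord_eq_sub]

theorem continuous_logKr_sub (k : ℕ) :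
    Continuous fun p : Torus × Torus => logKr (radius k) (p.1 - p.2) :=
  (continuous_logKr (radius_nonneg k) (radius_lt_one k)).comp (continuous_fst.sub continuous_snd)

theorem measurable_logKernel : Measurable fun p : Torus × Torus => logKernel p.1 p.2 :=
  measurable_of_tendsto_metrizable
    (f := fun k (p : Torus × Torus) => ENNReal.ofReal (logKr (radius k) (p.1 - p.2)))
    (fun k => ENNReal.measurable_ofReal.comp (continuous_logKr_sub k).measurable)
    (tendsto_pi_nhds.2 fun p => tendsto_ofReal_logKr p.1 p.2)

theorem integrable_continuous_prod {μ : Measure (Torus × Torus)} [IsFiniteMeasure μ]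
    {f : Torus × Torus → ℝ} (hf : Continuous f) : Integrable f μ :=
  hf.integrable_of_hasCompactSupport (HasCompactSupport.of_compactSpace f)

/-- The mutual logarithmic energy. -/
def mutualEnergy (ν₁ ν₂ : Measure Torus) : ℝ≥0∞ := ∫⁻ x, ∫⁻ y, logKernel x y ∂ν₂ ∂ν₁

theorem mutualEnergy_eq (ν₁ ν₂ : Measure Torus) [IsFiniteMeasure ν₁] [IsFiniteMeasure ν₂] :
    mutualEnergy ν₁ ν₂ = ∫⁻ p, logKernel p.1 p.2 ∂(ν₁.prod ν₂) :=
  (lintegral_prod _ measurable_logKernel.aemeasurable).symm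

/-- The addition formula separates the variables in cos n(x - y), leaving products of Fourier
coefficients of the two measures with nonnegative weights rⁿ/n. -/
theorem hasSum_integral_logKr {r : ℝ} (h0 : 0 ≤ r) (h1 : r < 1) (ν₁ ν₂ : Measure Torus)
    [IsProbabilityMeasure ν₁] [IsProbabilityMeasure ν₂] :
    HasSum (fun n : ℕ => r ^ n / n *
      ((∫ x, (fourier (n : ℤ) x : ℂ).re ∂ν₁) * (∫ x, (fourier (n : ℤ) x : ℂ).re ∂ν₂)
        + (∫ x, (fourier (n : ℤ) x : ℂ).im ∂ν₁) * (∫ x, (fourier (n : ℤ) x : ℂ).im ∂ν₂)))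
      (∫ p : Torus × Torus, logKr r (p.1 - p.2) ∂(ν₁.prod ν₂) - Real.log 2) := by
  have hcf : ∀ n : ℤ, Continuous fun x : Torus => (fourier n x : ℂ) := fun n =>
    map_continuous (fourier (T := 2 * Real.pi) n)
  have hcre : ∀ n : ℤ, Continuous fun x : Torus => (fourier n x : ℂ).re := fun n =>
    Complex.continuous_re.comp (hcf n)
  have hcim : ∀ n : ℤ, Continuous fun x : Torus => (fourier n x : ℂ).im := fun n =>
    Complex.continuous_im.comp (hcf n)
  have hF : ∀ j : ℕ, Integrable (fun p : Torus × Torus =>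
      r ^ j / j * (fourier (j : ℤ) (p.1 - p.2) : ℂ).re) (ν₁.prod ν₂) := fun j =>
    integrable_continuous_prod (((hcre j).comp (continuous_fst.sub continuous_snd)).const_mul _)
  have hb : ∀ (j : ℕ) (s : Torus), ‖r ^ j / j * (fourier (j : ℤ) s : ℂ).re‖ ≤ r ^ j := by
    intro j s
    rw [norm_mul]
    exact (mul_le_mul (abs_pow_div_le h0 j) ((Complex.abs_re_le_norm _).trans
      (norm_fourier_apply _ _).le) (abs_nonneg _) (by positivity)).trans (by simp)
  have hsum : Summable fun j : ℕ => ∫ p : Torus × Torus,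
      ‖r ^ j / j * (fourier (j : ℤ) (p.1 - p.2) : ℂ).re‖ ∂(ν₁.prod ν₂) := by
    refine Summable.of_nonneg_of_le (fun j => integral_nonneg fun s => norm_nonneg _) (fun j => ?_)
      (summable_pow h0 h1)
    refine (integral_mono (hF j).norm (integrable_const _) fun p => hb j _).trans (le_of_eq ?_)
    rw [integral_const, probReal_univ, one_smul]
  have h3 := hasSum_integral_of_summable_integral_norm hF hsum
  have h4 : ∀ p : Torus × Torus, ∑' j : ℕ, r ^ j / j * (fourier (j : ℤ) (p.1 - p.2) : ℂ).re
      = logKr r (p.1 - p.2) - Real.log 2 := fun p => (hasSum_logKr h0 h1 _).tsum_eq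
  simp_rw [h4] at h3
  have hi : Integrable (fun p : Torus × Torus => logKr r (p.1 - p.2)) (ν₁.prod ν₂) :=
    integrable_continuous_prod ((continuous_logKr h0 h1).comp (continuous_fst.sub continuous_snd))
  rw [integral_sub hi (integrable_const _), integral_const, probReal_univ, one_smul] at h3
  refine h3.congr_fun fun n => ?_
  rw [integral_const_mul]
  congr 1
  have e : ∀ p : Torus × Torus, (fourier (n : ℤ) (p.1 - p.2) : ℂ).re
      = (fourier (n : ℤ) p.1 : ℂ).re * (fourier (n : ℤ) p.2 : ℂ).re
        + (fourier (n : ℤ) p.1 : ℂ).im * (fourier (n : ℤ) p.2 : ℂ).im := by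
    intro p
    have : (fourier (n : ℤ) (p.1 - p.2) : ℂ)
        = fourier (n : ℤ) p.1 * (starRingEnd ℂ) (fourier (n : ℤ) p.2) := by
      rw [← fourier_neg, fourier_apply, fourier_apply, fourier_apply, smul_sub, sub_eq_add_neg,
        neg_smul]
      exact congrArg Subtype.val (AddCircle.toCircle_add _ _)
    rw [this, Complex.mul_re, Complex.conj_re, Complex.conj_im]; ring
  simp_rw [e]
  have i1 : Integrable (fun p : Torus × Torus => (fourier (n : ℤ) p.1 : ℂ).re
      * (fourier (n : ℤ) p.2 : ℂ).re) (ν₁.prod ν₂) :=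
    integrable_continuous_prod (((hcre n).comp continuous_fst).mul ((hcre n).comp continuous_snd))
  have i2 : Integrable (fun p : Torus × Torus => (fourier (n : ℤ) p.1 : ℂ).im
      * (fourier (n : ℤ) p.2 : ℂ).im) (ν₁.prod ν₂) :=
    integrable_continuous_prod (((hcim n).comp continuous_fst).mul ((hcim n).comp continuous_snd))
  rw [integral_add i1 i2, integral_prod_mul (fun x => (fourier (n : ℤ) x : ℂ).re)
    (fun x => (fourier (n : ℤ) x : ℂ).re), integral_prod_mul (fun x => (fourier (n : ℤ) x : ℂ).im)
    (fun x => (fourier (n : ℤ) x : ℂ).im)]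

theorem two_mul_integral_logKr_le {r : ℝ} (h0 : 0 ≤ r) (h1 : r < 1) (ν₁ ν₂ : Measure Torus)
    [IsProbabilityMeasure ν₁] [IsProbabilityMeasure ν₂] :
    2 * ∫ p : Torus × Torus, logKr r (p.1 - p.2) ∂(ν₁.prod ν₂)
      ≤ (∫ p : Torus × Torus, logKr r (p.1 - p.2) ∂(ν₁.prod ν₁))
        + ∫ p : Torus × Torus, logKr r (p.1 - p.2) ∂(ν₂.prod ν₂) := by
  have h := hasSum_le (fun n => ?_) ((hasSum_integral_logKr h0 h1 ν₁ ν₂).mul_left 2)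
    ((hasSum_integral_logKr h0 h1 ν₁ ν₁).add (hasSum_integral_logKr h0 h1 ν₂ ν₂))
  · linarith
  · set a := ∫ x, (fourier (n : ℤ) x : ℂ).re ∂ν₁
    set b := ∫ x, (fourier (n : ℤ) x : ℂ).re ∂ν₂
    set c := ∫ x, (fourier (n : ℤ) x : ℂ).im ∂ν₁
    set d := ∫ x, (fourier (n : ℤ) x : ℂ).im ∂ν₂
    have : 0 ≤ r ^ n / n * ((a - b) ^ 2 + (c - d) ^ 2) := by positivity
    linarith

/-- For r < 1 the difference of the two sides is ∑ (rⁿ/n)|ν̂₁(n) - ν̂₂(n)|². As r → 1, the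
self-energies converge by domination and the mutual energy is controlled by Fatou's lemma, so its
finiteness need not be known beforehand. -/
theorem two_mul_mutualEnergy_le (ν₁ ν₂ : Measure Torus) [IsProbabilityMeasure ν₁]
    [IsProbabilityMeasure ν₂] : 2 * mutualEnergy ν₁ ν₂ ≤ logEnergy ν₁ + logEnergy ν₂ := by
  by_cases hfin : logEnergy ν₁ = ⊤ ∨ logEnergy ν₂ = ⊤
  · rcases hfin with h | h <;> simp [h]
  push Not at hfin
  have hmeas : ∀ k, Measurable fun p : Torus × Torus =>
      ENNReal.ofReal (logKr (radius k) (p.1 - p.2)) := fun k =>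
    ENNReal.measurable_ofReal.comp (continuous_logKr_sub k).measurable
  have hof : ∀ (ν₁ ν₂ : Measure Torus) [IsProbabilityMeasure ν₁] [IsProbabilityMeasure ν₂] (k : ℕ),
      ∫⁻ p : Torus × Torus, ENNReal.ofReal (logKr (radius k) (p.1 - p.2)) ∂(ν₁.prod ν₂)
        = ENNReal.ofReal (∫ p : Torus × Torus, logKr (radius k) (p.1 - p.2) ∂(ν₁.prod ν₂)) := by
    intro ν₁ ν₂ _ _ k
    rw [ofReal_integral_eq_lintegral_ofReal (integrable_continuous_prod (continuous_logKr_sub k))]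
    exact Eventually.of_forall fun p => logKr_nonneg (radius_nonneg k) (radius_lt_one k) _
  have hlim : ∀ (ν : Measure Torus) [IsProbabilityMeasure ν], logEnergy ν ≠ ⊤ →
      Tendsto (fun k => ENNReal.ofReal (∫ p : Torus × Torus, logKr (radius k) (p.1 - p.2) ∂(ν.prod ν)))
        atTop (𝓝 (logEnergy ν)) := by
    intro ν _ hν
    have hE : logEnergy ν = ∫⁻ p, logKernel p.1 p.2 ∂(ν.prod ν) := mutualEnergy_eq ν ν
    simp_rw [← hof]
    rw [hE]
    refine tendsto_lintegral_of_dominated_convergence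
      (fun p => logKernel p.1 p.2 + ENNReal.ofReal (Real.log 2)) hmeas (fun k => ?_) ?_ ?_
    · refine Eventually.of_forall fun p => ?_
      by_cases h : p.1 = p.2
      · simp [logKernel, h]
      · simp only
        rw [logKernel_of_ne h, ← ENNReal.ofReal_add (logK_nonneg _)
          (Real.log_nonneg one_le_two)]
        exact ENNReal.ofReal_le_ofReal
          (logKr_le (radius_nonneg k) (radius_lt_one k) (sub_ne_zero.2 h))
    · rw [lintegral_add_left measurable_logKernel, ← hE, lintegral_const, measure_univ, mul_one]
      exact ENNReal.add_ne_top.2 ⟨hν, ENNReal.ofReal_ne_top⟩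
    · exact Eventually.of_forall fun p => tendsto_ofReal_logKr p.1 p.2
  have hM : mutualEnergy ν₁ ν₂ ≤ liminf (fun k => ENNReal.ofReal
      (∫ p : Torus × Torus, logKr (radius k) (p.1 - p.2) ∂(ν₁.prod ν₂))) atTop := by
    simp_rw [← hof]
    rw [mutualEnergy_eq]
    refine le_trans (lintegral_mono fun p => ?_) (lintegral_liminf_le hmeas)
    exact (tendsto_ofReal_logKr p.1 p.2).liminf_eq.ge
  have hsum := (hlim ν₁ hfin.1).add (hlim ν₂ hfin.2)
  refine le_of_forall_lt fun b hb => ?_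
  have hb2 : b / 2 < mutualEnergy ν₁ ν₂ :=
    ENNReal.div_lt_of_lt_mul' hb
  obtain ⟨b', hb1, hb3⟩ := exists_between hb2
  have hev := eventually_lt_of_lt_liminf (lt_of_lt_of_le hb3 hM)
  have hle : 2 * b' ≤ logEnergy ν₁ + logEnergy ν₂ := by
    refine ge_of_tendsto hsum ?_
    filter_upwards [hev] with k hk
    have hn : ∀ (ν₁ ν₂ : Measure Torus) [IsProbabilityMeasure ν₁] [IsProbabilityMeasure ν₂],
      0 ≤ ∫ p : Torus × Torus, logKr (radius k) (p.1 - p.2) ∂(ν₁.prod ν₂) := fun ν₁ ν₂ _ _ =>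
      integral_nonneg fun p => logKr_nonneg (radius_nonneg k) (radius_lt_one k) _
    rw [← ENNReal.ofReal_add (hn ν₁ ν₁) (hn ν₂ ν₂)]
    refine le_trans ?_ (ENNReal.ofReal_le_ofReal
      (two_mul_integral_logKr_le (radius_nonneg k) (radius_lt_one k) ν₁ ν₂))
    rw [ENNReal.ofReal_mul zero_le_two, ENNReal.ofReal_ofNat]
    gcongr
  refine lt_of_lt_of_le ?_ hle
  rwa [ENNReal.div_lt_iff (by simp) (by simp), mul_comm] at hb1

/-! ### The Euler–Lagrange equation characterises minimizers -/

/-- The density as a continuous map. -/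
def Density.cmap (ρ : Density) : C(Torus, ℝ) := ⟨ρ.toFun, ρ.continuous_toFun⟩

theorem Density.cmap_apply (ρ : Density) (x : Torus) : ρ.cmap x = ρ.toFun x := rfl

theorem Density.measurable_ofReal (ρ : Density) : Measurable fun x => ENNReal.ofReal (ρ.toFun x) :=
  ENNReal.measurable_ofReal.comp ρ.continuous_toFun.measurable

instance (ρ : Density) : IsProbabilityMeasure ρ.measure := ⟨by
  unfold Density.measure
  rw [withDensity_apply _ MeasurableSet.univ, setLIntegral_univ,
    ← ofReal_integral_eq_lintegral_ofReal (integrable_continuous ρ.continuous_toFun)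
      (Eventually.of_forall fun x => (ρ.pos x).le), ρ.integral_eq_one, ENNReal.ofReal_one]⟩

theorem Density.exists_pot_eq (ρ : Density) : ∃ U : C(Torus, ℝ),
    potOp (toL2 ρ.cmap) = toL2 U ∧ pot ρ.toFun = U := by
  obtain ⟨U, h1, h2⟩ := CircleGas.exists_pot_eq (toL2 ρ.cmap)
  refine ⟨U, h1, funext fun x => ?_⟩
  rw [← h2, pot_congr (coeFn_toL2 ρ.cmap)]
  rfl

theorem Density.continuous_pot (ρ : Density) : Continuous (pot ρ.toFun) := by
  obtain ⟨U, -, h⟩ := ρ.exists_pot_eq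
  rw [h]; exact U.continuous

theorem Density.pot_nonneg (ρ : Density) (x : Torus) : 0 ≤ pot ρ.toFun x :=
  integral_nonneg fun y => mul_nonneg (logK_nonneg _) (ρ.pos y).le

theorem ae_ne (x : Torus) : ∀ᵐ y : Torus, y ≠ x := by
  have : (volume : Measure Torus) {x} = 0 := by
    have := AddCircle.volume_closedBall (T := 2 * Real.pi) (x := x) 0
    simpa using this
  rw [ae_iff]
  simpa using this

theorem Density.lintegral_logKernel (ρ : Density) (x : Torus) :
    ∫⁻ y, logKernel x y ∂ρ.measure = ENNReal.ofReal (pot ρ.toFun x) := by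
  have hm : Measurable fun y => logKernel x y := measurable_logKernel.comp measurable_prodMk_left
  unfold Density.measure pot
  have hi : Integrable fun y => logK (x - y) * ρ.toFun y := by
    obtain ⟨C, hC⟩ := isCompact_univ.exists_bound_of_continuousOn (f := ρ.toFun)
      ρ.continuous_toFun.continuousOn
    exact (memLp_one_iff_integrable.1 ((memLp_logK_sub x).mono_exponent (by norm_num))).mul_bdd
      (c := C) ρ.continuous_toFun.aestronglyMeasurable (Eventually.of_forall fun y => hC y trivial)
  rw [ofReal_integral_eq_lintegral_ofReal hi
    (Eventually.of_forall fun y => mul_nonneg (logK_nonneg _) (ρ.pos y).le),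
    lintegral_withDensity_eq_lintegral_mul _
      ρ.measurable_ofReal hm]
  refine lintegral_congr_ae ?_
  filter_upwards [ae_ne x] with y hy
  rw [Pi.mul_apply, logKernel_of_ne (Ne.symm hy), mul_comm, ENNReal.ofReal_mul (logK_nonneg _)]

theorem integrable_continuous_measure {ν : Measure Torus} [IsFiniteMeasure ν] {f : Torus → ℝ}
    (hf : Continuous f) : Integrable f ν :=
  hf.integrable_of_hasCompactSupport (HasCompactSupport.of_compactSpace f)

theorem Density.mutualEnergy_eq (ρ : Density) (ν : Measure Torus) [IsProbabilityMeasure ν] :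
    mutualEnergy ν ρ.measure = ENNReal.ofReal (∫ x, pot ρ.toFun x ∂ν) := by
  unfold mutualEnergy
  simp_rw [ρ.lintegral_logKernel]
  rw [ofReal_integral_eq_lintegral_ofReal (integrable_continuous_measure ρ.continuous_pot)
    (Eventually.of_forall ρ.pot_nonneg)]

section EquilibriumDensity

variable {V : Torus → ℝ}

theorem integrable_refDensity (hV : Continuous V) :
    Integrable fun x => Real.exp (-V x) / (2 * Real.pi) :=
  integrable_continuous ((Real.continuous_exp.comp hV.neg).div_const _)

theorem isFiniteMeasure_refMeasure (hV : Continuous V) : IsFiniteMeasure (refMeasure V) :=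
  isFiniteMeasure_withDensity_ofReal (integrable_refDensity hV).2

/-- The Euler–Lagrange equation for the free energy. -/
def EulerLagrange (β : ℝ) (V : Torus → ℝ) (ρ : Density) : Prop :=
  ∃ c : ℝ, ∀ x, Real.log (ρ.toFun x) = c - V x - 2 * β * pot ρ.toFun x

/-- Writing ρ dx as an exponential tilt of the reference measure, with normalising constant 1, gives
access to the log-likelihood formulas for tilted measures. -/
theorem Density.measure_eq_tilted (ρ : Density) (hV : Continuous V) :
    ρ.measure = (refMeasure V).tilted
      (fun x => Real.log (ρ.toFun x) + V x + Real.log (2 * Real.pi)) ∧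
    ∫ x, Real.exp (Real.log (ρ.toFun x) + V x + Real.log (2 * Real.pi)) ∂(refMeasure V) = 1 := by
  have hd : Measurable fun x => ENNReal.ofReal (Real.exp (-V x) / (2 * Real.pi)) :=
    ENNReal.measurable_ofReal.comp ((Real.continuous_exp.comp hV.neg).div_const _).measurable
  have he : ∀ x, Real.exp (Real.log (ρ.toFun x) + V x + Real.log (2 * Real.pi))
      = ρ.toFun x * Real.exp (V x) * (2 * Real.pi) := fun x => by
    rw [Real.exp_add, Real.exp_add, Real.exp_log (ρ.pos x), Real.exp_log Real.two_pi_pos]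
  have hm : ∀ x, Real.exp (-V x) / (2 * Real.pi) * (ρ.toFun x * Real.exp (V x) * (2 * Real.pi))
      = ρ.toFun x := by
    intro x
    have := Real.pi_ne_zero
    rw [Real.exp_neg]
    have := (Real.exp_pos (V x)).ne'
    field_simp
  have hint : ∫ x, Real.exp (Real.log (ρ.toFun x) + V x + Real.log (2 * Real.pi)) ∂(refMeasure V)
      = 1 := by
    simp_rw [he]
    unfold refMeasure
    rw [integral_withDensity_eq_integral_toReal_smul hd
      (Eventually.of_forall fun x => ENNReal.ofReal_lt_top), ← ρ.integral_eq_one]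
    congr 1; funext x
    rw [ENNReal.toReal_ofReal (by positivity), smul_eq_mul, hm]
  refine ⟨?_, hint⟩
  unfold Measure.tilted
  rw [hint]
  simp_rw [div_one, he]
  unfold refMeasure Density.measure
  have hm2 : Measurable fun x => ENNReal.ofReal (ρ.toFun x * Real.exp (V x) * (2 * Real.pi)) :=
    ENNReal.measurable_ofReal.comp ((ρ.continuous_toFun.mul
      (Real.continuous_exp.comp hV)).mul continuous_const).measurable
  rw [← withDensity_mul _ hd hm2]
  congr 1; funext x
  rw [Pi.mul_apply, ← ENNReal.ofReal_mul (by positivity), hm]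

theorem continuous_log_density (ρ : Density) : Continuous fun x => Real.log (ρ.toFun x) :=
  ρ.continuous_toFun.log fun x => (ρ.pos x).ne'

/-- Let f be the log-density of ρ dx with respect to μ₀. Then K(ν | μ₀) equals K(ν | ρ dx) + ∫ f dν,
up to the mass constant, and f is constant minus 2βU. Hence F(ν) - F(ρ dx) - K(ν | ρ dx) is β times
the energy of ν - ρ dx, which is nonnegative. The extra entropy term yields uniqueness. -/
theorem EulerLagrange.freeEnergy_le {β : ℝ} (hβ : 0 < β) (hV : Continuous V) {ρ : Density}
    (h : EulerLagrange β V ρ) :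
    freeEnergy β V ρ.measure ≠ ⊤ ∧ ∀ ν : Measure Torus, IsProbabilityMeasure ν →
      freeEnergy β V ρ.measure + InformationTheory.klDiv ν ρ.measure ≤ freeEnergy β V ν := by
  obtain ⟨c, hc⟩ := h
  have := isFiniteMeasure_refMeasure hV
  set f : Torus → ℝ := fun x => Real.log (ρ.toFun x) + V x + Real.log (2 * Real.pi) with hf
  have hfc : Continuous f := ((continuous_log_density ρ).add hV).add continuous_const
  obtain ⟨htilt, hone⟩ := ρ.measure_eq_tilted hV
  have hexp : Integrable (fun x => Real.exp (f x)) (refMeasure V) :=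
    integrable_continuous_measure (Real.continuous_exp.comp hfc)
  have hac : ρ.measure ≪ refMeasure V := htilt ▸ tilted_absolutelyContinuous _ _
  have hllr : llr ρ.measure (refMeasure V) =ᵐ[ρ.measure] f := by
    have h1 := log_rnDeriv_tilted_left_self hexp
    rw [← htilt] at h1
    refine hac.ae_le ?_
    filter_upwards [h1] with x hx
    rw [llr, hx, hone, Real.log_one, sub_zero]
  have hρint : Integrable (llr ρ.measure (refMeasure V)) ρ.measure :=
    (integrable_continuous_measure hfc).congr hllr.symm
  have hKρ := InformationTheory.toReal_klDiv hac hρint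
  have hKρtop := InformationTheory.klDiv_ne_top hac hρint
  rw [integral_congr_ae hllr, probReal_univ (μ := ρ.measure)] at hKρ
  have hEρ : logEnergy ρ.measure = ENNReal.ofReal (∫ x, pot ρ.toFun x ∂ρ.measure) :=
    ρ.mutualEnergy_eq ρ.measure
  have hmnn : ∀ (ν : Measure Torus), 0 ≤ ∫ x, pot ρ.toFun x ∂ν := fun ν =>
    integral_nonneg ρ.pot_nonneg
  have hFρtop : freeEnergy β V ρ.measure ≠ ⊤ := by
    unfold freeEnergy
    rw [hEρ]
    exact ENNReal.add_ne_top.2 ⟨ENNReal.mul_ne_top ENNReal.ofReal_ne_top ENNReal.ofReal_ne_top, hKρtop⟩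
  refine ⟨hFρtop, fun ν _ => ?_⟩
  by_cases hFν : freeEnergy β V ν = ⊤
  · rw [hFν]; exact le_top
  have hKν : InformationTheory.klDiv ν (refMeasure V) ≠ ⊤ := (ENNReal.add_ne_top.1 hFν).2
  have hEν : logEnergy ν ≠ ⊤ := by
    intro htop
    have := (ENNReal.add_ne_top.1 hFν).1
    rw [htop, ENNReal.mul_top (ENNReal.ofReal_pos.2 hβ).ne'] at this
    exact this rfl
  obtain ⟨hνac, hνint⟩ := InformationTheory.klDiv_ne_top_iff.1 hKν
  have hKν' := InformationTheory.toReal_klDiv hνac hνint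
  rw [probReal_univ (μ := ν)] at hKν'
  have hfν : Integrable f ν := integrable_continuous_measure hfc
  have hνρ : ν ≪ ρ.measure := hνac.trans (htilt ▸ absolutelyContinuous_tilted hexp)
  have hνρint : Integrable (llr ν ρ.measure) ν := by
    rw [htilt]; exact integrable_llr_tilted_right hνac hfν hνint hexp
  have hKνρ := InformationTheory.toReal_klDiv_of_measure_eq hνρ (by simp)
  have hKtop := InformationTheory.klDiv_ne_top hνρ hνρint
  have hE := two_mul_mutualEnergy_le ν ρ.measure
  rw [ρ.mutualEnergy_eq, hEρ] at hE
  have hE' := ENNReal.toReal_mono (ENNReal.add_ne_top.2 ⟨hEν, ENNReal.ofReal_ne_top⟩) hE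
  rw [ENNReal.toReal_add hEν ENNReal.ofReal_ne_top, ENNReal.toReal_mul,
    ENNReal.toReal_ofReal (hmnn _), ENNReal.toReal_ofReal (hmnn _), ENNReal.toReal_ofNat] at hE'
  have hlin : ∫ x, llr ν ρ.measure x ∂ν = ∫ x, llr ν (refMeasure V) x ∂ν - ∫ x, f x ∂ν := by
    have h2 := integral_llr_tilted_right hνac hfν hexp hνint
    rw [← htilt, hone, Real.log_one, add_zero] at h2
    exact h2
  -- The Euler–Lagrange equation enters here: ∫ f dν depends on ν only through its mutual energy
  -- with ρ dx.
  have hfeq : ∀ (ν : Measure Torus) [IsProbabilityMeasure ν],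
      ∫ x, f x ∂ν = (c + Real.log (2 * Real.pi)) - 2 * β * ∫ x, pot ρ.toFun x ∂ν := by
    intro ν _
    have : ∀ x, f x = (c + Real.log (2 * Real.pi)) - 2 * β * pot ρ.toFun x := by
      intro x; simp only [hf, hc]; ring
    simp_rw [this]
    rw [integral_sub (integrable_const _)
      ((integrable_continuous_measure ρ.continuous_pot).const_mul _), integral_const_mul,
      integral_const, probReal_univ, one_smul]
  have hsum : freeEnergy β V ρ.measure + InformationTheory.klDiv ν ρ.measure ≠ ⊤ :=
    ENNReal.add_ne_top.2 ⟨hFρtop, hKtop⟩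
  rw [← ENNReal.toReal_le_toReal hsum hFν, ENNReal.toReal_add hFρtop hKtop]
  unfold freeEnergy
  rw [ENNReal.toReal_add (ENNReal.mul_ne_top ENNReal.ofReal_ne_top hEν) hKν,
    ENNReal.toReal_add (ENNReal.add_ne_top.1 hFρtop).1 hKρtop, ENNReal.toReal_mul, ENNReal.toReal_mul,
    ENNReal.toReal_ofReal hβ.le, hKρ, hKν', hKνρ, hlin, hEρ, ENNReal.toReal_ofReal (hmnn _),
    hfeq ν, hfeq ρ.measure]
  nlinarith [mul_le_mul_of_nonneg_left hE' hβ.le]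

theorem EulerLagrange.isEquilibriumDensity {β : ℝ} (hβ : 0 < β) (hV : Continuous V) {ρ : Density}
    (h : EulerLagrange β V ρ) : IsEquilibriumDensity β V ρ := fun ν hν =>
  le_self_add.trans ((h.freeEnergy_le hβ hV).2 ν hν)

/-- Two minimizers have relative entropy zero, so their densities agree almost everywhere and, being
continuous, everywhere. -/
theorem EulerLagrange.of_isEquilibriumDensity {β : ℝ} (hβ : 0 < β) (hV : Continuous V)
    {ρ ρ' : Density} (h : EulerLagrange β V ρ) (h' : IsEquilibriumDensity β V ρ') :
    EulerLagrange β V ρ' := by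
  obtain ⟨h1, h2⟩ := h.freeEnergy_le hβ hV
  have h3 := (h2 ρ'.measure inferInstance).trans (h' ρ.measure inferInstance)
  have h4 : InformationTheory.klDiv ρ'.measure ρ.measure = 0 := by
    by_contra hne
    have := ENNReal.lt_add_right h1 hne
    exact absurd h3 (not_le.2 this)
  have h5 := InformationTheory.klDiv_eq_zero_iff.1 h4
  have h6 : (fun x => ENNReal.ofReal (ρ'.toFun x)) =ᵐ[volume]
      fun x => ENNReal.ofReal (ρ.toFun x) :=
    (withDensity_eq_iff_of_sigmaFinite
      ρ'.measurable_ofReal.aemeasurable ρ.measurable_ofReal.aemeasurable).1 h5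
  have h7 : ρ'.toFun = ρ.toFun := by
    refine (Continuous.ae_eq_iff_eq volume ρ'.continuous_toFun ρ.continuous_toFun).1 ?_
    filter_upwards [h6] with x hx
    exact (ENNReal.ofReal_eq_ofReal_iff (ρ'.pos x).le (ρ.pos x).le).1 hx
  unfold EulerLagrange
  rw [h7]
  exact h

end EquilibriumDensity

/-! ### Existence of a solution of the Euler–Lagrange equation -/

/-- A Lipschitz strongly monotone map of a Hilbert space has a zero. -/
theorem exists_zero_of_strongly_monotone {E : Type*} [NormedAddCommGroup E]
    [InnerProductSpace ℝ E] [CompleteSpace E] (A : E → E) {L : ℝ}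
    (hmono : ∀ x y, ‖x - y‖ ^ 2 ≤ inner ℝ (A x - A y) (x - y))
    (hlip : ∀ x y, ‖A x - A y‖ ≤ L * ‖x - y‖) : ∃ x, A x = 0 := by
  set M : ℝ := max L 1
  have hM : 1 ≤ M := le_max_right _ _
  have hlip' : ∀ x y, ‖A x - A y‖ ≤ M * ‖x - y‖ := fun x y =>
    (hlip x y).trans (mul_le_mul_of_nonneg_right (le_max_left _ _) (norm_nonneg _))
  -- The map x ↦ x - τAx has squared Lipschitz constant at most 1 - 2τ + τ²M², which is 1 - τ for
  -- this τ; a zero of A is a fixed point.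
  set τ : ℝ := 1 / M ^ 2 with hτ
  have hτ0 : 0 < τ := by positivity
  have hτM : τ * M ^ 2 = 1 := by rw [hτ]; field_simp
  have hτ1 : τ ≤ 1 := by
    rw [hτ, div_le_one (by positivity)]
    exact one_le_pow₀ hM
  set q : ℝ := Real.sqrt (1 - τ)
  have hq1 : q < 1 := by
    rw [show (1 : ℝ) = Real.sqrt 1 by simp]
    exact Real.sqrt_lt_sqrt (by linarith) (by simpa using hτ0)
  have hcontr : ContractingWith ⟨q, Real.sqrt_nonneg _⟩ (fun x => x - τ • A x) := by
    refine ⟨by exact_mod_cast hq1, LipschitzWith.of_dist_le_mul fun x y => ?_⟩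
    rw [dist_eq_norm, dist_eq_norm]
    have e : x - τ • A x - (y - τ • A y) = (x - y) - τ • (A x - A y) := by
      rw [smul_sub]; abel
    rw [e]
    change _ ≤ q * ‖x - y‖
    refine abs_le_of_sq_le_sq' ?_ (by positivity) |>.2
    rw [norm_sub_sq_real, inner_smul_right, norm_smul, mul_pow, mul_pow, Real.sq_sqrt (by linarith),
      real_inner_comm, Real.norm_of_nonneg hτ0.le]
    have h1 := hmono x y
    have h2 : ‖A x - A y‖ ^ 2 ≤ M ^ 2 * ‖x - y‖ ^ 2 := by
      rw [← mul_pow]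
      exact pow_le_pow_left₀ (norm_nonneg _) (hlip' x y) 2
    have h3 : τ ^ 2 * ‖A x - A y‖ ^ 2 ≤ τ * ‖x - y‖ ^ 2 := by
      calc τ ^ 2 * ‖A x - A y‖ ^ 2 ≤ τ ^ 2 * (M ^ 2 * ‖x - y‖ ^ 2) :=
            mul_le_mul_of_nonneg_left h2 (by positivity)
        _ = τ * (τ * M ^ 2) * ‖x - y‖ ^ 2 := by ring
        _ = _ := by rw [hτM, mul_one]
    nlinarith [mul_le_mul_of_nonneg_left h1 hτ0.le]
  refine ⟨hcontr.fixedPoint, ?_⟩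
  have h := hcontr.fixedPoint_isFixedPt
  have h2 : τ • A hcontr.fixedPoint = 0 := by
    have h3 : hcontr.fixedPoint - τ • A hcontr.fixedPoint = hcontr.fixedPoint := h
    exact sub_eq_self.1 h3
  exact (smul_eq_zero.1 h2).resolve_left hτ0.ne'

theorem abs_sqrt_khat_le (n : ℤ) : |Real.sqrt (khat n)| ≤ Real.sqrt (2 * Real.pi) := by
  rw [abs_of_nonneg (Real.sqrt_nonneg _)]
  exact Real.sqrt_le_sqrt ((le_abs_self _).trans (abs_khat_le n))

/-- The square root of the potential operator. -/
def sqrtPotOp : L2T →L[ℝ] L2T :=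
  mulOp (Equiv.refl ℤ) (fun n => Real.sqrt (khat n)) _ abs_sqrt_khat_le

theorem casCoeff_sqrtPotOp (f : L2T) (n : ℤ) :
    casCoeff (sqrtPotOp f) n = Real.sqrt (khat n) * casCoeff f n := casCoeff_mulOp _ _ _ _ _ _

theorem sqrtPotOp_sqrtPotOp (f : L2T) : sqrtPotOp (sqrtPotOp f) = potOp f :=
  casCoeff_ext fun n => by
    rw [casCoeff_sqrtPotOp, casCoeff_sqrtPotOp, casCoeff_potOp, ← mul_assoc,
      Real.mul_self_sqrt (khat_nonneg n)]

theorem inner_sqrtPotOp (f g : L2T) : inner ℝ (sqrtPotOp f) g = inner ℝ f (sqrtPotOp g) := by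
  refine (hasSum_casCoeff_mul _ _).unique ((hasSum_casCoeff_mul _ _).congr_fun fun n => ?_)
  rw [casCoeff_sqrtPotOp, casCoeff_sqrtPotOp]; ring

/-- The function `exp (-2 β t⁺) - 1`. -/
def cutExp (β t : ℝ) : ℝ := Real.exp (-(2 * β * max t 0)) - 1

theorem abs_exp_neg_sub_le {a b : ℝ} (ha : 0 ≤ a) (hb : 0 ≤ b) :
    |Real.exp (-a) - Real.exp (-b)| ≤ |a - b| := by
  wlog h : a ≤ b generalizing a b
  · rw [abs_sub_comm, abs_sub_comm a]
    exact this hb ha (le_of_not_ge h)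
  have h1 : Real.exp (-b) ≤ Real.exp (-a) := Real.exp_le_exp.2 (by linarith)
  rw [abs_of_nonneg (by linarith), abs_of_nonpos (by linarith)]
  have h2 := Real.add_one_le_exp (-(b - a))
  have h3 : Real.exp (-b) = Real.exp (-a) * Real.exp (-(b - a)) := by
    rw [← Real.exp_add]; congr 1; ring
  have h4 : Real.exp (-a) ≤ 1 := Real.exp_le_one_iff.2 (by linarith)
  have h5 := Real.exp_pos (-a)
  rw [h3]
  nlinarith

theorem lipschitzWith_cutExp {β : ℝ} (hβ : 0 < β) : LipschitzWith (2 * β).toNNReal (cutExp β) := by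
  refine LipschitzWith.of_dist_le_mul fun s t => ?_
  rw [Real.coe_toNNReal _ (by positivity), Real.dist_eq, Real.dist_eq]
  have h1 := abs_exp_neg_sub_le (a := 2 * β * max s 0) (b := 2 * β * max t 0) (by positivity)
    (by positivity)
  have h2 : |max s 0 - max t 0| ≤ |s - t| := abs_max_sub_max_le_abs s t 0
  unfold cutExp
  rw [sub_sub_sub_cancel_right]
  refine h1.trans ?_
  rw [← mul_sub, abs_mul, abs_of_pos (by positivity : 0 < 2 * β)]
  exact mul_le_mul_of_nonneg_left h2 (by positivity)

theorem cutExp_zero (β : ℝ) : cutExp β 0 = 0 := by simp [cutExp]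

theorem cutExp_antitone {β : ℝ} (hβ : 0 < β) : Antitone (cutExp β) := by
  intro s t h
  unfold cutExp
  have : max s 0 ≤ max t 0 := max_le_max_right 0 h
  have := mul_le_mul_of_nonneg_left this (by positivity : 0 ≤ 2 * β)
  have := Real.exp_le_exp.2 (neg_le_neg this)
  linarith

theorem cutExp_add_one_pos (β t : ℝ) : 0 < 1 + cutExp β t := by
  unfold cutExp
  have := Real.exp_pos (-(2 * β * max t 0))
  linarith

theorem cutExp_nonpos {β : ℝ} (hβ : 0 < β) (t : ℝ) : cutExp β t ≤ 0 := by
  unfold cutExp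
  have : Real.exp (-(2 * β * max t 0)) ≤ 1 :=
    Real.exp_le_one_iff.2 (neg_nonpos.2 (by positivity))
  linarith

/-- The superposition operator `w ↦ q exp (-2 β w⁺)`. -/
def expOp {β : ℝ} (hβ : 0 < β) (q : C(Torus, ℝ)) (w : L2T) : L2T :=
  mulC q (toL2 1 + (lipschitzWith_cutExp hβ).compLp (cutExp_zero β) w)

theorem coeFn_expOp {β : ℝ} (hβ : 0 < β) (q : C(Torus, ℝ)) (w : L2T) :
    expOp hβ q w =ᵐ[volume] fun x => q x * (1 + cutExp β (w x)) := by
  unfold expOp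
  filter_upwards [coeFn_mulC q (toL2 1 + (lipschitzWith_cutExp hβ).compLp (cutExp_zero β) w),
    Lp.coeFn_add (toL2 1) ((lipschitzWith_cutExp hβ).compLp (cutExp_zero β) w),
    (lipschitzWith_cutExp hβ).coeFn_compLp (cutExp_zero β) w, coeFn_toL2 1] with x h1 h2 h3 h4
  rw [h1, h2, Pi.add_apply, h3, h4]
  rfl

theorem norm_expOp_sub_le {β : ℝ} (hβ : 0 < β) (q : C(Torus, ℝ)) (w w' : L2T) :
    ‖expOp hβ q w - expOp hβ q w'‖ ≤ ‖q‖ * (2 * β) * ‖w - w'‖ := by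
  unfold expOp
  rw [← map_sub, add_sub_add_left_eq_sub, mul_assoc]
  refine (norm_mulC_le _ _).trans (mul_le_mul_of_nonneg_left ?_ (norm_nonneg _))
  have := (lipschitzWith_cutExp hβ).norm_compLp_sub_le (cutExp_zero β) w w'
  rwa [Real.coe_toNNReal _ (by positivity)] at this

theorem inner_expOp_nonpos {β : ℝ} (hβ : 0 < β) {q : C(Torus, ℝ)} (hq : ∀ x, 0 ≤ q x) (w w' : L2T) :
    inner ℝ (expOp hβ q w - expOp hβ q w') (w - w') ≤ 0 := by
  rw [l2_inner]
  refine integral_nonpos_of_ae ?_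
  filter_upwards [coeFn_expOp hβ q w, coeFn_expOp hβ q w',
    Lp.coeFn_sub (expOp hβ q w) (expOp hβ q w'), Lp.coeFn_sub w w'] with x h1 h2 h3 h4
  rw [h3, h4, Pi.sub_apply, Pi.sub_apply, h1, h2]
  have e : (q x * (1 + cutExp β (w x)) - q x * (1 + cutExp β (w' x))) * (w x - w' x)
      = q x * ((cutExp β (w x) - cutExp β (w' x)) * (w x - w' x)) := by ring
  rw [e]
  refine mul_nonpos_of_nonneg_of_nonpos (hq x) ?_
  rcases le_total (w x) (w' x) with h | h
  · exact mul_nonpos_of_nonneg_of_nonpos (sub_nonneg.2 (cutExp_antitone hβ h)) (sub_nonpos.2 h)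
  · exact mul_nonpos_of_nonpos_of_nonneg (sub_nonpos.2 (cutExp_antitone hβ h)) (sub_nonneg.2 h)

theorem norm_expOp_le {β : ℝ} (hβ : 0 < β) (q : C(Torus, ℝ)) (w : L2T) :
    ‖expOp hβ q w‖ ≤ ‖q‖ * ‖toL2 1‖ := by
  refine Lp.norm_le_mul_norm_of_ae_le_mul ?_
  filter_upwards [coeFn_expOp hβ q w, coeFn_toL2 1] with x h1 h2
  rw [h1, h2, norm_mul]
  refine mul_le_mul (q.norm_coe_le_norm x) ?_ (norm_nonneg _) (norm_nonneg _)
  have h3 := cutExp_add_one_pos β (w x)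
  have h4 := cutExp_nonpos hβ (w x)
  rw [Real.norm_of_nonneg h3.le]
  simpa using h4

/-- With S = `sqrtPotOp` and v = Sf the equation becomes v - s·S(`expOp`(Sv)) = 0. The superposition
operator is decreasing and S is symmetric, so this is the identity plus a monotone Lipschitz map. -/
theorem exists_fixed_density {β : ℝ} (hβ : 0 < β) {q : C(Torus, ℝ)} (hq : ∀ x, 0 ≤ q x) {s : ℝ}
    (hs : 0 ≤ s) : ∃ f : L2T, f = s • expOp hβ q (potOp f) := by
  have e : ∀ x y : L2T, x - s • sqrtPotOp (expOp hβ q (sqrtPotOp x))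
      - (y - s • sqrtPotOp (expOp hβ q (sqrtPotOp y)))
      = (x - y) - s • sqrtPotOp (expOp hβ q (sqrtPotOp x) - expOp hβ q (sqrtPotOp y)) := by
    intro x y
    rw [map_sub, smul_sub]; abel
  have hmono : ∀ x y : L2T, ‖x - y‖ ^ 2 ≤ inner ℝ (x - s • sqrtPotOp (expOp hβ q (sqrtPotOp x))
      - (y - s • sqrtPotOp (expOp hβ q (sqrtPotOp y)))) (x - y) := by
    intro x y
    rw [e, inner_sub_left, real_inner_self_eq_norm_sq, inner_smul_left, inner_sqrtPotOp, map_sub]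
    have := mul_nonpos_of_nonneg_of_nonpos hs (inner_expOp_nonpos hβ hq (sqrtPotOp x) (sqrtPotOp y))
    simp only [conj_trivial]
    linarith
  have hlip : ∀ x y : L2T, ‖x - s • sqrtPotOp (expOp hβ q (sqrtPotOp x))
      - (y - s • sqrtPotOp (expOp hβ q (sqrtPotOp y)))‖
      ≤ (1 + s * (‖sqrtPotOp‖ * (‖q‖ * (2 * β) * ‖sqrtPotOp‖))) * ‖x - y‖ := by
    intro x y
    rw [e]
    refine (norm_sub_le _ _).trans ?_
    rw [norm_smul, Real.norm_of_nonneg hs, add_mul, one_mul, mul_assoc s]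
    refine add_le_add le_rfl (mul_le_mul_of_nonneg_left ?_ hs)
    refine (sqrtPotOp.le_opNorm _).trans ?_
    rw [mul_assoc]
    refine mul_le_mul_of_nonneg_left ((norm_expOp_sub_le hβ q _ _).trans ?_) (norm_nonneg _)
    rw [mul_assoc (‖q‖ * (2 * β)), ← map_sub]
    exact mul_le_mul_of_nonneg_left (sqrtPotOp.le_opNorm _) (by positivity)
  obtain ⟨v, hv⟩ := exists_zero_of_strongly_monotone
    (fun v : L2T => v - s • sqrtPotOp (expOp hβ q (sqrtPotOp v))) hmono hlip
  refine ⟨s • expOp hβ q (sqrtPotOp v), ?_⟩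
  have h1 : sqrtPotOp (s • expOp hβ q (sqrtPotOp v)) = v := by
    rw [map_smul]; exact (sub_eq_zero.1 hv).symm
  rw [← sqrtPotOp_sqrtPotOp (s • _), h1]

/-- Subtract the equations at s and t and pair the result with the difference of the potentials.
Monotonicity discards the nonlinear difference, leaving a bound of order |s - t| for the square root
of the energy; the equation then transfers it to F itself. -/
theorem continuous_expOp_lipschitz {β : ℝ} (hβ : 0 < β) {q : C(Torus, ℝ)} (hq : ∀ x, 0 ≤ q x)
    {F : ℝ → L2T} (hF : ∀ s, 0 ≤ s → F s = s • expOp hβ q (potOp (F s))) :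
    ContinuousOn F (Set.Ici 0) := by
  set N := ‖q‖ * ‖toL2 1‖
  set T := ‖sqrtPotOp‖
  have hN : 0 ≤ N := by positivity
  have hT : 0 ≤ T := norm_nonneg _
  have hv : ∀ s t, 0 ≤ s → 0 ≤ t → ‖sqrtPotOp (F s) - sqrtPotOp (F t)‖ ≤ |s - t| * (N * T) := by
    intro s t hs ht
    set d := sqrtPotOp (F s) - sqrtPotOp (F t) with hd
    have hd' : d = sqrtPotOp (F s - F t) := by rw [map_sub]
    have e : F s - F t = s • (expOp hβ q (potOp (F s)) - expOp hβ q (potOp (F t)))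
        + (s - t) • expOp hβ q (potOp (F t)) := by
      rw [smul_sub, sub_smul, ← hF s hs, ← hF t ht]; abel
    have h1 : ‖d‖ ^ 2 = inner ℝ (F s - F t) (potOp (F s) - potOp (F t)) := by
      rw [← real_inner_self_eq_norm_sq]
      nth_rw 1 [hd']
      rw [inner_sqrtPotOp, hd, map_sub, sqrtPotOp_sqrtPotOp, sqrtPotOp_sqrtPotOp]
    have h2 : ‖d‖ ^ 2 ≤ (s - t) * inner ℝ (expOp hβ q (potOp (F t))) (potOp (F s) - potOp (F t)) := by
      have h3 := mul_nonpos_of_nonneg_of_nonpos hs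
        (inner_expOp_nonpos hβ hq (potOp (F s)) (potOp (F t)))
      have h4 : inner ℝ (F s - F t) (potOp (F s) - potOp (F t))
          = s * inner ℝ (expOp hβ q (potOp (F s)) - expOp hβ q (potOp (F t)))
              (potOp (F s) - potOp (F t))
            + (s - t) * inner ℝ (expOp hβ q (potOp (F t))) (potOp (F s) - potOp (F t)) := by
        conv_lhs => rw [e]
        rw [inner_add_left, inner_smul_left, inner_smul_left]
        simp only [conj_trivial]
      rw [h1, h4]
      linarith
    have h5 : ‖potOp (F s) - potOp (F t)‖ ≤ T * ‖d‖ := by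
      rw [← sqrtPotOp_sqrtPotOp, ← sqrtPotOp_sqrtPotOp, ← map_sub]
      exact sqrtPotOp.le_opNorm _
    have h6 : (s - t) * inner ℝ (expOp hβ q (potOp (F t))) (potOp (F s) - potOp (F t))
        ≤ |s - t| * (N * (T * ‖d‖)) := by
      refine (le_abs_self _).trans ?_
      rw [abs_mul]
      refine mul_le_mul_of_nonneg_left ((abs_real_inner_le_norm _ _).trans ?_) (abs_nonneg _)
      exact mul_le_mul (norm_expOp_le hβ q _) h5 (norm_nonneg _) hN
    by_contra hlt
    push Not at hlt
    have hdpos : 0 < ‖d‖ := lt_of_le_of_lt (by positivity) hlt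
    nlinarith
  have hF' : ∀ s t, 0 ≤ s → 0 ≤ t →
      ‖F s - F t‖ ≤ s * (‖q‖ * (2 * β) * (T * (|s - t| * (N * T)))) + |s - t| * N := by
    intro s t hs ht
    have e : F s - F t = s • (expOp hβ q (potOp (F s)) - expOp hβ q (potOp (F t)))
        + (s - t) • expOp hβ q (potOp (F t)) := by
      rw [smul_sub, sub_smul, ← hF s hs, ← hF t ht]; abel
    rw [e]
    refine (norm_add_le _ _).trans ?_
    rw [norm_smul, norm_smul, Real.norm_of_nonneg hs, Real.norm_eq_abs]
    refine add_le_add (mul_le_mul_of_nonneg_left ((norm_expOp_sub_le hβ q _ _).trans ?_) hs)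
      (mul_le_mul_of_nonneg_left (norm_expOp_le hβ q _) (abs_nonneg _))
    refine mul_le_mul_of_nonneg_left ?_ (by positivity)
    rw [← sqrtPotOp_sqrtPotOp, ← sqrtPotOp_sqrtPotOp, ← map_sub]
    exact (sqrtPotOp.le_opNorm _).trans (mul_le_mul_of_nonneg_left (hv s t hs ht) hT)
  intro t ht
  refine tendsto_iff_norm_sub_tendsto_zero.2 ?_
  have hlim : Tendsto (fun s : ℝ => s * (‖q‖ * (2 * β) * (T * (|s - t| * (N * T)))) + |s - t| * N)
      (𝓝[Set.Ici 0] t) (𝓝 0) := by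
    have hc : Continuous fun s : ℝ =>
        s * (‖q‖ * (2 * β) * (T * (|s - t| * (N * T)))) + |s - t| * N := by fun_prop
    have := hc.tendsto t
    simp only [sub_self, abs_zero, zero_mul, mul_zero, add_zero] at this
    exact this.mono_left nhdsWithin_le_nhds
  refine squeeze_zero' (Eventually.of_forall fun _ => norm_nonneg _) ?_ hlim
  filter_upwards [self_mem_nhdsWithin] with s hs
  exact hF' s t hs ht

/-- The factor s stands for e^c. The mass of the solution is continuous in s, vanishes at s = 0 and
reaches 1, so some s normalises it. -/
theorem exists_eulerLagrange {β : ℝ} (hβ : 0 < β) {V : Torus → ℝ} (hV : Continuous V) :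
    ∃ ρ : Density, EulerLagrange β V ρ := by
  set q : C(Torus, ℝ) := ⟨fun x => Real.exp (-V x), Real.continuous_exp.comp hV.neg⟩ with hqdef
  have hq : ∀ x, 0 < q x := fun x => Real.exp_pos _
  have hfix : ∀ s : ℝ, ∃ f : L2T, 0 ≤ s → f = s • expOp hβ q (potOp f) := by
    intro s
    by_cases hs : 0 ≤ s
    · obtain ⟨f, hf⟩ := exists_fixed_density hβ (fun x => (hq x).le) hs
      exact ⟨f, fun _ => hf⟩
    · exact ⟨0, fun h => absurd h hs⟩
  choose F hF using hfix
  have hcont := continuous_expOp_lipschitz hβ (fun x => (hq x).le) hF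
  have hform : ∀ s, 0 ≤ s → ∃ U : C(Torus, ℝ), (∀ x, 0 ≤ U x) ∧ pot (F s) = U ∧
      potOp (F s) = toL2 U ∧ F s =ᵐ[volume] fun x => s * (q x * Real.exp (-(2 * β * U x))) := by
    intro s hs
    obtain ⟨U, hU1, hU2⟩ := exists_pot_eq (F s)
    have h1 : F s =ᵐ[volume] fun x => s * (q x * (1 + cutExp β (U x))) := by
      have h0 := coeFn_expOp hβ q (potOp (F s))
      have h0' := Lp.coeFn_smul s (expOp hβ q (potOp (F s)))
      rw [← hF s hs] at h0'
      have h0'' := coeFn_toL2 U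
      rw [← hU1] at h0''
      filter_upwards [h0, h0', h0''] with x h2 h3 h4
      rw [h3, Pi.smul_apply, h2, h4, smul_eq_mul]
    -- The kernel and the density are nonnegative, so the potential is nonnegative and the cut-off
    -- in `cutExp` is inactive: the uncut equation is solved.
    have hU : ∀ x, 0 ≤ U x := by
      intro x
      rw [← hU2, pot_congr h1]
      exact integral_nonneg fun y => mul_nonneg (logK_nonneg _)
        (mul_nonneg hs (mul_nonneg (hq y).le (cutExp_add_one_pos _ _).le))
    refine ⟨U, hU, funext hU2, hU1, ?_⟩
    filter_upwards [h1] with x hx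
    rw [hx]
    unfold cutExp
    rw [max_eq_left (hU x)]; ring
  have hmass : ∀ s, inner ℝ (F s) (toL2 1) = ∫ x, F s x := by
    intro s; rw [inner_toL2]; simp
  have hMc : ContinuousOn (fun s => inner ℝ (F s) (toL2 1)) (Set.Ici 0) :=
    hcont.inner continuousOn_const
  obtain ⟨δ, hδ, hδq⟩ : ∃ δ > 0, ∀ x, δ ≤ q x := by
    obtain ⟨x, -, hx⟩ := isCompact_univ.exists_isMinOn (Set.univ_nonempty (α := Torus))
      q.continuous.continuousOn
    exact ⟨q x, hq x, fun y => hx (Set.mem_univ y)⟩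
  -- The tangent line of the exponential at a = 2β log 2 gives exp(-t) ≥ e^{-a}(1 + a - t). The
  -- zeroth multiplier makes the mean of U equal to log 2 times the mass, so for mass at most 1 the
  -- linear terms integrate to at least 2π. The bound is linear in s, hence the mass cannot stay
  -- below 1.
  have hlow : ∀ s, 0 ≤ s → inner ℝ (F s) (toL2 1) ≤ 1 →
      s * (δ * (Real.exp (-(2 * β * Real.log 2)) * (2 * Real.pi))) ≤ inner ℝ (F s) (toL2 1) := by
    intro s hs hle
    obtain ⟨U, hU, -, hU2, hFU⟩ := hform s hs
    rw [hmass] at hle ⊢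
    have hintU : ∫ x, U x = 2 * Real.pi * Real.log 2 * ∫ x, F s x := by
      have h1 := casCoeff_potOp (F s) 0
      rw [hU2, casCoeff_congr (coeFn_toL2 U)] at h1
      unfold casCoeff at h1
      simp only [cas_zero, mul_one, khat, if_true] at h1
      have := casNorm_pos.ne'
      have h2 : casNorm * (∫ x, U x - 0) = casNorm * (2 * Real.pi * Real.log 2 * ∫ x, F s x) := by
        simp only [sub_zero]; linarith
      simpa using mul_left_cancel₀ this h2
    set a := 2 * β * Real.log 2 with ha
    have hpt : ∀ x, s * (δ * (Real.exp (-a) * ((1 + a) - 2 * β * U x)))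
        ≤ s * (q x * Real.exp (-(2 * β * U x))) := by
      intro x
      refine mul_le_mul_of_nonneg_left ?_ hs
      have h1 : Real.exp (-a) * ((1 + a) - 2 * β * U x) ≤ Real.exp (-(2 * β * U x)) := by
        have h2 := Real.add_one_le_exp (a - 2 * β * U x)
        have h3 : Real.exp (-(2 * β * U x)) = Real.exp (-a) * Real.exp (a - 2 * β * U x) := by
          rw [← Real.exp_add]; congr 1; ring
        rw [h3]
        exact mul_le_mul_of_nonneg_left (by linarith) (Real.exp_pos _).le
      exact (mul_le_mul_of_nonneg_left h1 hδ.le).trans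
        (mul_le_mul_of_nonneg_right (hδq x) (Real.exp_pos _).le)
    have hint : ∫ x, s * (δ * (Real.exp (-a) * ((1 + a) - 2 * β * U x))) ≤ ∫ x, F s x := by
      rw [integral_congr_ae hFU]
      exact integral_mono (integrable_continuous (by fun_prop))
        (integrable_continuous (by fun_prop)) hpt
    refine le_trans ?_ hint
    rw [integral_const_mul, integral_const_mul, integral_const_mul,
      integral_sub (integrable_const _) (integrable_continuous (by fun_prop)), integral_const,
      integral_const_mul, hintU, smul_eq_mul, Measure.real, AddCircle.measure_univ,
      ENNReal.toReal_ofReal Real.two_pi_pos.le]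
    refine mul_le_mul_of_nonneg_left (mul_le_mul_of_nonneg_left
      (mul_le_mul_of_nonneg_left ?_ (Real.exp_pos _).le) hδ.le) hs
    have h1 : 2 * β * (2 * Real.pi * Real.log 2 * ∫ x, F s x) ≤ 2 * Real.pi * a := by
      have h2 : 0 ≤ 2 * Real.pi * a := by
        have := Real.log_nonneg (one_le_two : (1 : ℝ) ≤ 2)
        have := Real.pi_pos
        positivity
      have h3 := mul_le_mul_of_nonneg_left hle h2
      calc _ = 2 * Real.pi * a * ∫ x, F s x := by rw [ha]; ring
        _ ≤ _ := by linarith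
    linarith
  set K := δ * (Real.exp (-(2 * β * Real.log 2)) * (2 * Real.pi)) with hK
  have hKpos : 0 < K := by have := Real.pi_pos; positivity
  have hs1 : 0 ≤ 1 / K := by positivity
  have h0 : inner ℝ (F 0) (toL2 1) ≤ 1 := by
    have : F 0 = 0 := by rw [hF 0 le_rfl, zero_smul]
    rw [this, inner_zero_left]; exact zero_le_one
  have h1 : 1 ≤ inner ℝ (F (1 / K)) (toL2 1) := by
    by_contra hlt
    push Not at hlt
    have := hlow _ hs1 hlt.le
    rw [one_div_mul_cancel hKpos.ne'] at this
    linarith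
  obtain ⟨s, hs, hs'⟩ := intermediate_value_Icc hs1
    (hMc.mono Set.Icc_subset_Ici_self) ⟨h0, h1⟩
  obtain ⟨U, hU, hU1, hU2, hFU⟩ := hform s hs.1
  simp only at hs'
  rw [hmass] at hs'
  have hspos : 0 < s := by
    refine lt_of_le_of_ne hs.1 fun h => ?_
    rw [integral_congr_ae hFU, ← h] at hs'
    simp at hs'
  refine ⟨⟨fun x => s * (q x * Real.exp (-(2 * β * U x))), by fun_prop,
    fun x => mul_pos hspos (mul_pos (hq x) (Real.exp_pos _)), ?_⟩, Real.log s, fun x => ?_⟩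
  · rw [← integral_congr_ae hFU]; exact hs'
  · have : pot (fun x => s * (q x * Real.exp (-(2 * β * U x)))) x = U x := by
      rw [← pot_congr hFU, hU1]
    simp only
    rw [this, Real.log_mul hspos.ne' (mul_pos (hq x) (Real.exp_pos _)).ne',
      Real.log_mul (hq x).ne' (Real.exp_pos _).ne', Real.log_exp]
    simp only [hqdef, ContinuousMap.coe_mk, Real.log_exp]
    ring

/-! ### Chain rule for weak derivatives -/

theorem tendsto_casCoeff {f : ℕ → L2T} {f₀ : L2T} (hf : Tendsto f atTop (𝓝 f₀)) (k : ℤ) :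
    Tendsto (fun n => casCoeff (f n) k) atTop (𝓝 (casCoeff f₀ k)) := by
  simp only [← inner_casBasis]
  exact tendsto_const_nhds.inner hf

theorem isWeakDeriv_of_tendsto {f g : ℕ → L2T} {f₀ g₀ : L2T} (h : ∀ n, IsWeakDeriv (f n) (g n))
    (hf : Tendsto f atTop (𝓝 f₀)) (hg : Tendsto g atTop (𝓝 g₀)) : IsWeakDeriv f₀ g₀ :=
  isWeakDeriv_iff.2 fun k => by
    refine tendsto_nhds_unique (tendsto_casCoeff hg k) ?_
    simp only [isWeakDeriv_iff.1 (h _)]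
    exact (tendsto_casCoeff hf (-k)).const_mul _

theorem mulC_add_left (a b : C(Torus, ℝ)) (f : L2T) : mulC (a + b) f = mulC a f + mulC b f := by
  refine Lp.ext ?_
  filter_upwards [coeFn_mulC (a + b) f, coeFn_mulC a f, coeFn_mulC b f,
    Lp.coeFn_add (mulC a f) (mulC b f)] with x h1 h2 h3 h4
  rw [h1, h4, Pi.add_apply, h2, h3, ContinuousMap.add_apply, add_mul]

theorem tendsto_mulC {a : ℕ → C(Torus, ℝ)} {a₀ : C(Torus, ℝ)} {f : ℕ → L2T} {f₀ : L2T}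
    (ha : Tendsto a atTop (𝓝 a₀)) (hf : Tendsto f atTop (𝓝 f₀)) :
    Tendsto (fun n => mulC (a n) (f n)) atTop (𝓝 (mulC a₀ f₀)) := by
  have e : ∀ n, mulC (a n) (f n) = mulC (a n - a₀) (f n) + mulC a₀ (f n) := fun n => by
    rw [← mulC_add_left, sub_add_cancel]
  simp only [e]
  have h1 : Tendsto (fun n => mulC (a n - a₀) (f n)) atTop (𝓝 0) := by
    refine squeeze_zero_norm (fun n => norm_mulC_le _ _) ?_
    have := (tendsto_iff_norm_sub_tendsto_zero.1 ha).mul hf.norm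
    simpa using this
  simpa using h1.add (((mulC a₀).continuous.tendsto f₀).comp hf)

/-- Approximate g in L² by continuous functions, integrate them, and add the constant part of F. The
Sobolev inequality applied to the differences upgrades the convergence of the primitives to uniform
convergence. -/
theorem IsWeakDeriv.exists_hasTDeriv_tendsto {F : C(Torus, ℝ)} {g : L2T}
    (h : IsWeakDeriv (toL2 F) g) : ∃ A B : ℕ → C(Torus, ℝ), (∀ n, HasTDeriv (A n) (B n)) ∧
      Tendsto A atTop (𝓝 F) ∧ Tendsto (fun n => toL2 (B n)) atTop (𝓝 g) := by
  have hd : g ∈ closure (Set.range (toL2 : C(Torus, ℝ) → L2T)) :=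
    ContinuousMap.toLp_denseRange (p := 2) (μ := (volume : Measure Torus)) ℝ ℝ (by norm_num) g
  obtain ⟨s, hs, hst⟩ := mem_closure_iff_seq_limit.1 hd
  choose B' hB' using hs
  -- Removing the mean makes the approximants integrable to periodic functions; the limit is
  -- unaffected since g has mean zero.
  set B : ℕ → C(Torus, ℝ) := fun n => B' n - casCoeff (s n) 0 • (casNorm • cas 0) with hB
  have eB : ∀ n, toL2 (B n) = s n - casCoeff (s n) 0 • casBasis 0 := fun n => by
    rw [hB, map_sub, hB', map_smul, casBasis_apply]
  have hB0 : ∀ n, casCoeff (toL2 (B n)) 0 = 0 := fun n => by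
    rw [eB, casCoeff_sub, casCoeff_smul, casCoeff_casBasis]; simp
  have hBt : Tendsto (fun n => toL2 (B n)) atTop (𝓝 g) := by
    simp only [eB]
    have := hst.sub ((tendsto_casCoeff hst 0).smul_const (casBasis 0))
    rwa [h.casCoeff_zero, zero_smul, sub_zero] at this
  have hr : IsWeakDeriv (toL2 F - antideriv g) 0 := by
    have := h.sub (isWeakDeriv_antideriv h.casCoeff_zero)
    rwa [sub_self] at this
  set f : ℕ → L2T := fun n => antideriv (toL2 (B n)) + (toL2 F - antideriv g) with hf
  have hfd : ∀ n, IsWeakDeriv (f n) (toL2 (B n)) := fun n => by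
    have := (isWeakDeriv_antideriv (hB0 n)).add hr
    rwa [add_zero] at this
  have hft : Tendsto f atTop (𝓝 (toL2 F)) := by
    have := ((antideriv.continuous.tendsto g).comp hBt).add_const (toL2 F - antideriv g)
    rwa [add_sub_cancel] at this
  obtain ⟨C, hC, hS⟩ := IsWeakDeriv.exists_continuous
  choose A hA _ using fun n => hS (hfd n)
  refine ⟨A, B, fun n => IsWeakDeriv.hasTDeriv (hA n ▸ hfd n), ?_, hBt⟩
  refine tendsto_iff_norm_sub_tendsto_zero.2 ?_
  have hb : ∀ n, ‖A n - F‖ ≤ C * (‖f n - toL2 F‖ + ‖toL2 (B n) - g‖) := fun n => by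
    obtain ⟨D, hD, hDn⟩ := hS ((hfd n).sub h)
    have : D = A n - F := toL2_injective (by rw [← hD, hA n, map_sub])
    rwa [this] at hDn
  refine squeeze_zero (fun n => norm_nonneg _) hb ?_
  have := ((tendsto_iff_norm_sub_tendsto_zero.1 hft).add
    (tendsto_iff_norm_sub_tendsto_zero.1 hBt)).const_mul C
  simpa using this

/-- The exponential of a continuous function. -/
def expC (F : C(Torus, ℝ)) : C(Torus, ℝ) := (⟨Real.exp, Real.continuous_exp⟩ : C(ℝ, ℝ)).comp F

theorem expC_apply (F : C(Torus, ℝ)) (x : Torus) : expC F x = Real.exp (F x) := rfl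

theorem HasTDeriv.expC {F G : C(Torus, ℝ)} (h : HasTDeriv F G) :
    HasTDeriv (expC F) (CircleGas.expC F * G) := fun t => (h t).exp

/-- Limit of the classical chain rule: the exponentials converge uniformly and the derivatives in
L², which suffices for the product. -/
theorem IsWeakDeriv.expC {F : C(Torus, ℝ)} {g : L2T} (h : IsWeakDeriv (toL2 F) g) :
    IsWeakDeriv (toL2 (CircleGas.expC F)) (CircleGas.mulC (CircleGas.expC F) g) := by
  obtain ⟨A, B, hAB, hA, hB⟩ := h.exists_hasTDeriv_tendsto
  have he : Tendsto (fun n => CircleGas.expC (A n)) atTop (𝓝 (CircleGas.expC F)) :=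
    ((ContinuousMap.continuous_postcomp _).tendsto F).comp hA
  refine isWeakDeriv_of_tendsto (fun n => (hAB n).expC.isWeakDeriv)
    ((toL2.continuous.tendsto _).comp he) ?_
  simp only [← mulC_toL2]
  exact tendsto_mulC he hB

/-! ### Scales of Sobolev spaces -/

section SobolevScale

variable {ι : Type*}

/-- The weak derivatives of order `i ≤ k` of the functions `f j` are of size `O(w j ^ (s + i))`
in `L²`. -/
def SobBound (w : ι → ℝ) : ℕ → ℕ → (ι → L2T) → Prop
  | s, 0, f => ∃ C : ℝ, ∀ j, ‖f j‖ ≤ C * w j ^ s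
  | s, k + 1, f => (∃ C : ℝ, ∀ j, ‖f j‖ ≤ C * w j ^ s) ∧
      ∃ g : ι → L2T, (∀ j, IsWeakDeriv (f j) (g j)) ∧ SobBound w (s + 1) k g

/-- The derivatives of order `i ≤ k` of the functions `F j` are of size `O(w j ^ (s + i))`
uniformly. -/
def SupBound (w : ι → ℝ) : ℕ → ℕ → (ι → C(Torus, ℝ)) → Prop
  | s, 0, F => ∃ C : ℝ, ∀ j, ‖F j‖ ≤ C * w j ^ s
  | s, k + 1, F => (∃ C : ℝ, ∀ j, ‖F j‖ ≤ C * w j ^ s) ∧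
      ∃ G : ι → C(Torus, ℝ), (∀ j, HasTDeriv (F j) (G j)) ∧ SupBound w (s + 1) k G

variable {w : ι → ℝ}

theorem SobBound.bound {s k : ℕ} {f : ι → L2T} (h : SobBound w s k f) :
    ∃ C : ℝ, ∀ j, ‖f j‖ ≤ C * w j ^ s := by
  cases k with
  | zero => exact h
  | succ k => exact h.1

theorem SobBound.of_succ {k : ℕ} : ∀ {s : ℕ} {f : ι → L2T}, SobBound w s (k + 1) f →
    SobBound w s k f := by
  induction k with
  | zero => exact fun h => h.1
  | succ k ih => exact fun ⟨h, g, hg, hb⟩ => ⟨h, g, hg, ih hb⟩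

theorem exists_bound_succ {E : Type*} [SeminormedAddCommGroup E] (hw : ∀ j, 1 ≤ w j) {s : ℕ}
    {f : ι → E} (h : ∃ C : ℝ, ∀ j, ‖f j‖ ≤ C * w j ^ s) : ∃ C : ℝ, ∀ j, ‖f j‖ ≤ C * w j ^ (s + 1) := by
  obtain ⟨C, hC⟩ := h
  refine ⟨|C|, fun j => (hC j).trans ?_⟩
  exact mul_le_mul (le_abs_self C) (pow_le_pow_right₀ (hw j) (Nat.le_succ s))
    (pow_nonneg (zero_le_one.trans (hw j)) _) (abs_nonneg _)

theorem SobBound.weaken (hw : ∀ j, 1 ≤ w j) {k : ℕ} : ∀ {s : ℕ} {f : ι → L2T}, SobBound w s k f →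
    SobBound w (s + 1) k f := by
  induction k with
  | zero => exact fun h => exists_bound_succ hw h
  | succ k ih => exact fun ⟨h, g, hg, hb⟩ => ⟨exists_bound_succ hw h, g, hg, ih hb⟩

theorem SupBound.weaken (hw : ∀ j, 1 ≤ w j) {k : ℕ} : ∀ {s : ℕ} {f : ι → C(Torus, ℝ)},
    SupBound w s k f → SupBound w (s + 1) k f := by
  induction k with
  | zero => exact fun h => exists_bound_succ hw h
  | succ k ih => exact fun ⟨h, g, hg, hb⟩ => ⟨exists_bound_succ hw h, g, hg, ih hb⟩

theorem exists_bound_add {E : Type*} [SeminormedAddCommGroup E] {s : ℕ} {f g : ι → E}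
    (h : ∃ C : ℝ, ∀ j, ‖f j‖ ≤ C * w j ^ s) (h' : ∃ C : ℝ, ∀ j, ‖g j‖ ≤ C * w j ^ s) :
    ∃ C : ℝ, ∀ j, ‖f j + g j‖ ≤ C * w j ^ s := by
  obtain ⟨C, hC⟩ := h
  obtain ⟨C', hC'⟩ := h'
  exact ⟨C + C', fun j => (norm_add_le _ _).trans (by linarith [hC j, hC' j])⟩

theorem exists_bound_smul {E : Type*} [SeminormedAddCommGroup E] [NormedSpace ℝ E] {s d : ℕ}
    {f : ι → E} {c : ι → ℝ} (hc : ∃ C : ℝ, ∀ j, |c j| ≤ C * w j ^ d)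
    (h : ∃ C : ℝ, ∀ j, ‖f j‖ ≤ C * w j ^ s) :
    ∃ C : ℝ, ∀ j, ‖c j • f j‖ ≤ C * w j ^ (s + d) := by
  obtain ⟨C, hC⟩ := h
  obtain ⟨D, hD⟩ := hc
  refine ⟨D * C, fun j => ?_⟩
  rw [norm_smul, pow_add, Real.norm_eq_abs]
  calc |c j| * ‖f j‖ ≤ (D * w j ^ d) * (C * w j ^ s) :=
        mul_le_mul (hD j) (hC j) (norm_nonneg _) ((abs_nonneg _).trans (hD j))
    _ = _ := by ring

theorem SobBound.add {k : ℕ} : ∀ {s : ℕ} {f g : ι → L2T}, SobBound w s k f → SobBound w s k g →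
    SobBound w s k (fun j => f j + g j) := by
  induction k with
  | zero => exact fun h h' => exists_bound_add h h'
  | succ k ih => exact fun ⟨h, g, hg, hb⟩ ⟨h', g', hg', hb'⟩ =>
      ⟨exists_bound_add h h', _, fun j => (hg j).add (hg' j), ih hb hb'⟩

theorem SupBound.add {k : ℕ} : ∀ {s : ℕ} {f g : ι → C(Torus, ℝ)}, SupBound w s k f →
    SupBound w s k g → SupBound w s k (fun j => f j + g j) := by
  induction k with
  | zero => exact fun h h' => exists_bound_add h h'
  | succ k ih => exact fun ⟨h, g, hg, hb⟩ ⟨h', g', hg', hb'⟩ =>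
      ⟨exists_bound_add h h', _, fun j => (hg j).add (hg' j), ih hb hb'⟩

theorem SobBound.smul {c : ι → ℝ} {d : ℕ} (hc : ∃ C : ℝ, ∀ j, |c j| ≤ C * w j ^ d) {k : ℕ} :
    ∀ {s : ℕ} {f : ι → L2T}, SobBound w s k f → SobBound w (s + d) k (fun j => c j • f j) := by
  induction k with
  | zero => exact fun h => exists_bound_smul hc h
  | succ k ih =>
    intro s f ⟨h, g, hg, hb⟩
    refine ⟨exists_bound_smul hc h, _, fun j => (hg j).smul (c j), ?_⟩
    have := ih hb
    rwa [show s + 1 + d = s + d + 1 by omega] at this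

theorem SobBound.const_smul (c : ℝ) {s k : ℕ} {f : ι → L2T} (h : SobBound w s k f) :
    SobBound w s k (fun j => c • f j) :=
  h.smul (d := 0) (c := fun _ => c) ⟨|c|, fun j => by simp⟩

theorem SobBound.hilb {k : ℕ} : ∀ {s : ℕ} {f : ι → L2T}, SobBound w s k f →
    SobBound w s k (fun j => hilb (f j)) := by
  induction k with
  | zero => exact fun ⟨C, hC⟩ => ⟨C, fun j => (norm_hilb_le _).trans (hC j)⟩
  | succ k ih => exact fun ⟨⟨C, hC⟩, g, hg, hb⟩ =>
      ⟨⟨C, fun j => (norm_hilb_le _).trans (hC j)⟩, _, fun j => (hg j).hilb, ih hb⟩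

theorem TContDiff.exists_hasTDeriv {k : ℕ} {a : C(Torus, ℝ)}
    (h : TContDiff ((k + 1 : ℕ) : ℕ∞) a) : ∃ a' : C(Torus, ℝ), HasTDeriv a a' ∧
      TContDiff (k : ℕ∞) a' := by
  obtain ⟨a', ha'⟩ := (h.of_le (m := 1) (by exact_mod_cast Nat.le_add_left 1 k)).hasTDeriv
  exact ⟨a', ha', ha'.tContDiff_succ.1 h⟩

theorem TContDiff.of_succ {k : ℕ} {a : Torus → ℝ} (h : TContDiff ((k + 1 : ℕ) : ℕ∞) a) :
    TContDiff (k : ℕ∞) a := h.of_le (by exact_mod_cast Nat.le_succ k)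

theorem exists_bound_mul (a : C(Torus, ℝ)) {s : ℕ} {f : ι → L2T}
    (h : ∃ C : ℝ, ∀ j, ‖f j‖ ≤ C * w j ^ s) : ∃ C : ℝ, ∀ j, ‖mulC a (f j)‖ ≤ C * w j ^ s := by
  obtain ⟨C, hC⟩ := h
  refine ⟨‖a‖ * C, fun j => (norm_mulC_le _ _).trans ?_⟩
  rw [mul_assoc]
  exact mul_le_mul_of_nonneg_left (hC j) (norm_nonneg a)

/-- Leibniz's rule. The term a'f carries one power of w less than required, and w ≥ 1 absorbs the
gap. -/
theorem SobBound.mulC (hw : ∀ j, 1 ≤ w j) {k : ℕ} : ∀ {a : C(Torus, ℝ)}, TContDiff (k : ℕ∞) a →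
    ∀ {s : ℕ} {f : ι → L2T}, SobBound w s k f → SobBound w s k (fun j => mulC a (f j)) := by
  induction k with
  | zero => exact fun _ _ _ h => exists_bound_mul _ h
  | succ k ih =>
    intro a ha s f h
    obtain ⟨a', ha', hk⟩ := ha.exists_hasTDeriv
    have h2 := ih hk (h.of_succ.weaken hw)
    obtain ⟨h, g, hg, hb⟩ := h
    exact ⟨exists_bound_mul _ h, _, fun j => (hg j).mulC ha', h2.add (ih ha.of_succ hb)⟩

theorem SupBound.of_succ {k : ℕ} : ∀ {s : ℕ} {f : ι → C(Torus, ℝ)}, SupBound w s (k + 1) f →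
    SupBound w s k f := by
  induction k with
  | zero => exact fun h => h.1
  | succ k ih => exact fun ⟨h, g, hg, hb⟩ => ⟨h, g, hg, ih hb⟩

theorem exists_bound_sup_mul (a : C(Torus, ℝ)) {s : ℕ} {f : ι → C(Torus, ℝ)}
    (h : ∃ C : ℝ, ∀ j, ‖f j‖ ≤ C * w j ^ s) : ∃ C : ℝ, ∀ j, ‖a * f j‖ ≤ C * w j ^ s := by
  obtain ⟨C, hC⟩ := h
  refine ⟨‖a‖ * C, fun j => (norm_mul_le _ _).trans ?_⟩
  rw [mul_assoc]
  exact mul_le_mul_of_nonneg_left (hC j) (norm_nonneg a)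

theorem SupBound.mul (hw : ∀ j, 1 ≤ w j) {k : ℕ} : ∀ {a : C(Torus, ℝ)}, TContDiff (k : ℕ∞) a →
    ∀ {s : ℕ} {f : ι → C(Torus, ℝ)}, SupBound w s k f → SupBound w s k (fun j => a * f j) := by
  induction k with
  | zero => exact fun _ _ _ h => exists_bound_sup_mul _ h
  | succ k ih =>
    intro a ha s f h
    obtain ⟨a', ha', hk⟩ := ha.exists_hasTDeriv
    have h2 := ih hk (h.of_succ.weaken hw)
    obtain ⟨h, g, hg, hb⟩ := h
    exact ⟨exists_bound_sup_mul _ h, _, fun j => ha'.mul (hg j), h2.add (ih ha.of_succ hb)⟩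

theorem sobBound_const (hw : ∀ j, 1 ≤ w j) {k : ℕ} : ∀ {a : C(Torus, ℝ)},
    TContDiff (k : ℕ∞) a → ∀ s, SobBound w s k (fun _ => toL2 a) := by
  have hb : ∀ (a : C(Torus, ℝ)) (s : ℕ), ∃ C : ℝ, ∀ j, ‖toL2 a‖ ≤ C * w j ^ s := fun a s =>
    ⟨‖toL2 a‖, fun j => le_mul_of_one_le_right (norm_nonneg _) (one_le_pow₀ (hw j))⟩
  induction k with
  | zero => exact fun _ s => hb _ s
  | succ k ih =>
    intro a ha s
    obtain ⟨a', ha', hk⟩ := ha.exists_hasTDeriv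
    exact ⟨hb a s, _, fun _ => ha'.isWeakDeriv, ih hk (s + 1)⟩

/-- The bound ‖F‖ ≤ C(‖f‖ + ‖f'‖) costs one derivative and hence one power of w. -/
theorem SobBound.exists_supBound {k : ℕ} : ∀ {s : ℕ} {f : ι → L2T}, (∀ j, 1 ≤ w j) →
    SobBound w s (k + 1) f → ∃ F : ι → C(Torus, ℝ), (∀ j, f j = toL2 (F j)) ∧
      SupBound w (s + 1) k F := by
  obtain ⟨C, hC, hS⟩ := IsWeakDeriv.exists_continuous
  have base : ∀ {s : ℕ} {f g : ι → L2T}, (∀ j, 1 ≤ w j) → (∃ C : ℝ, ∀ j, ‖f j‖ ≤ C * w j ^ s) →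
      (∀ j, IsWeakDeriv (f j) (g j)) → (∃ C : ℝ, ∀ j, ‖g j‖ ≤ C * w j ^ (s + 1)) →
      ∃ F : ι → C(Torus, ℝ), (∀ j, f j = toL2 (F j)) ∧
        ∃ C : ℝ, ∀ j, ‖F j‖ ≤ C * w j ^ (s + 1) := by
    intro s f g hw hf hfg hg
    obtain ⟨D, hD⟩ := exists_bound_succ hw hf
    obtain ⟨D', hD'⟩ := hg
    choose F hF hFn using fun j => hS (hfg j)
    refine ⟨F, hF, C * (D + D'), fun j => (hFn j).trans ?_⟩
    rw [mul_assoc]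
    exact mul_le_mul_of_nonneg_left (by linarith [hD j, hD' j]) hC.le
  induction k with
  | zero => exact fun hw ⟨h, g, hg, hb⟩ => base hw h hg hb
  | succ k ih =>
    intro s f hw ⟨h, g, hg, hb⟩
    obtain ⟨F, hF, hFb⟩ := base hw h hg hb.bound
    obtain ⟨G, hG, hGb⟩ := ih hw hb
    exact ⟨F, hF, hFb, G, fun j => IsWeakDeriv.hasTDeriv (hF j ▸ hG j ▸ hg j), hGb⟩

theorem SupBound.tContDiff {k : ℕ} : ∀ {s : ℕ} {F : ι → C(Torus, ℝ)}, SupBound w s k F →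
    ∀ j, TContDiff (k : ℕ∞) (F j) := by
  induction k with
  | zero => exact fun _ j => by exact_mod_cast tContDiff_zero.2 (map_continuous _)
  | succ k ih => exact fun ⟨_, G, hG, hb⟩ j => (hG j).tContDiff_succ.2 (ih hb j)

end SobolevScale

/-! ### Regularity of the equilibrium density -/

theorem TContDiff.mul {n : ℕ∞} {a b : Torus → ℝ} (ha : TContDiff n a) (hb : TContDiff n b) :
    TContDiff n (fun x => a x * b x) := ContDiff.mul ha hb

theorem TContDiff.add {n : ℕ∞} {a b : Torus → ℝ} (ha : TContDiff n a) (hb : TContDiff n b) :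
    TContDiff n (fun x => a x + b x) := ContDiff.add ha hb

theorem TContDiff.const_mul {n : ℕ∞} {a : Torus → ℝ} (c : ℝ) (ha : TContDiff n a) :
    TContDiff n (fun x => c * a x) := ContDiff.mul contDiff_const ha

/-- Chain rule for ρ = exp(c - V - 2βU), together with U' = πHρ. -/
theorem EulerLagrange.isWeakDeriv {β : ℝ} {V V' : C(Torus, ℝ)} {ρ : Density}
    (hV : HasTDeriv V V') (h : EulerLagrange β V ρ) :
    IsWeakDeriv (toL2 ρ.cmap)
      ((-1 : ℝ) • (mulC ρ.cmap (toL2 V')) + (-(2 * β * Real.pi)) • mulC ρ.cmap (hilb (toL2 ρ.cmap))) := by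
  obtain ⟨c, hc⟩ := h
  obtain ⟨U, hU, hpU⟩ := ρ.exists_pot_eq
  set W : C(Torus, ℝ) := ContinuousMap.const Torus c + (-1 : ℝ) • V + (-(2 * β)) • U with hW
  have hWρ : expC W = ρ.cmap := ContinuousMap.ext fun x => by
    rw [expC_apply, Density.cmap_apply, ← Real.exp_log (ρ.pos x), hc x, hpU, hW]
    congr 1
    simp only [ContinuousMap.add_apply, ContinuousMap.smul_apply, ContinuousMap.const_apply,
      smul_eq_mul]
    ring
  have hWd : IsWeakDeriv (toL2 W)
      (0 + (-1 : ℝ) • toL2 V' + (-(2 * β)) • (Real.pi • hilb (toL2 ρ.cmap))) := by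
    rw [hW, map_add, map_add, map_smul, map_smul]
    exact ((isWeakDeriv_const c).add (hV.isWeakDeriv.smul _)).add
      ((hU ▸ isWeakDeriv_potOp _).smul _)
  have := hWd.expC
  rw [hWρ] at this
  convert this using 1
  rw [zero_add, map_add, map_smul, map_smul, map_smul, smul_smul, neg_mul]

/-- Bootstrap. If ρ is C^k, the equation places ρ, hence also Hρ, in H^{k+1}, so Hρ is C^k and the
right-hand side for ρ' is C^k. The detour through Sobolev spaces is needed because H does not
preserve C^k. -/
theorem EulerLagrange.tContDiff {β : ℝ} {m : ℕ} {V : Torus → ℝ} (hV : TContDiff (m : ℕ∞) V)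
    {ρ : Density} (h : EulerLagrange β V ρ) : TContDiff (m : ℕ∞) ρ.toFun := by
  suffices H : ∀ k ≤ m, TContDiff (k : ℕ∞) ρ.cmap from H m le_rfl
  intro k
  induction k with
  | zero => exact fun _ => by exact_mod_cast tContDiff_zero.2 (map_continuous _)
  | succ k ih =>
    intro hk
    have hρ := ih (by omega)
    obtain ⟨V', hV', hk'⟩ := TContDiff.exists_hasTDeriv (k := k) (a := ⟨V, hV.continuous⟩)
      (hV.of_le (by exact_mod_cast hk))
    have hd := EulerLagrange.isWeakDeriv (V := ⟨V, hV.continuous⟩) hV' h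
    -- A one-element family with weight 1: the scales then express regularity alone.
    have hw : ∀ j : Unit, (1 : ℝ) ≤ (fun _ => 1) j := fun _ => le_rfl
    have b0 := sobBound_const hw hρ 0
    have b1 := ((sobBound_const hw hk' 0).mulC hw hρ).const_smul (-1)
    have b2 := (b0.hilb.mulC hw hρ).const_smul (-(2 * β * Real.pi))
    have b3 : SobBound (fun _ : Unit => (1 : ℝ)) 0 (k + 1) (fun _ => toL2 ρ.cmap) :=
      ⟨b0.bound, _, fun _ => hd, (b1.add b2).weaken hw⟩
    obtain ⟨F, hF, hFb⟩ := b3.hilb.exists_supBound hw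
    have e : (-1 : ℝ) • (mulC ρ.cmap (toL2 V'))
        + (-(2 * β * Real.pi)) • mulC ρ.cmap (hilb (toL2 ρ.cmap))
        = toL2 ((-1 : ℝ) • (ρ.cmap * V') + (-(2 * β * Real.pi)) • (ρ.cmap * F ())) := by
      rw [hF (), mulC_toL2, mulC_toL2, ← map_smul, ← map_smul, ← map_add]
    rw [e] at hd
    refine hd.hasTDeriv.tContDiff_succ.2 ?_
    exact ((hρ.mul hk').const_mul _).add ((hρ.mul (hFb.tContDiff ())).const_mul _)

/-! ### Compactness of the antiderivative -/

/-- The truncations to |n| ≤ N have finite rank, and the remaining multiplier is at most 1/(N + 1).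
-/
theorem isCompactOperator_antideriv : IsCompactOperator antideriv := by
  let T : ℕ → L2T →L[ℝ] L2T := fun N => ∑ n ∈ Finset.Icc (-(N : ℤ)) N,
    (((n : ℝ)⁻¹) • innerSL ℝ (casBasis (-n))).smulRight (casBasis n)
  have hT : ∀ N f, T N f = ∑ n ∈ Finset.Icc (-(N : ℤ)) N,
      ((n : ℝ)⁻¹ * casCoeff f (-n)) • casBasis n := fun N f => by
    simp only [T, _root_.sum_apply, ContinuousLinearMap.smulRight_apply,
      _root_.smul_apply, innerSL_apply_apply, inner_casBasis, smul_eq_mul]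
  have hcT : ∀ N f k, casCoeff (T N f) k
      = if k ∈ Finset.Icc (-(N : ℤ)) N then (k : ℝ)⁻¹ * casCoeff f (-k) else 0 := fun N f k => by
    rw [hT, ← inner_casBasis, inner_sum, ← Finset.sum_ite_eq (Finset.Icc (-(N : ℤ)) N) k
      (fun n => (n : ℝ)⁻¹ * casCoeff f (-n))]
    refine Finset.sum_congr rfl fun n _ => ?_
    rw [inner_smul_right, orthonormal_iff_ite.1 casBasis.orthonormal]
    split_ifs <;> simp
  have hb : ∀ N, ‖T N - antideriv‖ ≤ 1 / ((N : ℝ) + 1) := fun N => by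
    refine ContinuousLinearMap.opNorm_le_bound _ (by positivity) fun f => ?_
    refine abs_le_of_sq_le_sq' ?_ (by positivity) |>.2
    rw [mul_pow]
    have h1 := hasSum_casCoeff_sq ((T N - antideriv) f)
    have h2 := ((Equiv.neg ℤ).hasSum_iff.2 (hasSum_casCoeff_sq f)).mul_left
      ((1 / ((N : ℝ) + 1)) ^ 2)
    refine hasSum_le (fun k => ?_) h1 h2
    rw [_root_.sub_apply, casCoeff_sub, hcT, casCoeff_antideriv]
    simp only [Function.comp_apply, Equiv.neg_apply]
    split_ifs with hk
    · rw [sub_self, zero_pow two_ne_zero]; positivity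
    · rw [zero_sub, neg_sq, mul_pow]
      refine mul_le_mul_of_nonneg_right ?_ (sq_nonneg _)
      have : (N : ℝ) + 1 ≤ |(k : ℝ)| := by
        have : (N : ℤ) + 1 ≤ |k| := by
          by_contra hc
          exact hk (Finset.mem_Icc.2 (abs_le.1 (by omega)))
        exact_mod_cast this
      rw [← sq_abs, abs_inv, one_div]
      gcongr
  refine isCompactOperator_of_tendsto (l := atTop) (F := T) ?_ (Eventually.of_forall fun N => ?_)
  · refine tendsto_iff_norm_sub_tendsto_zero.2 (squeeze_zero (fun _ => norm_nonneg _) hb ?_)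
    exact tendsto_one_div_add_atTop_nhds_zero_nat
  · refine Submodule.sum_mem (compactOperator (RingHom.id ℝ) L2T L2T) fun n _ => ?_
    change IsCompactOperator fun f => ((n : ℝ)⁻¹ • innerSL ℝ (casBasis (-n))) f • casBasis n
    have h : IsCompactOperator ((n : ℝ)⁻¹ • innerSL ℝ (casBasis (-n))) :=
      isCompactOperator_of_locallyCompactSpace_dom _
    exact h.clm_comp (ContinuousLinearMap.toSpanSingleton ℝ (casBasis n))

/-! ### The square root of the density -/

/-- The square root of a density. -/
def Density.sqrt (ρ : Density) : C(Torus, ℝ) :=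
  ⟨fun x => Real.sqrt (ρ.toFun x), ρ.continuous_toFun.sqrt⟩

/-- The inverse square root of a density. -/
def Density.invSqrt (ρ : Density) : C(Torus, ℝ) :=
  ⟨fun x => (Real.sqrt (ρ.toFun x))⁻¹,
    ρ.continuous_toFun.sqrt.inv₀ fun x => (Real.sqrt_pos.2 (ρ.pos x)).ne'⟩

theorem Density.sqrt_apply (ρ : Density) (x : Torus) : ρ.sqrt x = Real.sqrt (ρ.toFun x) := rfl

theorem Density.invSqrt_apply (ρ : Density) (x : Torus) :
    ρ.invSqrt x = (Real.sqrt (ρ.toFun x))⁻¹ := rfl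

theorem Density.sqrt_pos (ρ : Density) (x : Torus) : 0 < ρ.sqrt x := Real.sqrt_pos.2 (ρ.pos x)

theorem Density.sqrt_mul_sqrt (ρ : Density) : ρ.sqrt * ρ.sqrt = ρ.cmap :=
  ContinuousMap.ext fun x => Real.mul_self_sqrt (ρ.pos x).le

theorem Density.sqrt_mul_invSqrt (ρ : Density) : ρ.sqrt * ρ.invSqrt = 1 :=
  ContinuousMap.ext fun x => mul_inv_cancel₀ (ρ.sqrt_pos x).ne'

theorem Density.invSqrt_mul_sqrt (ρ : Density) : ρ.invSqrt * ρ.sqrt = 1 :=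
  ContinuousMap.ext fun x => inv_mul_cancel₀ (ρ.sqrt_pos x).ne'

theorem inner_toL2_toL2 (F G : C(Torus, ℝ)) : inner ℝ (toL2 F) (toL2 G) = ∫ x, F x * G x := by
  rw [inner_toL2]
  refine integral_congr_ae ?_
  filter_upwards [coeFn_toL2 F] with x hx
  rw [hx]

theorem Density.inner_cmap_one (ρ : Density) : inner ℝ (toL2 ρ.cmap) (toL2 1) = 1 := by
  rw [inner_toL2_toL2, ← ρ.integral_eq_one]
  simp [Density.cmap_apply]

theorem Density.inner_sqrt_sqrt (ρ : Density) : inner ℝ (toL2 ρ.sqrt) (toL2 ρ.sqrt) = 1 := by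
  rw [inner_toL2_toL2, ← ρ.integral_eq_one]
  congr 1; funext x
  exact Real.mul_self_sqrt (ρ.pos x).le

/-! ### The energy space as a Hilbert space -/

namespace EnergySpace

variable {ρ : Density}

theorem inner_eq (u v : EnergySpace ρ) :
    inner ℝ u v = inner ℝ (mulC ρ.sqrt u.wderiv) (mulC ρ.sqrt v.wderiv) := by
  rw [inner_mulC_left, ← mulC_mul, ρ.sqrt_mul_sqrt, l2_inner]
  change ∫ x, u.wderiv x * v.wderiv x * ρ.toFun x = _
  refine integral_congr_ae ?_
  filter_upwards [coeFn_mulC ρ.cmap v.wderiv] with x hx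
  rw [hx, Density.cmap_apply]; ring

theorem inner_cmap_val (u : EnergySpace ρ) : inner ℝ (toL2 ρ.cmap) u.val = 0 := by
  rw [real_inner_comm, inner_toL2]
  exact u.integral_mul_eq_zero

/-- The element of the energy space with a given weak derivative. -/
def mk {f g : L2T} (h : IsWeakDeriv f g) (h0 : inner ℝ (toL2 ρ.cmap) f = 0) : EnergySpace ρ :=
  ⟨(f, g), h, by rw [real_inner_comm, inner_toL2] at h0; exact h0⟩

theorem val_mk {f g : L2T} (h : IsWeakDeriv f g) (h0 : inner ℝ (toL2 ρ.cmap) f = 0) :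
    (mk h h0).val = f := rfl

theorem wderiv_mk {f g : L2T} (h : IsWeakDeriv f g) (h0 : inner ℝ (toL2 ρ.cmap) f = 0) :
    (mk h h0).wderiv = g := rfl

/-- The centering `f - ∫ f ρ`. -/
def _root_.CircleGas.Density.center (ρ : Density) : L2T →L[ℝ] L2T :=
  ContinuousLinearMap.id ℝ L2T - (innerSL ℝ (toL2 ρ.cmap)).smulRight (toL2 1)

theorem _root_.CircleGas.Density.center_apply (f : L2T) :
    ρ.center f = f - inner ℝ (toL2 ρ.cmap) f • toL2 1 := rfl

theorem inner_cmap_center (f : L2T) : inner ℝ (toL2 ρ.cmap) (ρ.center f) = 0 := by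
  rw [ρ.center_apply, inner_sub_right, inner_smul_right, ρ.inner_cmap_one, mul_one, sub_self]

theorem _root_.CircleGas.IsWeakDeriv.center {f g : L2T} (h : IsWeakDeriv f g) :
    IsWeakDeriv (ρ.center f) g := by
  have := h.sub ((isWeakDeriv_const 1).smul (inner ℝ (toL2 ρ.cmap) f))
  rwa [smul_zero, sub_zero] at this

theorem val_eq_of_isWeakDeriv {f : L2T} (u : EnergySpace ρ) (h : IsWeakDeriv f u.wderiv) :
    u.val = ρ.center f := by
  have h1 := h.sub u.isWeakDeriv
  rw [sub_self] at h1
  obtain ⟨c, hc⟩ := ae_const_of_weakDeriv_zero h1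
  have h2 : f - u.val = c • toL2 1 := by
    rw [← map_smul]
    refine Lp.ext ?_
    filter_upwards [hc, coeFn_toL2 (c • 1)] with x h1 h2
    rw [h1, h2]; simp
  have h3 : c = inner ℝ (toL2 ρ.cmap) f := by
    have := congrArg (inner ℝ (toL2 ρ.cmap)) h2
    rw [inner_sub_right, u.inner_cmap_val, inner_smul_right, ρ.inner_cmap_one] at this
    linarith
  rw [ρ.center_apply, ← h3, ← h2, sub_sub_cancel]

theorem val_eq (u : EnergySpace ρ) : u.val = ρ.center (antideriv u.wderiv) :=
  u.val_eq_of_isWeakDeriv (isWeakDeriv_antideriv u.isWeakDeriv.casCoeff_zero)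

theorem ext_wderiv {u v : EnergySpace ρ} (h : u.wderiv = v.wderiv) : u = v :=
  Subtype.ext (Prod.ext (by
    change u.val = v.val
    rw [u.val_eq, v.val_eq, h]) h)

/-- The isometric embedding `u ↦ √ρ u'` of the energy space into `L²`. -/
def toL2Isometry (ρ : Density) : EnergySpace ρ →ₗᵢ[ℝ] L2T :=
  LinearMap.isometryOfInner
    { toFun := fun u => mulC ρ.sqrt u.wderiv
      map_add' := fun u v => by rw [wderiv_add, map_add]
      map_smul' := fun c u => by rw [wderiv_smul, map_smul]; rfl }
    fun u v => (inner_eq u v).symm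

theorem toL2Isometry_apply (u : EnergySpace ρ) : toL2Isometry ρ u = mulC ρ.sqrt u.wderiv := rfl

theorem wderiv_eq (u : EnergySpace ρ) : u.wderiv = mulC ρ.invSqrt (toL2Isometry ρ u) := by
  rw [toL2Isometry_apply, ← mulC_mul, ρ.invSqrt_mul_sqrt, mulC_one]

theorem casCoeff_zero_eq (f : L2T) : casCoeff f 0 = casNorm * inner ℝ (toL2 1) f := by
  rw [casCoeff, real_inner_comm, inner_toL2]
  simp [cas_zero]

theorem inner_invSqrt_eq (h : L2T) :
    casNorm * inner ℝ (toL2 ρ.invSqrt) h = casCoeff (mulC ρ.invSqrt h) 0 := by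
  rw [casCoeff_zero_eq, ← inner_mulC_left, mulC_toL2, mul_one]

/-- The function h/√ρ is a derivative on the circle exactly when its mean vanishes, that is, when h
is orthogonal to ρ^{-1/2}. The range of the isometry is therefore a hyperplane. -/
theorem exists_toL2Isometry_eq {h : L2T} (h0 : inner ℝ (toL2 ρ.invSqrt) h = 0) :
    ∃ u : EnergySpace ρ, toL2Isometry ρ u = h := by
  refine ⟨mk (isWeakDeriv_antideriv (g := mulC ρ.invSqrt h) ?_).center (inner_cmap_center _), ?_⟩
  · rw [← inner_invSqrt_eq, h0, mul_zero]
  · rw [toL2Isometry_apply, wderiv_mk, ← mulC_mul, ρ.sqrt_mul_invSqrt, mulC_one]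

theorem inner_invSqrt_toL2Isometry (u : EnergySpace ρ) :
    inner ℝ (toL2 ρ.invSqrt) (toL2Isometry ρ u) = 0 := by
  have := inner_invSqrt_eq (ρ := ρ) (toL2Isometry ρ u)
  rw [← wderiv_eq, u.isWeakDeriv.casCoeff_zero] at this
  exact (mul_eq_zero.1 this).resolve_left casNorm_pos.ne'

/-- The space is isometric to a closed hyperplane of L². -/
instance : CompleteSpace (EnergySpace ρ) := by
  rw [completeSpace_iff_isComplete_range (toL2Isometry ρ).isometry.isUniformInducing]
  have : Set.range (toL2Isometry ρ) = {h : L2T | inner ℝ (toL2 ρ.invSqrt) h = 0} :=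
    Set.ext fun h => ⟨fun ⟨u, hu⟩ => hu ▸ inner_invSqrt_toL2Isometry u,
      fun h0 => exists_toL2Isometry_eq h0⟩
  rw [this]
  exact (isClosed_eq (by fun_prop) continuous_const).isComplete

/-- The map `u ↦ √ρ u` from the energy space to `L²`. -/
def embed (ρ : Density) : EnergySpace ρ →L[ℝ] L2T :=
  mulC ρ.sqrt ∘L ρ.center ∘L antideriv ∘L mulC ρ.invSqrt ∘L
    (toL2Isometry ρ).toContinuousLinearMap

theorem embed_apply (u : EnergySpace ρ) : embed ρ u = mulC ρ.sqrt u.val := by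
  rw [val_eq, wderiv_eq]; rfl

theorem isCompactOperator_embed : IsCompactOperator (embed ρ) :=
  (isCompactOperator_antideriv.comp_clm
    (mulC ρ.invSqrt ∘L (toL2Isometry ρ).toContinuousLinearMap)).clm_comp (mulC ρ.sqrt ∘L ρ.center)

theorem inner_sqrt_embed (u : EnergySpace ρ) : inner ℝ (toL2 ρ.sqrt) (embed ρ u) = 0 := by
  rw [embed_apply, ← inner_mulC_left, mulC_toL2, ρ.sqrt_mul_sqrt, u.inner_cmap_val]

theorem val_eq_embed (u : EnergySpace ρ) : u.val = mulC ρ.invSqrt (embed ρ u) := by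
  rw [embed_apply, ← mulC_mul, ρ.invSqrt_mul_sqrt, mulC_one]

theorem embed_injective : Function.Injective (embed ρ) := fun u v h => by
  have hv : u.val = v.val := by rw [val_eq_embed, val_eq_embed, h]
  exact ext_wderiv (u.isWeakDeriv.unique (hv ▸ v.isWeakDeriv))

/-- The adjoint of `u ↦ √ρ u`. It solves `-(ρ u')' = √ρ a`. -/
def solve (ρ : Density) : L2T →L[ℝ] EnergySpace ρ := ContinuousLinearMap.adjoint (embed ρ)

theorem inner_solve_left (a : L2T) (u : EnergySpace ρ) :
    inner ℝ (solve ρ a) u = inner ℝ a (embed ρ u) := ContinuousLinearMap.adjoint_inner_left _ _ _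

/-- The flux `ρ u'`. -/
def flux (ρ : Density) : EnergySpace ρ →L[ℝ] L2T :=
  mulC ρ.sqrt ∘L (toL2Isometry ρ).toContinuousLinearMap

theorem flux_eq (u : EnergySpace ρ) : flux ρ u = mulC ρ.sqrt (toL2Isometry ρ u) := rfl

theorem flux_eq' (u : EnergySpace ρ) : flux ρ u = mulC ρ.cmap u.wderiv := by
  rw [flux_eq, toL2Isometry_apply, ← mulC_mul, ρ.sqrt_mul_sqrt]

theorem inner_eq_flux (u v : EnergySpace ρ) : inner ℝ u v = inner ℝ (flux ρ u) v.wderiv := by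
  rw [inner_eq, flux_eq', ← ρ.sqrt_mul_sqrt, mulC_mul, inner_mulC_left ρ.sqrt (mulC _ _)]

/-- The orthogonal projection onto the complement of `√ρ`. -/
def _root_.CircleGas.Density.proj (ρ : Density) : L2T →L[ℝ] L2T :=
  ContinuousLinearMap.id ℝ L2T - (innerSL ℝ (toL2 ρ.sqrt)).smulRight (toL2 ρ.sqrt)

theorem _root_.CircleGas.Density.proj_apply (f : L2T) :
    ρ.proj f = f - inner ℝ (toL2 ρ.sqrt) f • toL2 ρ.sqrt := rfl

theorem proj_eq_self {f : L2T} (h : inner ℝ (toL2 ρ.sqrt) f = 0) : ρ.proj f = f := by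
  rw [ρ.proj_apply, h, zero_smul, sub_zero]

theorem inner_sqrt_proj (f : L2T) : inner ℝ (toL2 ρ.sqrt) (ρ.proj f) = 0 := by
  rw [ρ.proj_apply, inner_sub_right, inner_smul_right, ρ.inner_sqrt_sqrt, mul_one, sub_self]

theorem inner_proj_left (f g : L2T) : inner ℝ (ρ.proj f) g = inner ℝ f (ρ.proj g) := by
  rw [ρ.proj_apply, ρ.proj_apply, inner_sub_left, inner_sub_right, inner_smul_left,
    inner_smul_right, real_inner_comm f]
  simp [mul_comm]

theorem norm_proj_le (f : L2T) : ‖ρ.proj f‖ ≤ ‖f‖ := by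
  have h1 : inner ℝ (ρ.proj f) (ρ.proj f) = inner ℝ f (ρ.proj f) := by
    rw [inner_proj_left, proj_eq_self (inner_sqrt_proj f)]
  have h2 := real_inner_le_norm f (ρ.proj f)
  rw [← h1, real_inner_self_eq_norm_mul_norm] at h2
  by_contra hc
  push Not at hc
  nlinarith [norm_nonneg f]

/-- Test the adjoint relation on the centred functions `cas n`. Centering on the side of u becomes,
after multiplication by √ρ, the projection off √ρ on the side of a. -/
theorem isWeakDeriv_flux_solve (a : L2T) :
    IsWeakDeriv (flux ρ (solve ρ a)) (-mulC ρ.sqrt (ρ.proj a)) := isWeakDeriv_iff.2 fun n => by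
  have h1 := inner_solve_left a
    (mk (ρ := ρ) (hasTDeriv_cas n).isWeakDeriv.center (inner_cmap_center _))
  rw [inner_eq_flux, embed_apply, wderiv_mk, val_mk, map_smul, inner_smul_right, ρ.center_apply,
    map_sub, map_smul, mulC_toL2, mulC_toL2, mul_one, inner_sub_right, inner_smul_right] at h1
  have e : ∀ f : L2T, ∀ k, casCoeff f k = casNorm * inner ℝ f (toL2 (cas k)) := fun f k => by
    rw [inner_toL2]; rfl
  rw [e, e, inner_neg_left, inner_mulC_left, inner_proj_left, mulC_toL2, ρ.proj_apply,
    inner_sub_right, inner_smul_right]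
  have h2 : inner ℝ (toL2 ρ.sqrt) (toL2 (ρ.sqrt * cas n)) = inner ℝ (toL2 ρ.cmap) (toL2 (cas n)) := by
    rw [← mulC_toL2, ← inner_mulC_left, mulC_toL2, ρ.sqrt_mul_sqrt]
  rw [h2, ← h1]
  ring

theorem solve_eq_of_isWeakDeriv {u : EnergySpace ρ} {a : L2T}
    (h : IsWeakDeriv (flux ρ u) (-mulC ρ.sqrt a)) : u = solve ρ a := by
  refine ext_inner_right ℝ fun v => ?_
  rw [inner_solve_left, inner_eq_flux, embed_apply, ← inner_mulC_left, ← neg_neg (mulC ρ.sqrt a),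
    inner_neg_left, h.inner_eq v.isWeakDeriv, neg_neg]

theorem inner_sqrt_eq_zero_of_isWeakDeriv {u : EnergySpace ρ} {a : L2T}
    (h : IsWeakDeriv (flux ρ u) (-mulC ρ.sqrt a)) : inner ℝ (toL2 ρ.sqrt) a = 0 := by
  have := h.casCoeff_zero
  rw [casCoeff_zero_eq, inner_neg_right, ← inner_mulC_left, mulC_toL2, mul_one] at this
  simpa [casNorm_pos.ne'] using this

/-! ### The inverse operator -/

/-- The nonlocal part `-2πc √ρ H(ρ u')`, as an operator of `a = -(ρ u')' / √ρ`. -/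
def perturb (ρ : Density) (c : ℝ) : L2T →L[ℝ] L2T :=
  -((2 * Real.pi * c) • (ρ.proj ∘L mulC ρ.sqrt ∘L hilb ∘L flux ρ ∘L solve ρ))

theorem perturb_apply (c : ℝ) (a : L2T) : perturb ρ c a
    = -((2 * Real.pi * c) • ρ.proj (mulC ρ.sqrt (hilb (flux ρ (solve ρ a))))) := rfl

/-- Moving the projection and √ρ to the other side produces the derivative of the flux of b, and
⟨Hg, k'⟩ = ∑ |n| g(n)k(n). The nonlocal part is thus the H^{1/2} form of the flux, whence its
symmetry and positivity. -/
theorem hasSum_inner_perturb (c : ℝ) (a b : L2T) :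
    HasSum (fun n : ℤ => 2 * Real.pi * c * (|(n : ℝ)| * (casCoeff (flux ρ (solve ρ a)) n
      * casCoeff (flux ρ (solve ρ b)) n))) (inner ℝ (perturb ρ c a) b) := by
  rw [perturb_apply, inner_neg_left, inner_smul_left, inner_proj_left, inner_mulC_left,
    ← mul_neg, ← inner_neg_right]
  refine HasSum.mul_left _ ?_
  have h := hasSum_casCoeff_mul (hilb (flux ρ (solve ρ a))) (-mulC ρ.sqrt (ρ.proj b))
  refine (((Equiv.neg ℤ).hasSum_iff).2 h).congr_fun fun n => ?_
  simp only [Function.comp_apply, Equiv.neg_apply]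
  rw [casCoeff_hilb, isWeakDeriv_iff.1 (isWeakDeriv_flux_solve b), neg_neg, Int.sign_neg]
  have : |(n : ℝ)| = (n.sign : ℝ) * n := by
    have := Int.sign_mul_self_eq_abs n
    rw [← Int.cast_abs, ← this]; push_cast; ring
  rw [this]; push_cast; ring

theorem inner_perturb_left (c : ℝ) (a b : L2T) :
    inner ℝ (perturb ρ c a) b = inner ℝ a (perturb ρ c b) := by
  rw [real_inner_comm (perturb ρ c b) a]
  refine (hasSum_inner_perturb c a b).unique ((hasSum_inner_perturb c b a).congr_fun fun n => ?_)
  ring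

theorem inner_perturb_nonneg {c : ℝ} (hc : 0 ≤ c) (a : L2T) : 0 ≤ inner ℝ (perturb ρ c a) a := by
  refine (hasSum_inner_perturb c a a).nonneg fun n => ?_
  have := Real.pi_pos
  have := mul_self_nonneg (casCoeff (flux ρ (solve ρ a)) n)
  positivity

/-- The operator whose quadratic form is that of `L`. -/
def form (ρ : Density) (c : ℝ) : L2T →L[ℝ] L2T := 1 + perturb ρ c

theorem form_apply (c : ℝ) (a : L2T) : form ρ c a = a + perturb ρ c a := rfl

theorem inner_form_left (c : ℝ) (a b : L2T) :
    inner ℝ (form ρ c a) b = inner ℝ a (form ρ c b) := by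
  rw [form_apply, form_apply, inner_add_left, inner_add_right, inner_perturb_left]

theorem norm_sq_le_inner_form {c : ℝ} (hc : 0 ≤ c) (a : L2T) :
    ‖a‖ ^ 2 ≤ inner ℝ (form ρ c a) a := by
  rw [form_apply, inner_add_left, real_inner_self_eq_norm_sq]
  linarith [inner_perturb_nonneg (ρ := ρ) hc a]

/-- Lax–Milgram: the form is bounded below by the identity. -/
theorem isUnit_form {c : ℝ} (hc : 0 ≤ c) : IsUnit (form ρ c) :=
  ContinuousLinearMap.isUnit_of_forall_le_norm_inner_map _ (c := 1) one_pos fun a => by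
    rw [NNReal.coe_one, mul_one]
    exact (norm_sq_le_inner_form hc a).trans (le_abs_self _)

/-- The inverse of `form`. -/
def formInv (ρ : Density) (c : ℝ) : L2T →L[ℝ] L2T := Ring.inverse (form ρ c)

theorem form_formInv {c : ℝ} (hc : 0 ≤ c) (a : L2T) : form ρ c (formInv ρ c a) = a := by
  have h : form ρ c * formInv ρ c = 1 := Ring.mul_inverse_cancel _ (isUnit_form hc)
  rw [← mul_apply_eq_comp, h, one_apply_eq_self]

theorem formInv_form {c : ℝ} (hc : 0 ≤ c) (a : L2T) : formInv ρ c (form ρ c a) = a := by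
  have h : formInv ρ c * form ρ c = 1 := Ring.inverse_mul_cancel _ (isUnit_form hc)
  rw [← mul_apply_eq_comp, h, one_apply_eq_self]

theorem inner_formInv_left {c : ℝ} (hc : 0 ≤ c) (a b : L2T) :
    inner ℝ (formInv ρ c a) b = inner ℝ a (formInv ρ c b) := by
  rw [← form_formInv hc b, formInv_form hc, ← inner_form_left, form_formInv hc]

/-- The inverse operator. -/
def green (ρ : Density) (c : ℝ) : EnergySpace ρ →L[ℝ] EnergySpace ρ :=
  solve ρ ∘L formInv ρ c ∘L embed ρ

theorem green_apply (c : ℝ) (f : EnergySpace ρ) :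
    green ρ c f = solve ρ (formInv ρ c (embed ρ f)) := rfl

theorem isCompactOperator_green (c : ℝ) : IsCompactOperator (green ρ c) :=
  isCompactOperator_embed.clm_comp (solve ρ ∘L formInv ρ c)

/-- The operator is E*(1 + P)⁻¹E with E = `embed`. It is symmetric for the energy inner product
although the expression L is not symmetric in L²(μ). -/
theorem inner_green_left {c : ℝ} (hc : 0 ≤ c) (f g : EnergySpace ρ) :
    inner ℝ (green ρ c f) g = inner ℝ f (green ρ c g) := by
  rw [green_apply, inner_solve_left, inner_formInv_left hc, real_inner_comm, ← inner_solve_left,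
    ← green_apply, real_inner_comm]

theorem inner_green_self (c : ℝ) (f : EnergySpace ρ) :
    inner ℝ (green ρ c f) f = inner ℝ (formInv ρ c (embed ρ f)) (embed ρ f) := by
  rw [green_apply, inner_solve_left]

/-- With b = (1 + P)⁻¹Ef, the norm of Ef is at most ‖1 + P‖‖b‖, and ‖b‖² ≤ ⟨(1 + P)b, b⟩. It gives
strict positivity here, and later the L² size of the eigenfunctions. -/
theorem norm_embed_sq_le {c : ℝ} (hc : 0 ≤ c) (f : EnergySpace ρ) :
    ‖embed ρ f‖ ^ 2 ≤ ‖form ρ c‖ ^ 2 * inner ℝ (green ρ c f) f := by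
  rw [inner_green_self]
  set b := formInv ρ c (embed ρ f) with hb
  have h1 : embed ρ f = form ρ c b := (form_formInv hc _).symm
  have h2 := norm_sq_le_inner_form (ρ := ρ) hc b
  have h3 := (form ρ c).le_opNorm b
  rw [h1, real_inner_comm]
  calc ‖form ρ c b‖ ^ 2 ≤ (‖form ρ c‖ * ‖b‖) ^ 2 := by gcongr
    _ = ‖form ρ c‖ ^ 2 * ‖b‖ ^ 2 := by ring
    _ ≤ _ := by gcongr

theorem inner_green_self_pos {c : ℝ} (hc : 0 ≤ c) {f : EnergySpace ρ} (hf : f ≠ 0) :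
    0 < inner ℝ (green ρ c f) f := by
  have h1 := norm_embed_sq_le hc f
  have h2 : 0 < ‖embed ρ f‖ ^ 2 := by
    have : embed ρ f ≠ 0 := fun h => hf (embed_injective (h.trans (map_zero _).symm))
    positivity
  by_contra hc'
  push Not at hc'
  nlinarith [mul_nonneg (sq_nonneg ‖form ρ c‖) (neg_nonneg.2 hc')]

end EnergySpace

/-! ### The operators induced by the differential expressions -/

section InducedOperator

variable {ρ : Density} {ρ' : C(Torus, ℝ)}

theorem Density.hasTDeriv_sqrt (hρ : HasTDeriv ρ.cmap ρ') :
    HasTDeriv ρ.sqrt ((2⁻¹ : ℝ) • (ρ.invSqrt * ρ')) := fun t => by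
  have := (hρ t).sqrt (ρ.pos _).ne'
  refine this.congr_deriv ?_
  simp only [ContinuousMap.smul_apply, ContinuousMap.mul_apply, ρ.invSqrt_apply, smul_eq_mul,
    Density.cmap_apply]
  have := (ρ.sqrt_pos (t : Torus)).ne'
  rw [ρ.sqrt_apply] at this
  field_simp

theorem Density.hasTDeriv_invSqrt (hρ : HasTDeriv ρ.cmap ρ') :
    HasTDeriv ρ.invSqrt ((-2⁻¹ : ℝ) • (ρ.invSqrt * ρ.invSqrt * ρ.invSqrt * ρ')) := fun t => by
  have := (ρ.hasTDeriv_sqrt hρ t).inv (ρ.sqrt_pos _).ne'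
  refine this.congr_deriv ?_
  simp only [ContinuousMap.smul_apply, ContinuousMap.mul_apply, ρ.invSqrt_apply, smul_eq_mul,
    ρ.sqrt_apply]
  have := (ρ.sqrt_pos (t : Torus)).ne'
  rw [ρ.sqrt_apply] at this
  field_simp

theorem Density.tderiv_log (hρ : HasTDeriv ρ.cmap ρ') :
    tderiv (fun y => Real.log (ρ.toFun y)) = ⇑(ρ.invSqrt * ρ.invSqrt * ρ') := by
  have : HasTDeriv ⟨_, continuous_log_density ρ⟩ (ρ.invSqrt * ρ.invSqrt * ρ') := fun t => by
    have := (hρ t).log (ρ.pos _).ne'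
    refine this.congr_deriv ?_
    simp only [ContinuousMap.mul_apply, ρ.invSqrt_apply, Density.cmap_apply]
    rw [← mul_inv, Real.mul_self_sqrt (ρ.pos _).le, div_eq_inv_mul]
  exact this.tderiv_eq

theorem Density.cmap_mul_invSqrt (ρ : Density) : ρ.cmap * ρ.invSqrt = ρ.sqrt := by
  rw [← ρ.sqrt_mul_sqrt, mul_assoc, ρ.sqrt_mul_invSqrt, mul_one]

theorem Density.invSqrt_mul_invSqrt_mul_cmap (ρ : Density) :
    ρ.invSqrt * ρ.invSqrt * ρ.cmap = 1 := by
  rw [mul_assoc, mul_comm _ ρ.cmap, ρ.cmap_mul_invSqrt, ρ.invSqrt_mul_sqrt]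

/-- The second derivative, when `ρ v'` is differentiable. -/
theorem Density.hasTDeriv_of_flux (hρ : HasTDeriv ρ.cmap ρ') {v₁ F₁ : C(Torus, ℝ)}
    (hF : HasTDeriv (ρ.cmap * v₁) F₁) :
    HasTDeriv v₁ (ρ.invSqrt * ρ.invSqrt * F₁ - ρ.invSqrt * ρ.invSqrt * ρ' * v₁) := by
  have h := ((ρ.hasTDeriv_invSqrt hρ).mul (ρ.hasTDeriv_invSqrt hρ)).mul hF
  rw [← mul_assoc, ρ.invSqrt_mul_invSqrt_mul_cmap, one_mul] at h
  convert h using 1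
  ext x
  simp only [ContinuousMap.sub_apply, ContinuousMap.add_apply, ContinuousMap.smul_apply,
    ContinuousMap.mul_apply, smul_eq_mul]
  have h1 : ρ.cmap x * ρ.invSqrt x * ρ.invSqrt x = 1 := by
    have := DFunLike.congr_fun ρ.invSqrt_mul_invSqrt_mul_cmap x
    simp only [ContinuousMap.mul_apply, ContinuousMap.one_apply] at this
    rw [← this]; ring
  linear_combination (ρ.invSqrt x ^ 2 * ρ' x * v₁ x) * h1

/-- The local part is in divergence form: φ'' + (log ρ)'φ' = (ρφ')'/ρ. -/
theorem opExpr_ae_eq (hρ : HasTDeriv ρ.cmap ρ') (c : ℝ) {v v₁ F₁ : C(Torus, ℝ)}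
    (hv : HasTDeriv v v₁) (hF : HasTDeriv (ρ.cmap * v₁) F₁) :
    opExpr c ρ v =ᵐ[volume] (-mulC (ρ.invSqrt * ρ.invSqrt) (toL2 F₁)
      - (2 * Real.pi * c) • hilb (toL2 (ρ.cmap * v₁)) : L2T) := by
  filter_upwards [hilbertTransform_ae_eq hF, coeFn_mulC (ρ.invSqrt * ρ.invSqrt) (toL2 F₁),
    coeFn_toL2 F₁, Lp.coeFn_neg (mulC (ρ.invSqrt * ρ.invSqrt) (toL2 F₁)),
    Lp.coeFn_smul (2 * Real.pi * c) (hilb (toL2 (ρ.cmap * v₁))),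
    Lp.coeFn_sub (-mulC (ρ.invSqrt * ρ.invSqrt) (toL2 F₁))
      ((2 * Real.pi * c) • hilb (toL2 (ρ.cmap * v₁)))] with x h1 h2 h3 h4 h5 h6
  rw [h6, Pi.sub_apply, h4, h5, Pi.neg_apply, Pi.smul_apply, h2, h3, h1]
  unfold opExpr
  rw [hv.tderiv_eq, (ρ.hasTDeriv_of_flux hρ hF).tderiv_eq, ρ.tderiv_log hρ]
  simp only [ContinuousMap.sub_apply, ContinuousMap.mul_apply, smul_eq_mul]
  have e : (⇑(ρ.cmap * v₁) : Torus → ℝ) = fun y => ρ.toFun y * v₁ y := rfl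
  rw [e]
  ring

namespace EnergySpace

theorem wderiv_eq_flux (u : EnergySpace ρ) :
    u.wderiv = mulC (ρ.invSqrt * ρ.invSqrt) (flux ρ u) := by
  rw [flux_eq', ← mulC_mul, ρ.invSqrt_mul_invSqrt_mul_cmap, mulC_one]

theorem inner_sqrt_perturb (c : ℝ) (a : L2T) :
    inner ℝ (toL2 ρ.sqrt) (perturb ρ c a) = 0 := by
  rw [perturb_apply, inner_neg_right, inner_smul_right, inner_sqrt_proj, mul_zero, neg_zero]

theorem inner_sqrt_formInv {c : ℝ} (hc : 0 ≤ c) (f : EnergySpace ρ) :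
    inner ℝ (toL2 ρ.sqrt) (formInv ρ c (embed ρ f)) = 0 := by
  have := congrArg (inner ℝ (toL2 ρ.sqrt)) (form_formInv (ρ := ρ) hc (embed ρ f))
  rwa [form_apply, inner_add_right, inner_sqrt_perturb, add_zero, inner_sqrt_embed] at this

theorem isWeakDeriv_flux_green {c : ℝ} (hc : 0 ≤ c) (f : EnergySpace ρ) :
    IsWeakDeriv (flux ρ (green ρ c f)) (-mulC ρ.sqrt (formInv ρ c (embed ρ f))) := by
  have := isWeakDeriv_flux_solve (ρ := ρ) (formInv ρ c (embed ρ f))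
  rwa [proj_eq_self (inner_sqrt_formInv hc f)] at this

theorem eq_green_of_inducedGraph (hρ : HasTDeriv ρ.cmap ρ') {c : ℝ} (hc : 0 ≤ c)
    {u f : EnergySpace ρ} (h : InducedGraph (opExpr c ρ) u f) : u = green ρ c f := by
  obtain ⟨v, hv, huv, k, hk⟩ := h
  obtain ⟨v₁, hv₁, h1⟩ := TContDiff.exists_hasTDeriv (k := 1) (a := ⟨v, hv.continuous⟩) hv
  obtain ⟨v₂, hv₂⟩ := h1.hasTDeriv
  have hF := hρ.mul hv₂
  set F₁ := ρ' * v₁ + ρ.cmap * v₂ with hF₁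
  have e1 : u.wderiv = toL2 v₁ := by
    have : u.val = toL2 ⟨v, hv.continuous⟩ := l2_ext_continuous huv (coeFn_toL2 _)
    exact u.isWeakDeriv.unique (this ▸ hv₁.isWeakDeriv)
  have e2 : flux ρ u = toL2 (ρ.cmap * v₁) := by rw [flux_eq', e1, mulC_toL2]
  have e3 : (-mulC (ρ.invSqrt * ρ.invSqrt) (toL2 F₁)
      - (2 * Real.pi * c) • hilb (toL2 (ρ.cmap * v₁)) : L2T) = f.val + k • toL2 1 := by
    rw [← map_smul toL2 k]
    refine Lp.ext ?_
    filter_upwards [hk, opExpr_ae_eq hρ c hv₁ hF, Lp.coeFn_add f.val (toL2 (k • 1)),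
      coeFn_toL2 (k • 1)] with x h1 h2 h3 h4
    rw [← h2, h3, Pi.add_apply, h4]
    refine h1.trans ?_
    simp
  set a : L2T := -mulC ρ.invSqrt (toL2 F₁) with ha
  have e4 : IsWeakDeriv (flux ρ u) (-mulC ρ.sqrt a) := by
    rw [e2, ha, map_neg, neg_neg, ← mulC_mul, ρ.sqrt_mul_invSqrt, mulC_one]
    exact hF.isWeakDeriv
  have e5 := solve_eq_of_isWeakDeriv e4
  have e6 := inner_sqrt_eq_zero_of_isWeakDeriv e4
  -- Multiplication by √ρ turns the free additive constant into a multiple of √ρ, which the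
  -- projection annihilates; what remains is `form ρ c a = embed ρ f`.
  have e7 := congrArg (fun g => ρ.proj (mulC ρ.sqrt g)) e3
  simp only [map_add, map_sub, map_smul, map_neg] at e7
  rw [← mulC_mul, ← mul_assoc, ρ.sqrt_mul_invSqrt, one_mul, mulC_toL2 ρ.sqrt 1, mul_one,
    ρ.proj_apply (toL2 ρ.sqrt), ρ.inner_sqrt_sqrt, one_smul, sub_self, smul_zero, add_zero,
    ← map_neg, ← ha, proj_eq_self e6, ← embed_apply, proj_eq_self (inner_sqrt_embed f), ← e2] at e7
  have e8 : form ρ c a = embed ρ f := by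
    rw [form_apply, perturb_apply, ← e5, ← e7, sub_eq_add_neg]
  rw [green_apply, ← e8, formInv_form hc, ← e5]

/-- The functions representing `green ρ c f` and its derivatives. -/
theorem exists_green_rep {c : ℝ} (hc : 0 ≤ c) (f : EnergySpace ρ) :
    ∃ v v₁ F₁ : C(Torus, ℝ), (green ρ c f).val = toL2 v ∧ HasTDeriv v v₁ ∧
      HasTDeriv (ρ.cmap * v₁) F₁ ∧ ∃ k : ℝ,
        -mulC (ρ.invSqrt * ρ.invSqrt) (toL2 F₁) - (2 * Real.pi * c) • hilb (toL2 (ρ.cmap * v₁))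
          = f.val + k • toL2 1 := by
  set u := green ρ c f with hu
  set a := formInv ρ c (embed ρ f) with ha
  have hw : IsWeakDeriv (flux ρ u) (-mulC ρ.sqrt a) := isWeakDeriv_flux_green hc f
  obtain ⟨C, hC, hS⟩ := IsWeakDeriv.exists_continuous
  obtain ⟨g, hg, -⟩ := hS hw
  obtain ⟨h, hh, -⟩ := hS hw.hilb
  obtain ⟨f₀, hf₀, -⟩ := hS f.isWeakDeriv
  obtain ⟨v, hv, -⟩ := hS u.isWeakDeriv
  set k : ℝ := inner ℝ (toL2 ρ.sqrt) (mulC ρ.sqrt (hilb (flux ρ u))) with hk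
  -- The equation (1 + P)a = √ρ f solved for a: all terms on the right have continuous
  -- representatives, so a is continuous and the flux is C¹. The number k is the component along √ρ
  -- that the projection removes.
  set a₀ : C(Torus, ℝ) := ρ.sqrt * f₀ + (2 * Real.pi * c) • (ρ.sqrt * h - k • ρ.sqrt) with ha₀
  have e1 : a = toL2 a₀ := by
    have := form_formInv (ρ := ρ) hc (embed ρ f)
    rw [form_apply, perturb_apply, ← ha, ← green_apply, ← hu, ρ.proj_apply, ← hk, hh,
      embed_apply, hf₀, mulC_toL2, mulC_toL2, ← sub_eq_add_neg, sub_eq_iff_eq_add] at this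
    rw [this, ha₀, map_add, map_smul, map_sub, map_smul]
  have e2 : HasTDeriv g (-(ρ.sqrt * a₀)) := by
    refine IsWeakDeriv.hasTDeriv ?_
    rw [← hg, map_neg, ← mulC_toL2, ← e1]
    exact hw
  have e3 : ρ.cmap * (ρ.invSqrt * ρ.invSqrt * g) = g := by
    rw [← mul_assoc, mul_comm ρ.cmap, ρ.invSqrt_mul_invSqrt_mul_cmap, one_mul]
  refine ⟨v, ρ.invSqrt * ρ.invSqrt * g, -(ρ.sqrt * a₀), hv, ?_, by rwa [e3],
    -(2 * Real.pi * c * k), ?_⟩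
  · refine IsWeakDeriv.hasTDeriv ?_
    rw [← hv, ← mulC_toL2, ← hg, ← wderiv_eq_flux]
    exact u.isWeakDeriv
  · rw [e3, ← hg, hh, hf₀, mulC_toL2, ← map_smul toL2, ← map_smul toL2, ← map_neg toL2, ← map_sub,
      ← map_add]
    congr 1
    ext x
    simp only [ha₀, ContinuousMap.sub_apply, ContinuousMap.add_apply, ContinuousMap.smul_apply,
      ContinuousMap.mul_apply, ContinuousMap.neg_apply, smul_eq_mul, ContinuousMap.one_apply]
    have h1 : ρ.sqrt x * ρ.invSqrt x = 1 := by
      have := DFunLike.congr_fun ρ.sqrt_mul_invSqrt x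
      simpa only [ContinuousMap.mul_apply, ContinuousMap.one_apply] using this
    linear_combination (f₀ x + 2 * Real.pi * c * (h x - k)) * (1 + ρ.sqrt x * ρ.invSqrt x) * h1

theorem inducedGraph_green (hρ : HasTDeriv ρ.cmap ρ') {c : ℝ} (hc : 0 ≤ c) (f : EnergySpace ρ) :
    InducedGraph (opExpr c ρ) (green ρ c f) f := by
  obtain ⟨v, v₁, F₁, hv, h1, h2, k, hk⟩ := exists_green_rep hc f
  refine ⟨v, ?_, hv ▸ coeFn_toL2 v, k, ?_⟩
  · refine (h1.tContDiff_succ (k := 1)).2 (((ρ.hasTDeriv_of_flux hρ h2).tContDiff_succ (k := 0)).2 ?_)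
    exact_mod_cast tContDiff_zero.2 (map_continuous _)
  · have h3 := opExpr_ae_eq hρ c h1 h2
    rw [hk, ← map_smul toL2 k] at h3
    filter_upwards [h3, Lp.coeFn_add f.val (toL2 (k • 1)), coeFn_toL2 (k • 1)] with x h1 h2 h3
    rw [h1, h2, Pi.add_apply, h3]
    simp

theorem inducedGraph_iff (hρ : HasTDeriv ρ.cmap ρ') {c : ℝ} (hc : 0 ≤ c) (u f : EnergySpace ρ) :
    InducedGraph (opExpr c ρ) u f ↔ u = green ρ c f :=
  ⟨eq_green_of_inducedGraph hρ hc, fun h => h ▸ inducedGraph_green hρ hc f⟩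

end EnergySpace

end InducedOperator

/-! ### Eigenbases of compact positive operators -/

section Spectral

variable {E : Type*} [NormedAddCommGroup E] [InnerProductSpace ℝ E] [CompleteSpace E]

/-- For a positive operator the norm is the supremum of the Rayleigh quotient. Were it in the
resolvent set, the quotient would stay below ‖T‖ - ε. By compactness this nonzero spectral value is
an eigenvalue. -/
theorem exists_eigenvector_norm [Nontrivial E] {T : E →L[ℝ] E} (hT : IsCompactOperator T)
    (hs : ∀ x y, inner ℝ (T x) y = inner ℝ x (T y)) (hp : ∀ x, x ≠ 0 → 0 < inner ℝ (T x) x) :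
    ∃ v : E, ‖v‖ = 1 ∧ T v = ‖T‖ • v := by
  have hsym : T.IsSymmetric := hs
  have hT0 : ‖T‖ ≠ 0 := by
    obtain ⟨x, hx⟩ := exists_ne (0 : E)
    intro h
    have := hp x hx
    rw [norm_eq_zero.1 h] at this
    simp at this
  have hray : ∀ x, 0 ≤ T.rayleighQuotient x := fun x => by
    by_cases hx : x = 0
    · simp [hx]
    · rw [ContinuousLinearMap.rayleighQuotient, ContinuousLinearMap.reApplyInnerSelf_apply]
      exact div_nonneg (hp x hx).le (sq_nonneg _)
  have hspec : ‖T‖ ∈ spectrum ℝ T := by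
    by_contra hc
    obtain ⟨ε, hε, h⟩ := T.rayleighQuotient_le_of_norm_mem_resolventSet (𝕜 := ℝ)
      (not_not.1 hc)
    have h2 : ‖T‖ ≤ ‖T‖ - ε := by
      conv_lhs => rw [T.norm_eq_iSup_rayleighQuotient hsym]
      exact ciSup_le fun x => by rw [abs_of_nonneg (hray x)]; exact h x
    linarith
  obtain ⟨v, hv⟩ := ((hT.hasEigenvalue_iff_mem_spectrum hT0).2 hspec).exists_hasEigenvector
  have hv0 : ‖v‖ ≠ 0 := norm_ne_zero_iff.2 hv.2
  refine ⟨‖v‖⁻¹ • v, by rw [norm_smul, norm_inv, norm_norm, inv_mul_cancel₀ hv0], ?_⟩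
  have := hv.apply_eq_smul
  rw [map_smul, smul_comm]
  exact congrArg _ this

/-- Apply the previous result to the restriction of T to the orthogonal complement of U, which is
invariant by symmetry and nonzero because E is infinite dimensional. -/
theorem exists_top_eigenvector {T : E →L[ℝ] E} (hT : IsCompactOperator T)
    (hs : ∀ x y, inner ℝ (T x) y = inner ℝ x (T y)) (hp : ∀ x, x ≠ 0 → 0 < inner ℝ (T x) x)
    (hE : ¬FiniteDimensional ℝ E) (U : Submodule ℝ E) [FiniteDimensional ℝ U]
    (hU : ∀ x ∈ U, T x ∈ U) : ∃ p : E × ℝ, p.1 ∈ Uᗮ ∧ ‖p.1‖ = 1 ∧ 0 < p.2 ∧ T p.1 = p.2 • p.1 ∧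
      ∀ w ∈ Uᗮ, inner ℝ (T w) w ≤ p.2 * ‖w‖ ^ 2 := by
  have hU' : ∀ x ∈ Uᗮ, T x ∈ Uᗮ := fun x hx => (Submodule.mem_orthogonal _ _).2 fun y hy => by
    rw [← hs]
    exact (Submodule.mem_orthogonal _ _).1 hx _ (hU y hy)
  have hne : Nontrivial Uᗮ := by
    rw [Submodule.nontrivial_iff_ne_bot]
    intro h
    rw [Submodule.orthogonal_eq_bot_iff] at h
    subst h
    exact hE (Module.Finite.equiv (Submodule.topEquiv (R := ℝ) (M := E)))
  let S : Uᗮ →L[ℝ] Uᗮ := T.restrict hU'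
  have hSc : IsCompactOperator S := hT.restrict' hU'
  have hSe : ∀ x : Uᗮ, ((S x : Uᗮ) : E) = T x := fun x => rfl
  have hSp : ∀ x : Uᗮ, x ≠ 0 → 0 < inner ℝ (S x) x := fun x hx =>
    hp x fun h => hx (Subtype.ext h)
  obtain ⟨v, hv1, hv2⟩ := exists_eigenvector_norm hSc (fun x y => hs x y) hSp
  refine ⟨(v, ‖S‖), v.2, hv1, ?_, ?_, fun w hw => ?_⟩
  · have : v ≠ 0 := fun h => by rw [h, norm_zero] at hv1; exact zero_ne_one hv1
    have := hSp v this
    rwa [hv2, inner_smul_left, real_inner_self_eq_norm_sq, hv1, one_pow, mul_one, conj_trivial] at this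
  · rw [← hSe, hv2]; rfl
  · have h1 := real_inner_le_norm (S ⟨w, hw⟩) ⟨w, hw⟩
    have h2 := S.le_opNorm ⟨w, hw⟩
    change inner ℝ (T w) w ≤ ‖S ⟨w, hw⟩‖ * ‖w‖ at h1
    change ‖S ⟨w, hw⟩‖ ≤ ‖S‖ * ‖w‖ at h2
    calc inner ℝ (T w) w ≤ ‖S ⟨w, hw⟩‖ * ‖w‖ := h1
      _ ≤ ‖S‖ * ‖w‖ * ‖w‖ := by gcongr
      _ = _ := by ring

/-- Greedy construction: each new vector is a top eigenvector orthogonal to the span of the previous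
ones. The enumeration then comes with nonincreasing eigenvalues, as the min-max arguments require.
-/
theorem exists_eigenbasis {T : E →L[ℝ] E} (hT : IsCompactOperator T)
    (hs : ∀ x y, inner ℝ (T x) y = inner ℝ x (T y)) (hp : ∀ x, x ≠ 0 → 0 < inner ℝ (T x) x)
    (hE : ¬FiniteDimensional ℝ E) : ∃ (b : HilbertBasis ℕ ℝ E) (μ : ℕ → ℝ), (∀ n, 0 < μ n) ∧
      Antitone μ ∧ ∀ n, T (b n) = μ n • b n := by
  let I := {U : Submodule ℝ E // FiniteDimensional ℝ U ∧ ∀ x ∈ U, T x ∈ U}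
  have H : ∀ U : I, ∃ p : E × ℝ, p.1 ∈ U.1ᗮ ∧ ‖p.1‖ = 1 ∧ 0 < p.2 ∧ T p.1 = p.2 • p.1 ∧
      ∀ w ∈ U.1ᗮ, inner ℝ (T w) w ≤ p.2 * ‖w‖ ^ 2 := fun U => by
    have := U.2.1
    exact exists_top_eigenvector hT hs hp hE U.1 U.2.2
  choose p hperp hnorm hpos heig hmax using H
  have hstep : ∀ U : I, FiniteDimensional ℝ ↥(U.1 ⊔ Submodule.span ℝ {(p U).1}) ∧
      ∀ x ∈ U.1 ⊔ Submodule.span ℝ {(p U).1}, T x ∈ U.1 ⊔ Submodule.span ℝ {(p U).1} :=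
    fun U => by
      have := U.2.1
      refine ⟨inferInstance, fun x hx => ?_⟩
      obtain ⟨y, hy, z, hz, rfl⟩ := Submodule.mem_sup.1 hx
      obtain ⟨a, rfl⟩ := Submodule.mem_span_singleton.1 hz
      rw [map_add, map_smul, heig]
      exact Submodule.add_mem_sup (U.2.2 y hy) (Submodule.smul_mem _ _
        (Submodule.smul_mem _ _ (Submodule.mem_span_singleton_self _)))
  let U : ℕ → I := fun n => Nat.rec ⟨⊥, inferInstance, fun x hx => by
    rw [(Submodule.mem_bot ℝ).1 hx, map_zero]; exact Submodule.zero_mem _⟩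
    (fun _ W => ⟨W.1 ⊔ Submodule.span ℝ {(p W).1}, hstep W⟩) n
  have hUs : ∀ n, (U (n + 1)).1 = (U n).1 ⊔ Submodule.span ℝ {(p (U n)).1} := fun n => rfl
  have hUm : Monotone fun n => (U n).1 := monotone_nat_of_le_succ fun n => by
    simp only [hUs]; exact le_sup_left
  set v : ℕ → E := fun n => (p (U n)).1 with hv
  set μ : ℕ → ℝ := fun n => (p (U n)).2 with hμ
  have hvU : ∀ {m n}, m < n → v m ∈ (U n).1 := fun {m n} h => hUm (Nat.succ_le_of_lt h) (by
    simp only [hUs]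
    exact Submodule.mem_sup_right (Submodule.mem_span_singleton_self _))
  have hlt : ∀ {m n}, m < n → inner ℝ (v m) (v n) = 0 := fun {m n} h =>
    (Submodule.mem_orthogonal _ _).1 (hperp (U n)) _ (hvU h)
  have hort : Orthonormal ℝ v := by
    refine ⟨fun n => hnorm (U n), fun m n hmn => ?_⟩
    rcases lt_or_gt_of_ne hmn with h | h
    · exact hlt h
    · rw [real_inner_comm]; exact hlt h
  have hanti : Antitone μ := antitone_nat_of_succ_le fun n => by
    have h1 := hmax (U n) (v (n + 1)) (Submodule.orthogonal_le (hUm n.le_succ) (hperp (U (n + 1))))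
    rw [heig, inner_smul_left, real_inner_self_eq_norm_sq] at h1
    have h2 : ‖v (n + 1)‖ = 1 := hnorm (U (n + 1))
    rw [h2] at h1
    simpa using h1
  -- Otherwise every v n lies in the image of the ball of radius 1/ε, which is relatively compact,
  -- while orthonormal vectors are at mutual distance √2.
  have hsmall : ∀ ε > 0, ∃ n, μ n < ε := by
    intro ε hε
    by_contra hc
    push Not at hc
    have hK := hT.isCompact_closure_image_closedBall (f := (T : E →ₗ[ℝ] E)) ε⁻¹
    have hmem : ∀ n, v n ∈ closure ((T : E →ₗ[ℝ] E) '' Metric.closedBall 0 ε⁻¹) := fun n => by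
      refine subset_closure ⟨(μ n)⁻¹ • v n, ?_, ?_⟩
      · rw [mem_closedBall_zero_iff, norm_smul, hort.1 n, mul_one, norm_inv,
          Real.norm_of_nonneg (hpos _).le]
        exact inv_anti₀ hε (hc n)
      · change T ((μ n)⁻¹ • v n) = v n
        rw [map_smul, heig, smul_smul, inv_mul_cancel₀ (hpos (U n)).ne', one_smul]
    obtain ⟨a, -, φ, hφ, ha⟩ := hK.tendsto_subseq hmem
    obtain ⟨N, hN⟩ := Metric.cauchySeq_iff.1 ha.cauchySeq 1 one_pos
    have h1 := hN N le_rfl (N + 1) N.le_succ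
    rw [dist_eq_norm] at h1
    have h2 := @norm_sub_sq_real E _ _ (v (φ N)) (v (φ (N + 1)))
    rw [hlt (hφ N.lt_succ_self), hort.1, hort.1] at h2
    simp only [Function.comp_apply] at h1
    nlinarith [norm_nonneg (v (φ N) - v (φ (N + 1)))]
  -- A vector x orthogonal to all v n satisfies ⟨Tx, x⟩ ≤ μ n ‖x‖² for every n, which contradicts
  -- strict positivity unless x = 0.
  have hbot : (Submodule.span ℝ (Set.range v))ᗮ = ⊥ := by
    rw [Submodule.eq_bot_iff]
    intro x hx
    have hle : ∀ n, (U n).1 ≤ Submodule.span ℝ (Set.range v) := fun n => by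
      induction n with
      | zero => exact bot_le
      | succ n ih =>
        rw [hUs]
        exact sup_le ih (Submodule.span_le.2 (by
          rw [Set.singleton_subset_iff]
          exact Submodule.subset_span ⟨n, rfl⟩))
    by_contra hx0
    have h1 := hp x hx0
    have h2 : 0 < ‖x‖ ^ 2 := by positivity
    obtain ⟨n, hn⟩ := hsmall _ (div_pos h1 h2)
    have h3 := hmax (U n) x (Submodule.orthogonal_le (hle n) hx)
    rw [lt_div_iff₀ h2] at hn
    exact absurd h3 (not_le.2 hn)
  refine ⟨HilbertBasis.mkOfOrthogonalEqBot hort hbot, μ, fun n => hpos _, hanti, fun n => ?_⟩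
  rw [HilbertBasis.coe_mkOfOrthogonalEqBot]
  exact heig (U n)

end Spectral

section Eigenbasis

variable {E : Type*} [NormedAddCommGroup E] [InnerProductSpace ℝ E]
  {T : E →L[ℝ] E} {b : HilbertBasis ℕ ℝ E} {μ : ℕ → ℝ}

theorem hasSum_inner_eigenbasis (hs : ∀ x y, inner ℝ (T x) y = inner ℝ x (T y))
    (h : ∀ n, T (b n) = μ n • b n) (x : E) :
    HasSum (fun n => μ n * |inner ℝ x (b n)| ^ 2) (inner ℝ x (T x)) := by
  refine (b.hasSum_inner_mul_inner x (T x)).congr_fun fun n => ?_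
  rw [← hs, h, inner_smul_left, sq_abs, real_inner_comm x (b n)]
  simp only [conj_trivial]; ring

theorem hasSum_eigenbasis (hs : ∀ x y, inner ℝ (T x) y = inner ℝ x (T y))
    (h : ∀ n, T (b n) = μ n • b n) (x : E) :
    HasSum (fun n => inner ℝ (b n) x • μ n • b n) (T x) := by
  refine (b.hasSum_repr (T x)).congr_fun fun n => ?_
  rw [HilbertBasis.repr_apply_apply, ← hs, h, inner_smul_left, smul_smul]
  simp [mul_comm]

theorem isTraceClass_of_eigenbasis (hs : ∀ x y, inner ℝ (T x) y = inner ℝ x (T y))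
    (h : ∀ n, T (b n) = μ n • b n) (hμ : ∀ n, 0 < μ n) (hsum : Summable μ) : IsTraceClass T := by
  refine ⟨b, fun n => μ n • b n, ?_, hasSum_eigenbasis hs h⟩
  refine hsum.congr fun n => ?_
  rw [norm_smul, b.orthonormal.1, Real.norm_of_nonneg (hμ n).le, one_mul, mul_one]

theorem inner_le_of_orthogonal (hs : ∀ x y, inner ℝ (T x) y = inner ℝ x (T y))
    (h : ∀ n, T (b n) = μ n • b n) (hμ : Antitone μ) {x : E} {n : ℕ}
    (hx : ∀ j < n, inner ℝ x (b j) = 0) : inner ℝ x (T x) ≤ μ n * ‖x‖ ^ 2 := by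
  have h1 := (b.hasSum_inner_mul_inner x x).mul_left (μ n)
  rw [real_inner_self_eq_norm_sq] at h1
  refine hasSum_le (fun j => ?_) (hasSum_inner_eigenbasis hs h x) h1
  rw [real_inner_comm x (b j), ← sq, sq_abs]
  by_cases hj : j < n
  · rw [hx j hj]; simp
  · exact mul_le_mul_of_nonneg_right (hμ (not_lt.1 hj)) (sq_nonneg _)

end Eigenbasis

/-! ### Eigenvalue asymptotics -/

theorem exists_combination_orthogonal {H ι κ : Type*} [NormedAddCommGroup H]
    [InnerProductSpace ℝ H] [Fintype ι] [Fintype κ] (v : ι → H) (y : κ → H)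
    (h : Fintype.card κ < Fintype.card ι) :
    ∃ a : ι → ℝ, a ≠ 0 ∧ ∀ i, inner ℝ (y i) (∑ j, a j • v j) = 0 := by
  let Φ : (ι → ℝ) →ₗ[ℝ] (κ → ℝ) :=
    { toFun := fun a i => inner ℝ (y i) (∑ j, a j • v j)
      map_add' := fun a a' => funext fun i => by
        simp only [Pi.add_apply, add_smul, Finset.sum_add_distrib, inner_add_right]
      map_smul' := fun r a => funext fun i => by
        simp only [Pi.smul_apply, smul_eq_mul, mul_smul, ← Finset.smul_sum, inner_smul_right,
          RingHom.id_apply] }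
  have hk : LinearMap.ker Φ ≠ ⊥ := LinearMap.ker_ne_bot_of_finrank_lt (by simpa using h)
  obtain ⟨a, ha, ha0⟩ := Submodule.exists_mem_ne_zero_of_ne_bot hk
  exact ⟨a, ha0, fun i => congrFun (LinearMap.mem_ker.1 ha) i⟩

/-- Bernstein's inequality in L². -/
theorem exists_isWeakDeriv_of_band {h : L2T} {M : ℕ} (hh : ∀ k : ℤ, (M : ℤ) < |k| → casCoeff h k = 0) :
    ∃ h' : L2T, IsWeakDeriv h h' ∧ ‖h'‖ ≤ M * ‖h‖ := by
  have hb : ∀ n : ℤ, |if |n| ≤ (M : ℤ) then -(n : ℝ) else 0| ≤ (M : ℝ) := fun n => by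
    split_ifs with hn
    · rw [abs_neg]; exact_mod_cast hn
    · simp
  refine ⟨mulOp (Equiv.neg ℤ) _ M hb h, isWeakDeriv_iff.2 fun n => ?_, norm_mulOp_le _ _ _ _ _⟩
  rw [casCoeff_mulOp, Equiv.neg_apply]
  split_ifs with hn
  · rfl
  · rw [hh (-n) (by rw [abs_neg]; exact not_le.1 hn)]; simp

/-- The Wirtinger inequality, sharpened by the absence of frequencies up to M. -/
theorem IsWeakDeriv.mul_norm_le {h h' : L2T} (hd : IsWeakDeriv h h') {M : ℕ}
    (hh : ∀ k : ℤ, |k| ≤ (M : ℤ) → casCoeff h k = 0) : ((M : ℝ) + 1) * ‖h‖ ≤ ‖h'‖ := by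
  refine abs_le_of_sq_le_sq' ?_ (norm_nonneg _) |>.2
  rw [mul_pow]
  refine hasSum_le (fun k => ?_) ((hasSum_casCoeff_sq h).mul_left _)
    ((Equiv.neg ℤ).hasSum_iff.2 (hasSum_casCoeff_sq h'))
  simp only [Function.comp_apply, Equiv.neg_apply]
  rw [isWeakDeriv_iff.1 hd, neg_neg]
  by_cases hk : |k| ≤ (M : ℤ)
  · rw [hh k hk]; simp
  · rw [mul_pow]
    refine mul_le_mul_of_nonneg_right ?_ (sq_nonneg _)
    have : (M : ℝ) + 1 ≤ |(k : ℝ)| := by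
      have : (M : ℤ) + 1 ≤ |k| := by omega
      exact_mod_cast this
    rw [Int.cast_neg, neg_neg, ← sq_abs (k : ℝ)]
    gcongr

theorem norm_toL2Isometry {ρ : Density} (u : EnergySpace ρ) :
    ‖EnergySpace.toL2Isometry ρ u‖ = ‖u‖ := (EnergySpace.toL2Isometry ρ).norm_map u

namespace EnergySpace

variable {ρ : Density} {ρ' : C(Torus, ℝ)}

/-- A trigonometric polynomial of degree `M` satisfying `n < 2 * M` linear conditions. -/
theorem exists_band {n M : ℕ} (hn : n < 2 * M) (y : Fin n → EnergySpace ρ) :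
    ∃ u : EnergySpace ρ, u ≠ 0 ∧ (∀ i, inner ℝ (y i) u = 0) ∧
      ∃ h' : L2T, IsWeakDeriv (toL2Isometry ρ u) h' ∧ ‖h'‖ ≤ M * ‖u‖ := by
  obtain ⟨a, ha, hy⟩ := exists_combination_orthogonal
    (fun j : Finset.Icc (-(M : ℤ)) M => casBasis j)
    -- The extra condition `none` puts the polynomial in the range of the isometry. There are n + 1
    -- conditions on a space of dimension 2M + 1.
    (fun i : Option (Fin n) => i.elim (toL2 ρ.invSqrt) (fun i => toL2Isometry ρ (y i)))
    (by simp; omega)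
  set h : L2T := ∑ j, a j • casBasis j with hh
  obtain ⟨u, hu⟩ := exists_toL2Isometry_eq (hy none)
  have hcoeff : ∀ k : ℤ, casCoeff h k = ∑ j, a j * if k = j then 1 else 0 := fun k => by
    rw [hh, ← inner_casBasis, inner_sum]
    refine Finset.sum_congr rfl fun j _ => ?_
    rw [inner_smul_right, inner_casBasis, casCoeff_casBasis]
  have hband : ∀ k : ℤ, (M : ℤ) < |k| → casCoeff h k = 0 := fun k hk => by
    rw [hcoeff]
    refine Finset.sum_eq_zero fun j _ => ?_
    have : k ≠ j := fun e => by
      have := abs_le.2 (Finset.mem_Icc.1 j.2)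
      rw [← e] at this
      omega
    rw [if_neg this, mul_zero]
  obtain ⟨h', hd, hn'⟩ := exists_isWeakDeriv_of_band hband
  refine ⟨u, ?_, fun i => ?_, h', hu ▸ hd, ?_⟩
  · rintro rfl
    refine ha (funext fun j => ?_)
    have h0 : h = 0 := by rw [← hu, map_zero]
    have := hcoeff j
    rw [Finset.sum_eq_single j (fun i _ hij => by
        rw [if_neg (fun e => hij (Subtype.ext e.symm)), mul_zero]) (fun h => absurd (Finset.mem_univ _) h),
      if_pos rfl, mul_one, h0, ← inner_casBasis, inner_zero_right] at this
    exact this.symm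
  · have := hy (some i)
    change inner ℝ (toL2Isometry ρ (y i)) h = 0 at this
    rwa [← hu, (toL2Isometry ρ).inner_map_map] at this
  · rwa [← norm_toL2Isometry, hu]

theorem not_finiteDimensional (ρ : Density) : ¬FiniteDimensional ℝ (EnergySpace ρ) := by
  intro h
  obtain ⟨u, hu0, hu, -⟩ := exists_band (M := Module.finrank ℝ (EnergySpace ρ) + 1)
    (n := Module.finrank ℝ (EnergySpace ρ)) (by omega) (stdOrthonormalBasis ℝ (EnergySpace ρ))
  refine hu0 ?_
  rw [← (stdOrthonormalBasis ℝ (EnergySpace ρ)).sum_repr' u]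
  exact Finset.sum_eq_zero fun i _ => by rw [hu, zero_smul]

theorem norm_flux_le (u : EnergySpace ρ) : ‖flux ρ u‖ ≤ ‖ρ.sqrt‖ * ‖u‖ := by
  rw [flux_eq, ← norm_toL2Isometry u]
  exact norm_mulC_le _ _

/-- The Hilbert transform acts on the flux without differentiating it, so the nonlocal part is
bounded by the energy norm of u alone. This is why it does not change the Weyl constant. -/
theorem inner_form_le {c : ℝ} (hc : 0 ≤ c) (a : L2T) :
    inner ℝ (form ρ c a) a
      ≤ (‖a‖ + 2 * Real.pi * c * ‖ρ.sqrt‖ ^ 2 * ‖solve ρ a‖) ^ 2 := by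
  have hpi := Real.pi_pos
  have h1 : ‖perturb ρ c a‖ ≤ 2 * Real.pi * c * ‖ρ.sqrt‖ ^ 2 * ‖solve ρ a‖ := by
    rw [perturb_apply, norm_neg, norm_smul, Real.norm_of_nonneg (by positivity)]
    calc 2 * Real.pi * c * ‖ρ.proj (mulC ρ.sqrt (hilb (flux ρ (solve ρ a))))‖
        ≤ 2 * Real.pi * c * (‖ρ.sqrt‖ * (‖ρ.sqrt‖ * ‖solve ρ a‖)) := by
          gcongr
          refine (norm_proj_le _).trans ((norm_mulC_le _ _).trans ?_)
          gcongr
          exact (norm_hilb_le _).trans (norm_flux_le _)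
      _ = _ := by ring
  have h2 := real_inner_le_norm (perturb ρ c a) a
  rw [form_apply, inner_add_left, real_inner_self_eq_norm_sq]
  set K := 2 * Real.pi * c * ‖ρ.sqrt‖ ^ 2 * ‖solve ρ a‖
  have hK : 0 ≤ K := by positivity
  nlinarith [norm_nonneg a, mul_le_mul_of_nonneg_right h1 (norm_nonneg a)]

/-- Since h = √ρ u' is ρ^{-1/2} times the flux, Leibniz's rule gives h' = -a plus a bounded multiple
of h. -/
theorem isWeakDeriv_toL2Isometry (hρ : HasTDeriv ρ.cmap ρ') : ∃ d : ℝ, 0 ≤ d ∧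
    ∀ {u : EnergySpace ρ} {a : L2T}, IsWeakDeriv (flux ρ u) (-mulC ρ.sqrt a) →
      ∃ h', IsWeakDeriv (toL2Isometry ρ u) h' ∧ ‖h'‖ ≤ ‖a‖ + d * ‖u‖ := by
  refine ⟨‖((-2⁻¹ : ℝ) • (ρ.invSqrt * ρ.invSqrt * ρ.invSqrt * ρ')) * ρ.sqrt‖, norm_nonneg _,
    fun {u a} h => ?_⟩
  have h1 := h.mulC (ρ.hasTDeriv_invSqrt hρ)
  rw [flux_eq, ← mulC_mul, ← mulC_mul, ρ.invSqrt_mul_sqrt, mulC_one, map_neg, ← mulC_mul,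
    ρ.invSqrt_mul_sqrt, mulC_one] at h1
  refine ⟨_, h1, (norm_add_le _ _).trans ?_⟩
  rw [norm_neg, add_comm]
  have := norm_mulC_le (((-2⁻¹ : ℝ) • (ρ.invSqrt * ρ.invSqrt * ρ.invSqrt * ρ')) * ρ.sqrt)
    (toL2Isometry ρ u)
  rw [norm_toL2Isometry] at this
  linarith

theorem isWeakDeriv_flux_of_toL2Isometry (hρ : HasTDeriv ρ.cmap ρ') : ∃ d : ℝ, 0 ≤ d ∧
    ∀ {u : EnergySpace ρ} {h' : L2T}, IsWeakDeriv (toL2Isometry ρ u) h' →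
      ∃ a, IsWeakDeriv (flux ρ u) (-mulC ρ.sqrt a) ∧ ‖a‖ ≤ ‖h'‖ + d * ‖u‖ := by
  refine ⟨‖ρ.invSqrt * ((2⁻¹ : ℝ) • (ρ.invSqrt * ρ'))‖, norm_nonneg _, fun {u h'} h => ?_⟩
  refine ⟨-(mulC (ρ.invSqrt * ((2⁻¹ : ℝ) • (ρ.invSqrt * ρ'))) (toL2Isometry ρ u) + h'), ?_, ?_⟩
  · have h1 := h.mulC (ρ.hasTDeriv_sqrt hρ)
    rwa [map_neg, neg_neg, map_add, ← mulC_mul, ← mul_assoc, ρ.sqrt_mul_invSqrt, one_mul]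
  · rw [norm_neg]
    refine (norm_add_le _ _).trans ?_
    have := norm_mulC_le (ρ.invSqrt * ((2⁻¹ : ℝ) • (ρ.invSqrt * ρ'))) (toL2Isometry ρ u)
    rw [norm_toL2Isometry] at this
    linarith

/-! ### Two-sided eigenvalue bounds and the trace -/

section Weyl

variable {c : ℝ} {b : HilbertBasis ℕ ℝ (EnergySpace ρ)} {μ : ℕ → ℝ}

/-- Take a trial function u orthogonal to the first n eigenvectors, with √ρ u' a trigonometric
polynomial of degree M. Its form is at most (M + C)²‖u‖², and a Cauchy–Schwarz argument turns this
into a lower bound for the inverse operator at u. -/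
theorem exists_eigenvalue_le (hρ : HasTDeriv ρ.cmap ρ') (hc : 0 ≤ c)
    (h : ∀ n, green ρ c (b n) = μ n • b n) (hμ : Antitone μ) (hpos : ∀ n, 0 < μ n) :
    ∃ C : ℝ, 0 ≤ C ∧ ∀ n M : ℕ, n < 2 * M → √(μ n)⁻¹ ≤ M + C := by
  obtain ⟨d, hd, H⟩ := isWeakDeriv_flux_of_toL2Isometry hρ
  have hpi := Real.pi_pos
  refine ⟨d + 2 * Real.pi * c * ‖ρ.sqrt‖ ^ 2, by positivity, fun n M hn => ?_⟩
  set C := d + 2 * Real.pi * c * ‖ρ.sqrt‖ ^ 2 with hC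
  have hC0 : 0 ≤ C := by positivity
  obtain ⟨u, hu0, hub, h', hd', hh'⟩ := exists_band (ρ := ρ) hn (fun i => b i)
  obtain ⟨a, ha, hna⟩ := H hd'
  have hua := solve_eq_of_isWeakDeriv ha
  have hM : (0 : ℝ) < M := by exact_mod_cast (by omega : 0 < M)
  set K : ℝ := (M + C) ^ 2 with hK
  have hK0 : 0 < K := by positivity
  have hu2 : 0 < ‖u‖ ^ 2 := by positivity
  have h1 : inner ℝ (form ρ c a) a ≤ K * ‖u‖ ^ 2 := by
    refine (inner_form_le hc a).trans ?_
    rw [← hua, hK, ← mul_pow]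
    gcongr
    calc _ ≤ (M * ‖u‖ + d * ‖u‖) + 2 * Real.pi * c * ‖ρ.sqrt‖ ^ 2 * ‖u‖ := by gcongr; linarith
      _ = _ := by rw [hC]; ring
  set y := formInv ρ c (embed ρ u) with hy
  have h2 : inner ℝ a (form ρ c y) = ‖u‖ ^ 2 := by
    rw [hy, form_formInv hc, ← inner_solve_left, ← hua, real_inner_self_eq_norm_sq]
  have h3 : inner ℝ (form ρ c y) y ≤ μ n * ‖u‖ ^ 2 := by
    have := inner_le_of_orthogonal (inner_green_left hc) h hμ (n := n) (x := u) (fun j hj => by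
      rw [real_inner_comm]; exact hub ⟨j, hj⟩)
    rwa [real_inner_comm, inner_green_self, ← hy, ← form_formInv (ρ := ρ) hc (embed ρ u), ← hy,
      real_inner_comm] at this
  -- Cauchy–Schwarz for the form, as positivity at K⁻¹a - y: since ⟨a, (1 + P)y⟩ = ‖u‖², it yields
  -- K⁻¹‖u‖² ≤ ⟨(1 + P)y, y⟩, and the right-hand side is ⟨u, `green` u⟩.
  have h4 := (sq_nonneg _).trans (norm_sq_le_inner_form (ρ := ρ) hc (K⁻¹ • a - y))
  rw [map_sub, map_smul, inner_sub_left, inner_sub_right, inner_sub_right, inner_smul_left,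
    inner_smul_left, inner_smul_right, inner_smul_right, inner_form_left c a y, h2,
    real_inner_comm a (form ρ c y), h2] at h4
  simp only [conj_trivial] at h4
  have h5 : K⁻¹ * (K⁻¹ * inner ℝ (form ρ c a) a) ≤ K⁻¹ * ‖u‖ ^ 2 := by
    have : K⁻¹ * inner ℝ (form ρ c a) a ≤ ‖u‖ ^ 2 := by
      rw [inv_mul_le_iff₀ hK0]; exact h1
    gcongr
  have h6 : K⁻¹ ≤ μ n := by
    by_contra hcon
    push Not at hcon
    nlinarith [mul_lt_mul_of_pos_right hcon hu2]
  have h7 : (μ n)⁻¹ ≤ K := by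
    rw [inv_le_comm₀ (hpos n) hK0]; exact h6
  rw [show (M : ℝ) + C = √K by rw [hK, Real.sqrt_sq (by positivity)]]
  exact Real.sqrt_le_sqrt h7

/-- Among the combinations of the first n + 1 eigenvectors, one has √ρ u' free of the 2M + 1 lowest
frequencies. Its derivative is at least (M + 1)‖u‖, whereas the span of these eigenvectors bounds
the form by (μ n)⁻¹‖u‖². -/
theorem exists_le_eigenvalue (hρ : HasTDeriv ρ.cmap ρ') (hc : 0 ≤ c)
    (h : ∀ n, green ρ c (b n) = μ n • b n) (hμ : Antitone μ) (hpos : ∀ n, 0 < μ n) :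
    ∃ C : ℝ, 0 ≤ C ∧ ∀ n M : ℕ, 2 * M < n → (M : ℝ) + 1 - C ≤ √(μ n)⁻¹ := by
  obtain ⟨d, hd, H⟩ := isWeakDeriv_toL2Isometry hρ
  refine ⟨d, hd, fun n M hn => ?_⟩
  obtain ⟨a, ha, hort⟩ := exists_combination_orthogonal
    (fun j : Fin (n + 1) => toL2Isometry ρ (b j))
    (fun k : Finset.Icc (-(M : ℤ)) M => casBasis k) (by simp; omega)
  have hon : Orthonormal ℝ (fun j : Fin (n + 1) => b j) :=
    b.orthonormal.comp _ Fin.val_injective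
  set u : EnergySpace ρ := ∑ j, a j • b j with hu
  set v : EnergySpace ρ := ∑ j, (a j * (μ j)⁻¹) • b j with hv
  have hgv : green ρ c v = u := by
    rw [hv, hu, map_sum]
    refine Finset.sum_congr rfl fun j _ => ?_
    rw [map_smul, h, smul_smul, mul_assoc, inv_mul_cancel₀ (hpos j).ne', mul_one]
  have hju : toL2Isometry ρ u = ∑ j, a j • toL2Isometry ρ (b j) := by
    rw [hu, map_sum]
    simp only [map_smul]
  have hu2 : ‖u‖ ^ 2 = ∑ j, a j * a j := by
    rw [← real_inner_self_eq_norm_sq, hu, hon.inner_sum]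
    simp
  have hu0 : 0 < ‖u‖ ^ 2 := by
    rw [hu2]
    obtain ⟨j, hj⟩ := Function.ne_iff.1 ha
    exact Finset.sum_pos' (fun _ _ => mul_self_nonneg _) ⟨j, Finset.mem_univ _, by
      exact mul_self_pos.2 hj⟩
  have huv : inner ℝ u v ≤ (μ n)⁻¹ * ‖u‖ ^ 2 := by
    rw [hu2, hu, hv, hon.inner_sum, Finset.mul_sum]
    refine Finset.sum_le_sum fun j _ => ?_
    have h1 : (μ j)⁻¹ ≤ (μ n)⁻¹ := inv_anti₀ (hpos n) (hμ (Nat.lt_succ_iff.1 j.2))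
    simp only [conj_trivial]
    nlinarith [mul_le_mul_of_nonneg_left h1 (mul_self_nonneg (a j))]
  set α := formInv ρ c (embed ρ v) with hα
  have h1 := norm_sq_le_inner_form (ρ := ρ) hc α
  rw [hα, form_formInv hc, ← hα, real_inner_comm, hα, ← inner_green_self, hgv, ← hα] at h1
  have h2 := isWeakDeriv_flux_green hc v
  rw [hgv, ← hα] at h2
  obtain ⟨h', hd', hn'⟩ := H h2
  have h3 := hd'.mul_norm_le (M := M) (fun k hk => by
    rw [← inner_casBasis, hju]
    exact hort ⟨k, Finset.mem_Icc.2 (abs_le.1 hk)⟩)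
  rw [norm_toL2Isometry] at h3
  have hup : 0 < ‖u‖ := by
    by_contra hcon
    rw [le_antisymm (not_lt.1 hcon) (norm_nonneg u)] at hu0
    simp at hu0
  have h4 : ‖α‖ ≤ √(μ n)⁻¹ * ‖u‖ := by
    rw [← Real.sqrt_sq (norm_nonneg u), ← Real.sqrt_mul (inv_pos.2 (hpos n)).le]
    exact Real.le_sqrt_of_sq_le (h1.trans huv)
  have h5 : ((M : ℝ) + 1 - d) * ‖u‖ ≤ √(μ n)⁻¹ * ‖u‖ := by linarith
  exact le_of_mul_le_mul_right h5 hup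

theorem isEquivalent_sqrt_eigenvalue (hρ : HasTDeriv ρ.cmap ρ') (hc : 0 ≤ c)
    (h : ∀ n, green ρ c (b n) = μ n • b n) (hμ : Antitone μ) (hpos : ∀ n, 0 < μ n) :
    (fun n => √(μ n)⁻¹) ~[atTop] (fun n : ℕ => 2⁻¹ * ((n : ℝ) + 1)) := by
  obtain ⟨C, hC, H⟩ := exists_eigenvalue_le hρ hc h hμ hpos
  obtain ⟨D, hD, H'⟩ := exists_le_eigenvalue hρ hc h hμ hpos
  have hb : ∀ n : ℕ, |√(μ n)⁻¹ - 2⁻¹ * ((n : ℝ) + 1)| ≤ C + D + 1 := fun n => by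
    rw [abs_le]
    constructor
    · rcases Nat.eq_zero_or_pos n with rfl | hn
      · have := Real.sqrt_nonneg (μ 0)⁻¹
        rw [Nat.cast_zero]; linarith
      · have h1 := H' n ((n - 1) / 2) (by omega)
        have h2 : n ≤ 2 * ((n - 1) / 2) + 2 := by omega
        have h3 : (n : ℝ) ≤ 2 * ((n - 1) / 2 : ℕ) + 2 := by exact_mod_cast h2
        linarith
    · have h1 := H n (n / 2 + 1) (by omega)
      have h2 : 2 * (n / 2) ≤ n := by omega
      have h3 : 2 * ((n / 2 : ℕ) : ℝ) ≤ n := by exact_mod_cast h2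
      push_cast at h1
      linarith
  have h1 : ((fun n => √(μ n)⁻¹) - fun n : ℕ => 2⁻¹ * ((n : ℝ) + 1)) =O[atTop]
      (fun _ => (1 : ℝ)) :=
    IsBigO.of_bound (C + D + 1) (Eventually.of_forall fun n => by
      rw [norm_one, mul_one]; exact hb n)
  refine h1.trans_isLittleO (isLittleO_const_left.2 (Or.inr ?_))
  refine tendsto_norm_atTop_atTop.comp ?_
  exact (tendsto_atTop_add_const_right _ _ tendsto_natCast_atTop_atTop).const_mul_atTop
    (by norm_num)

theorem isEquivalent_eigenvalue (hρ : HasTDeriv ρ.cmap ρ') (hc : 0 ≤ c)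
    (h : ∀ n, green ρ c (b n) = μ n • b n) (hμ : Antitone μ) (hpos : ∀ n, 0 < μ n) :
    (fun n => (μ n)⁻¹) ~[atTop] (fun n : ℕ => 4⁻¹ * ((n : ℝ) + 1) ^ 2) := by
  have h1 := (isEquivalent_sqrt_eigenvalue hρ hc h hμ hpos).pow 2
  convert h1 using 1
  · funext n
    simp only [Pi.pow_apply]
    exact (Real.sq_sqrt (inv_pos.2 (hpos n)).le).symm
  · funext n
    simp only [Pi.pow_apply]
    ring

theorem summable_eigenvalue (hρ : HasTDeriv ρ.cmap ρ') (hc : 0 ≤ c)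
    (h : ∀ n, green ρ c (b n) = μ n • b n) (hμ : Antitone μ) (hpos : ∀ n, 0 < μ n) :
    Summable μ := by
  have h1 := (isEquivalent_eigenvalue hρ hc h hμ hpos).inv.isBigO
  refine summable_of_isBigO_nat (g := fun n : ℕ => (4⁻¹ * ((n : ℝ) + 1) ^ 2)⁻¹) ?_ ?_
  · have h2 := (summable_nat_add_iff 1).2 (Real.summable_one_div_nat_pow (p := 2).2 one_lt_two)
    refine (h2.mul_left 4).congr fun n => ?_
    rw [mul_inv, inv_inv, one_div]; push_cast; rfl
  · exact h1.congr_left fun n => inv_inv (μ n)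

end Weyl

theorem exists_green_eigenbasis (ρ : Density) {c : ℝ} (hc : 0 ≤ c) :
    ∃ (b : HilbertBasis ℕ ℝ (EnergySpace ρ)) (μ : ℕ → ℝ), (∀ n, 0 < μ n) ∧ Antitone μ ∧
      ∀ n, green ρ c (b n) = μ n • b n :=
  exists_eigenbasis (isCompactOperator_green c) (inner_green_left hc)
    (fun _ hx => inner_green_self_pos hc hx) (not_finiteDimensional ρ)

theorem isEigenbasis_of_green (hρ : HasTDeriv ρ.cmap ρ') {c : ℝ} (hc : 0 ≤ c)
    {b : HilbertBasis ℕ ℝ (EnergySpace ρ)} {μ : ℕ → ℝ} (hpos : ∀ n, 0 < μ n) (hμ : Antitone μ)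
    (h : ∀ n, green ρ c (b n) = μ n • b n) :
    IsEigenbasis (opExpr c ρ) b fun n => (μ n)⁻¹ where
  pos n := inv_pos.2 (hpos n)
  mono _ _ hmn := inv_anti₀ (hpos _) (hμ hmn)
  eigen n := (inducedGraph_iff hρ hc _ _).2 (by
    rw [map_smul, h, smul_smul, inv_mul_cancel₀ (hpos n).ne', one_smul])

end EnergySpace

theorem opExpr_zero (ρ : Density) : opExpr 0 ρ = sturmLiouvilleExpr ρ := by
  funext φ x
  simp [opExpr, sturmLiouvilleExpr]

/-! ### Lipschitz bounds -/

theorem exists_coe_eq (x : Torus) : ∃ s : ℝ, |s| ≤ Real.pi ∧ (s : Torus) = x := by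
  obtain ⟨s, hs⟩ := (AddCircle.equivIoc (2 * Real.pi) (-Real.pi)).symm.surjective x
  have h1 := s.2.1
  have h2 := s.2.2
  exact ⟨s, abs_le.2 ⟨h1.le, by linarith⟩, hs⟩

/-- The factor π/2 compares arc length with the chord: |sin(s/2)| ≥ |s|/π for |s| ≤ π. -/
theorem HasTDeriv.lipBound {F G : C(Torus, ℝ)} (h : HasTDeriv F G) :
    LipBound F (Real.pi / 2 * ‖G‖) := fun x y => by
  obtain ⟨s, hs, hxy⟩ := exists_coe_eq (x - y)
  have h1 := h.abs_sub_le x s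
  rw [hxy, sub_sub_cancel, abs_sub_comm] at h1
  refine h1.trans ?_
  have hpi := Real.pi_pos
  have h2 : 2 / Real.pi * |s / 2| ≤ |Real.sin (s / 2)| :=
    Real.mul_abs_le_abs_sin (by rw [abs_div, abs_two]; linarith)
  rw [chord_eq_sub, ← hxy, chord_coe_zero, abs_mul, abs_two]
  rw [abs_div, abs_two] at h2
  have h3 : |s| ≤ Real.pi * |Real.sin (s / 2)| := by
    have h4 := mul_le_mul_of_nonneg_left h2 hpi.le
    have h5 : Real.pi * (2 / Real.pi * (|s| / 2)) = |s| := by field_simp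
    linarith
  calc ‖G‖ * |s| ≤ ‖G‖ * (Real.pi * |Real.sin (s / 2)|) := by gcongr
    _ = _ := by ring

theorem LipBound.mono {f : Torus → ℝ} {K K' : ℝ} (h : LipBound f K) (hK : K ≤ K') :
    LipBound f K' := fun x y =>
  (h x y).trans (mul_le_mul_of_nonneg_right hK (chord_nonneg x y))

theorem SupBound.lipBound {ι : Type*} {w : ι → ℝ} {k : ℕ} : ∀ {s : ℕ} {F : ι → C(Torus, ℝ)},
    SupBound w s (k + 1) F → ∃ C : ℝ, ∀ j, LipBound (tderiv^[k] (F j)) (C * w j ^ (s + k + 1)) := by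
  induction k with
  | zero =>
    intro s F ⟨_, G, hG, C, hC⟩
    refine ⟨Real.pi / 2 * C, fun j => (hG j).lipBound.mono ?_⟩
    rw [mul_assoc]
    exact mul_le_mul_of_nonneg_left (hC j) (by positivity)
  | succ k ih =>
    intro s F ⟨_, G, hG, hb⟩
    obtain ⟨C, hC⟩ := ih hb
    refine ⟨C, fun j => ?_⟩
    rw [Function.iterate_succ_apply, (hG j).tderiv_eq, show s + (k + 1) + 1 = s + 1 + k + 1 by ring]
    exact hC j

theorem SupBound.of_le {ι : Type*} {w : ι → ℝ} {s k l : ℕ} {F : ι → C(Torus, ℝ)}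
    (h : SupBound w s l F) (hkl : k ≤ l) : SupBound w s k F := by
  induction l, hkl using Nat.le_induction with
  | base => exact h
  | succ l _ ih => exact ih h.of_succ

/-! ### Regularity of the eigenfunctions -/

theorem Density.tContDiff_invSqrt_sq {ρ : Density} {n : ℕ∞} (h : TContDiff n ρ.toFun) :
    TContDiff n ⇑(ρ.invSqrt * ρ.invSqrt) := by
  have e : (⇑(ρ.invSqrt * ρ.invSqrt) : Torus → ℝ) = fun x => (ρ.toFun x)⁻¹ := funext fun x => by
    change (Real.sqrt (ρ.toFun x))⁻¹ * (Real.sqrt (ρ.toFun x))⁻¹ = _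
    rw [← mul_inv, Real.mul_self_sqrt (ρ.pos x).le]
  rw [e]
  exact ContDiff.inv h fun t => (ρ.pos t).ne'

namespace EnergySpace

variable {ρ : Density} {c : ℝ} {b : HilbertBasis ℕ ℝ (EnergySpace ρ)} {μ : ℕ → ℝ}

/-- Eigenvectors are normalised through their derivatives, so in L² they themselves are of size
ϰ^{-1/2}. This gain makes the exponents in the final bounds come out right. -/
theorem norm_val_le (hc : 0 ≤ c) (h : ∀ n, green ρ c (b n) = μ n • b n) :
    ∃ C : ℝ, 0 ≤ C ∧ ∀ n, ‖(b n).val‖ ≤ C * √(μ n) := by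
  refine ⟨‖ρ.invSqrt‖ * ‖form ρ c‖, by positivity, fun n => ?_⟩
  have h1 := norm_embed_sq_le hc (b n)
  rw [h, inner_smul_left, real_inner_self_eq_norm_sq, b.orthonormal.1] at h1
  simp only [conj_trivial, one_pow, mul_one] at h1
  have h2 : ‖embed ρ (b n)‖ ≤ ‖form ρ c‖ * √(μ n) := by
    rw [← Real.sqrt_sq (norm_nonneg (form ρ c)), ← Real.sqrt_mul (sq_nonneg _)]
    exact Real.le_sqrt_of_sq_le h1
  rw [val_eq_embed, mul_assoc]
  exact (norm_mulC_le _ _).trans (by gcongr)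

theorem norm_wderiv_le (u : EnergySpace ρ) : ‖u.wderiv‖ ≤ ‖ρ.invSqrt‖ * ‖u‖ := by
  rw [wderiv_eq, ← norm_toL2Isometry u]
  exact norm_mulC_le _ _

theorem isWeakDeriv_flux_eigenfunction (hc : 0 ≤ c) (hpos : ∀ n, 0 < μ n)
    (h : ∀ n, green ρ c (b n) = μ n • b n) :
    ∃ k : ℕ → ℝ, (∃ C : ℝ, ∀ n, |k n| ≤ C) ∧ ∀ n, IsWeakDeriv (flux ρ (b n))
      ((-(2 * Real.pi * c)) • mulC ρ.cmap (hilb (flux ρ (b n)))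
        + (-1 : ℝ) • mulC ρ.cmap ((μ n)⁻¹ • (b n).val) + k n • toL2 ρ.cmap) := by
  have H : ∀ n, ∃ k : ℝ, |k| ≤ 2 * Real.pi * c * (‖toL2 ρ.cmap‖ * ‖ρ.sqrt‖) ∧
      IsWeakDeriv (flux ρ (b n)) ((-(2 * Real.pi * c)) • mulC ρ.cmap (hilb (flux ρ (b n)))
        + (-1 : ℝ) • mulC ρ.cmap ((μ n)⁻¹ • (b n).val) + k • toL2 ρ.cmap) := by
    intro n
    obtain ⟨v, v₁, F₁, hv, h1, h2, k, hk⟩ := exists_green_rep hc ((μ n)⁻¹ • b n)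
    have e0 : green ρ c ((μ n)⁻¹ • b n) = b n := by
      rw [map_smul, h, smul_smul, inv_mul_cancel₀ (hpos n).ne', one_smul]
    rw [e0] at hv
    have e1 : (b n).wderiv = toL2 v₁ := (b n).isWeakDeriv.unique (hv ▸ h1.isWeakDeriv)
    have e2 : flux ρ (b n) = toL2 (ρ.cmap * v₁) := by rw [flux_eq', e1, mulC_toL2]
    have e3 : ((μ n)⁻¹ • b n).val = (μ n)⁻¹ • (b n).val := rfl
    rw [e3, ← e2] at hk
    have e4 := congrArg (mulC ρ.cmap) hk
    rw [map_sub, map_neg, map_smul, map_add, map_smul _ k, ← mulC_mul, mul_comm ρ.cmap (_ * _),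
      ρ.invSqrt_mul_invSqrt_mul_cmap, mulC_one, mulC_toL2, mul_one] at e4
    have e5 := h2.isWeakDeriv
    have e6 : toL2 F₁ = (-(2 * Real.pi * c)) • mulC ρ.cmap (hilb (flux ρ (b n)))
        + (-1 : ℝ) • mulC ρ.cmap ((μ n)⁻¹ • (b n).val) + (-k) • toL2 ρ.cmap := by
      rw [neg_smul, neg_smul, neg_smul, one_smul]
      rw [← sub_eq_zero] at e4 ⊢
      rw [← neg_eq_zero, ← e4]
      abel
    rw [← e2] at e5
    -- The derivative of the flux has mean zero, and ∫ φρ = 0 while ∫ ρ = 1. The eigenvalue term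
    -- thus drops out of the constant, which stays bounded in n.
    have e7 : k = -(2 * Real.pi * c) * inner ℝ (toL2 ρ.cmap) (hilb (flux ρ (b n))) := by
      have e8 := e5.casCoeff_zero
      rw [casCoeff_zero_eq] at e8
      have e9 := (mul_eq_zero.1 e8).resolve_left casNorm_pos.ne'
      rw [e6, inner_add_right, inner_add_right, inner_smul_right, inner_smul_right,
        inner_smul_right, ← inner_mulC_left, ← inner_mulC_left, mulC_toL2, mul_one,
        inner_smul_right, inner_cmap_val, real_inner_comm (toL2 ρ.cmap) (toL2 1), ρ.inner_cmap_one] at e9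
      linarith
    refine ⟨-k, ?_, e6 ▸ e5⟩
    have hpi := Real.pi_pos
    rw [abs_neg, e7, abs_mul, abs_neg, abs_of_nonneg (by positivity : 0 ≤ 2 * Real.pi * c)]
    gcongr
    refine (abs_real_inner_le_norm _ _).trans ?_
    gcongr
    refine (norm_hilb_le _).trans ((norm_flux_le _).trans ?_)
    rw [b.orthonormal.1, mul_one]
  choose k hk1 hk2 using H
  exact ⟨k, ⟨_, hk1⟩, hk2⟩

/-- The flux is O(1) in L², and its equation shows that each further derivative costs one factor w,
for as long as ρ can be differentiated. The embedding costs one more factor on φ', which is exactly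
the bound w for φ'; and φ itself is bounded. -/
theorem exists_supBound_eigenfunction (hc : 0 ≤ c) (hpos : ∀ n, 0 < μ n) (hμ : Antitone μ)
    (h : ∀ n, green ρ c (b n) = μ n • b n) {m : ℕ} (hρ : TContDiff (m : ℕ∞) ρ.toFun) :
    ∃ v : ℕ → C(Torus, ℝ), (∀ n, (b n).val = toL2 (v n)) ∧
      SupBound (fun n => √(μ 0 * (μ n)⁻¹)) 0 (m + 1) v := by
  -- The square root of the eigenvalue, normalised by the first one so that w ≥ 1.
  set w : ℕ → ℝ := fun n => √(μ 0 * (μ n)⁻¹) with hw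
  have hw1 : ∀ n, 1 ≤ w n := fun n => by
    refine Real.one_le_sqrt.2 ?_
    rw [← div_eq_mul_inv, one_le_div (hpos n)]
    exact hμ (Nat.zero_le n)
  have hw2 : ∀ n, w n ^ 2 = μ 0 * (μ n)⁻¹ := fun n =>
    Real.sq_sqrt (mul_nonneg (hpos 0).le (inv_pos.2 (hpos n)).le)
  have hκ : ∀ n, |(μ n)⁻¹| ≤ (μ 0)⁻¹ * w n ^ 2 := fun n => by
    rw [hw2, ← mul_assoc, inv_mul_cancel₀ (hpos 0).ne', one_mul, abs_of_pos (inv_pos.2 (hpos n))]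
  obtain ⟨D, hD0, hD⟩ := norm_val_le hc h
  have hκφ : ∃ C : ℝ, ∀ n, ‖(μ n)⁻¹ • (b n).val‖ ≤ C * w n ^ 1 := by
    refine ⟨D * √(μ 0)⁻¹, fun n => ?_⟩
    rw [norm_smul, Real.norm_of_nonneg (inv_pos.2 (hpos n)).le, pow_one]
    have e1 : √(μ 0)⁻¹ * w n = √(μ n)⁻¹ := by
      rw [← Real.sqrt_mul (inv_pos.2 (hpos 0)).le, ← mul_assoc, inv_mul_cancel₀ (hpos 0).ne',
        one_mul]
    have e2 : (μ n)⁻¹ * √(μ n) = √(μ n)⁻¹ := by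
      have := (Real.sqrt_pos.2 (hpos n)).ne'
      rw [Real.sqrt_inv, ← Real.mul_self_sqrt (hpos n).le, Real.sqrt_mul_self (Real.sqrt_nonneg _)]
      field_simp
    calc (μ n)⁻¹ * ‖(b n).val‖ ≤ (μ n)⁻¹ * (D * √(μ n)) :=
          mul_le_mul_of_nonneg_left (hD n) (inv_pos.2 (hpos n)).le
      _ = D * (√(μ 0)⁻¹ * w n) := by rw [e1, ← e2]; ring
      _ = _ := by ring
  obtain ⟨k, ⟨K, hK⟩, hflux⟩ := isWeakDeriv_flux_eigenfunction hc hpos h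
  have hg0 : ∃ C : ℝ, ∀ n, ‖flux ρ (b n)‖ ≤ C * w n ^ 0 := ⟨‖ρ.sqrt‖, fun n => by
    have := norm_flux_le (b n)
    rwa [b.orthonormal.1, mul_one, ← mul_one ‖ρ.sqrt‖, ← pow_zero (w n)] at this⟩
  have hwd : ∀ n, (b n).wderiv = mulC (ρ.invSqrt * ρ.invSqrt) (flux ρ (b n)) := fun n =>
    wderiv_eq_flux (b n)
  -- In the flux equation ϰφ is of size w, and its derivative ϰφ' is of size w² times the bound
  -- known for φ'. The term is therefore exactly of the order allowed for the derivative of the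
  -- flux; the Hilbert term and the constant have a power of w to spare.
  have hg : ∀ i ≤ m + 1, SobBound w 0 i (fun n => flux ρ (b n)) := by
    intro i
    induction i with
    | zero => exact fun _ => hg0
    | succ i ih =>
      intro hi
      have hi' : i ≤ m := by omega
      have hρi : TContDiff (i : ℕ∞) ρ.cmap := TContDiff.of_le hρ (by exact_mod_cast hi')
      have b0 := ih (by omega)
      have b1 : SobBound w 0 i (fun n => (b n).wderiv) := by
        simp only [hwd]
        exact b0.mulC hw1 (Density.tContDiff_invSqrt_sq hρi)
      have b2 : SobBound w 1 (i + 1) (fun n => (μ n)⁻¹ • (b n).val) :=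
        ⟨hκφ, _, fun n => (b n).isWeakDeriv.smul _, b1.smul ⟨_, hκ⟩⟩
      have b3 := ((b0.hilb.mulC hw1 hρi).const_smul (-(2 * Real.pi * c))).weaken hw1
      have b4 := (b2.of_succ.mulC hw1 hρi).const_smul (-1)
      have b5 := ((sobBound_const hw1 hρi 0).smul (d := 0) (c := k)
        ⟨K, fun n => by rw [pow_zero, mul_one]; exact hK n⟩).weaken hw1
      exact ⟨hg0, _, hflux, (b3.add b4).add b5⟩
  obtain ⟨G, hG, hGb⟩ := (hg (m + 1) le_rfl).exists_supBound hw1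
  obtain ⟨C, hC, hS⟩ := IsWeakDeriv.exists_continuous
  choose v hv hvn using fun n => hS (b n).isWeakDeriv
  have hd : ∀ n, HasTDeriv (v n) (ρ.invSqrt * ρ.invSqrt * G n) := fun n => by
    refine IsWeakDeriv.hasTDeriv ?_
    rw [← hv, ← mulC_toL2, ← hG, ← hwd]
    exact (b n).isWeakDeriv
  refine ⟨v, hv, ⟨C * (D * √(μ 0) + ‖ρ.invSqrt‖), fun n => ?_⟩, _, hd,
    hGb.mul hw1 (Density.tContDiff_invSqrt_sq hρ)⟩
  rw [pow_zero, mul_one]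
  refine (hvn n).trans ?_
  gcongr
  · refine (hD n).trans ?_
    gcongr
    exact hμ (Nat.zero_le n)
  · have := norm_wderiv_le (b n)
    rwa [b.orthonormal.1, mul_one] at this

theorem exists_lipBound_eigenfunction (hpos : ∀ n, 0 < μ n) {m : ℕ} {v : ℕ → C(Torus, ℝ)}
    (h : SupBound (fun n => √(μ 0 * (μ n)⁻¹)) 0 (m + 1) v) :
    ∃ C : ℕ → ℝ, ∀ k ≤ m, ∀ n,
      LipBound (tderiv^[k] (v n)) (C k * (μ n)⁻¹ ^ (((k : ℝ) + 1) / 2)) := by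
  have H : ∀ k ≤ m, ∃ C : ℝ, ∀ n,
      LipBound (tderiv^[k] (v n)) (C * (μ n)⁻¹ ^ (((k : ℝ) + 1) / 2)) := by
    intro k hk
    obtain ⟨C, hC⟩ := (h.of_le (Nat.succ_le_succ hk)).lipBound
    -- Undoes the normalisation of w.
    refine ⟨C * √(μ 0) ^ (k + 1), fun n => (hC n).mono (le_of_eq ?_)⟩
    have e : (μ n)⁻¹ ^ (((k : ℝ) + 1) / 2) = √(μ n)⁻¹ ^ (k + 1) := by
      rw [Real.sqrt_eq_rpow, ← Real.rpow_natCast, ← Real.rpow_mul (inv_pos.2 (hpos n)).le]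
      congr 1
      push_cast; ring
    rw [e, mul_assoc, ← mul_pow, ← Real.sqrt_mul (hpos 0).le, zero_add]
  choose! C hC using H
  exact ⟨C, hC⟩

end EnergySpace

end CircleGas

end

/-! ### The main theorem -/

open CircleGas
theorem mainTheorem3 (β : ℝ) (hβ : 0 < β) (m : ℕ) (hm : 1 ≤ m) (V : Torus → ℝ)
    (hV : IsCmLip m V) :
    (∃ ρ : Density, IsEquilibriumDensity β V ρ) ∧
    ∀ ρ : Density, IsEquilibriumDensity β V ρ →
      ∃ (φ : ℕ → Torus → ℝ) (b : HilbertBasis ℕ ℝ (EnergySpace ρ)) (κ : ℕ → ℝ) (α : ℝ),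
        -- the functions `φ j` form an orthonormal eigenbasis
        (∀ j, ∀ᵐ x, (b j).val x = φ j x) ∧
        IsEigenbasis (opExpr β ρ) b κ ∧
        -- asymptotics, with the constant of the Sturm–Liouville operator
        0 < α ∧
        κ ~[atTop] (fun j : ℕ => α * ((j : ℝ) + 1) ^ 2) ∧
        (∃ (e : HilbertBasis ℕ ℝ (EnergySpace ρ)) (l : ℕ → ℝ),
          IsEigenbasis (sturmLiouvilleExpr ρ) e l ∧
          l ~[atTop] (fun j : ℕ => α * ((j : ℝ) + 1) ^ 2)) ∧
        -- the inverse operator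
        (∃ G : EnergySpace ρ →L[ℝ] EnergySpace ρ,
          (∀ u f : EnergySpace ρ, InducedGraph (opExpr β ρ) u f ↔ u = G f) ∧
          IsTraceClass G ∧
          ∀ ψ : EnergySpace ρ, HasSum (fun j => (κ j)⁻¹ * |inner ℝ ψ (b j)| ^ 2) (inner ℝ ψ (G ψ))) ∧
        -- regularity
        (∀ j, TContDiff m (φ j)) ∧
        ∃ C : ℕ → ℝ, ∀ k ≤ m, ∀ j,
          LipBound (tderiv^[k] (φ j)) (C k * κ j ^ (((k : ℝ) + 1) / 2)) := by
  have hVc : Continuous V := hV.1.continuous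
  obtain ⟨ρ₀, hρ₀⟩ := exists_eulerLagrange hβ hVc
  refine ⟨⟨ρ₀, hρ₀.isEquilibriumDensity hβ hVc⟩, fun ρ hρ => ?_⟩
  have hreg : TContDiff (m : ℕ∞) ρ.toFun :=
    (hρ₀.of_isEquilibriumDensity hβ hVc hρ).tContDiff hV.1
  obtain ⟨ρ', hd⟩ := TContDiff.hasTDeriv (F := ρ.cmap) (hreg.of_le (by exact_mod_cast hm))
  obtain ⟨b, μ, hpos, hμ, hb⟩ := EnergySpace.exists_green_eigenbasis ρ hβ.le
  -- The coupling constant 0 gives the Sturm–Liouville operator.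
  obtain ⟨e, l, hlpos, hl, he⟩ := EnergySpace.exists_green_eigenbasis ρ le_rfl
  obtain ⟨v, hv, hsup⟩ := EnergySpace.exists_supBound_eigenfunction hβ.le hpos hμ hb hreg
  refine ⟨fun j => v j, b, fun j => (μ j)⁻¹, 4⁻¹, fun j => hv j ▸ coeFn_toL2 (v j),
    EnergySpace.isEigenbasis_of_green hd hβ.le hpos hμ hb, by norm_num,
    EnergySpace.isEquivalent_eigenvalue hd hβ.le hb hμ hpos,
    ⟨e, fun j => (l j)⁻¹, opExpr_zero ρ ▸ EnergySpace.isEigenbasis_of_green hd le_rfl hlpos hl he,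
      EnergySpace.isEquivalent_eigenvalue hd le_rfl he hl hlpos⟩,
    ⟨EnergySpace.green ρ β, EnergySpace.inducedGraph_iff hd hβ.le,
      isTraceClass_of_eigenbasis (EnergySpace.inner_green_left hβ.le) hb hpos
        (EnergySpace.summable_eigenvalue hd hβ.le hb hμ hpos), fun ψ => ?_⟩,
    fun j => (hsup.of_succ).tContDiff j, EnergySpace.exists_lipBound_eigenfunction hpos hsup⟩
  simp only [inv_inv]
  exact hasSum_inner_eigenbasis (EnergySpace.inner_green_left hβ.le) hb ψ
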